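/- Let $d\ge 1$ and fix non-zero windows $g\in\mathcal S(\mathbb R^d)$ and $\Phi\in\mathcal S(\mathbb R^{2d})$. For $f\in\mathcal S'(\mathbb R^n)$ and a non-zero window $\gamma\in\mathcal S(\mathbb R^n)$ let $V_\gamma f(x,\xi)=\langle f,M_\xi T_x\gamma\rangle$, where $T_x\gamma(t)=\gamma(t-x)$, $M_\xi\gamma(t)=e^{2\pi i\xi t}\gamma(t)$, and $\langle\cdot,\cdot\rangle$ extends $\int f\,\overline{g}$ to $\mathcal S'\times\mathcal S$. For a weight $m$ on $\mathbb R^{2n}$ and $p,q\in[1,\infty]$ put $$\|f\|_{M^{p,q}_m}=\Big\|\,\xi\mapsto\big\|V_\gamma f(\cdot,\xi)\,m(\cdot,\xi)\big\|_{L^p(\mathbb R^n)}\Big\|_{L^q(\mathbb R^n)},\qquad M^{p,q}_m(\mathbb R^n)=\{f\in\mathcal S'(\mathbb R^n):\|f\|_{M^{p,q}_m}<\infty\},$$ with $\gamma=g$ for $n=d$ and $\gamma=\Phi$ for $n=2d$. For $s\in\mathbb R$ let $v_s(z)=(1+|z|^2)^{s/2}$, $z\in\mathbb R^{2d}$, and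 $(1\otimes v_s)(z,\zeta)=v_s(\zeta)$, $z,\zeta\in\mathbb R^{2d}$. For $\sigma\in\mathcal S'(\mathbb R^{2d})$ the Weyl operator $L_\sigma:\mathcal S(\mathbb R^d)\to\mathcal S'(\mathbb R^d)$ is defined by $$\langle L_\sigma f,h\rangle=\langle\sigma,W(h,f)\rangle,\qquad W(h,f)(x,\xi)=\int_{\mathbb R^d}h(x+\tfrac t2)\,\overline{f(x-\tfrac t2)}\,e^{-2\pi i\xi t}\,dt,\qquad f,h\in\mathcal S(\mathbb R^d).$$ Let $p_1,q_1,p_2,q_2,p,q\in[1,\infty]$, let a prime denote the conjugate exponent, and consider the conditions $$\min\Big\{\frac1{p_1}+\frac1{p_2'},\ \frac1{q_1}+\frac1{q_2'}\Big\}\ \ge\ \frac1{p'}+\frac1{q'}\qquad\text{and}\qquad q\le\min\{p_1',q_1',p_2,q_2\}.\tag{$*$}$$ (a) Let $s\ge 0$ and assume $(*)$. There is a constant $C<\infty$ such that, for every $\sigma\in M^{p,q}_{1\otimes v_s}(\mathbb R^{2d})$, the operator $L_\sigma$ extends to a linear operator $T:M^{p_1,q_1}_{v_s}(\mathbb R^d)\to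 M^{p_2,q_2}_{v_s}(\mathbb R^d)$ with $$\|Tf\|_{M^{p_2,q_2}_{v_s}}\le C\,\|\sigma\|_{M^{p,q}_{1\otimes v_s}}\,\|f\|_{M^{p_1,q_1}_{v_s}}\qquad\text{for all } f\in M^{p_1,q_1}_{v_s}(\mathbb R^d).$$ If $p_1,q_1<\infty$, then $T$ is the only bounded linear operator from $M^{p_1,q_1}_{v_s}$ to $M^{p_2,q_2}_{v_s}$ that extends $L_\sigma$. For all exponents, any two bounded linear extensions agree on the closure of $\mathcal S(\mathbb R^d)$ in $M^{p_1,q_1}_{v_s}$. (b) Conversely, if there is a constant $C<\infty$ such that $$\|L_\sigma f\|_{M^{p_2,q_2}}\le C\,\|\sigma\|_{M^{p,q}}\,\|f\|_{M^{p_1,q_1}}\qquad\text{for all } f\in\mathcal S(\mathbb R^d),\ \sigma\in\mathcal S'(\mathbb R^{2d})$$ (unweighted norms, $s=0$; a norm is $\infty$ outside its space, and $\infty\cdot 0=0$), then $(*)$ holds. -/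

import Mathlib

open MeasureTheory SchwartzMap Complex FourierTransform
open scoped ENNReal NNReal ComplexConjugate InnerProductSpace

set_option linter.unusedSectionVars false

noncomputable section

namespace WeylMod

variable {E : Type*} [NormedAddCommGroup E] [InnerProductSpace ℝ E] [FiniteDimensional ℝ E]
  [MeasurableSpace E] [BorelSpace E]

theorem norm_iteratedFDeriv_slice_le (F : 𝓢(E × E, ℂ)) (x : E) (n : ℕ) (t : E) :
    ‖iteratedFDeriv ℝ n (fun t => F (x, t)) t‖ ≤ ‖iteratedFDeriv ℝ n F (x, t)‖ := by
  have h1 : (fun t => F (x, t)) =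
      (fun z => F (z + (x, 0))) ∘ (ContinuousLinearMap.inr ℝ E E) := by
    ext t; simp
  have h2 : ContDiff ℝ n (fun z : E × E => F (z + (x, 0))) :=
    (F.smooth n).comp (contDiff_id.add contDiff_const)
  rw [h1, ContinuousLinearMap.iteratedFDeriv_comp_right _ h2 _ le_rfl]
  refine (ContinuousMultilinearMap.norm_compContinuousLinearMap_le _ _).trans ?_
  rw [iteratedFDeriv_comp_add_right]
  simp only [ContinuousLinearMap.inr_apply, Prod.mk_add_mk, zero_add, add_zero,
    Finset.prod_const, Finset.card_univ, Fintype.card_fin]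
  exact mul_le_of_le_one_right (norm_nonneg _)
    (pow_le_one₀ (norm_nonneg _) (ContinuousLinearMap.norm_inr_le_one ℝ E E))

/-- The slice `t ↦ F (x, t)` of a Schwartz function on `E × E`. -/
def slice (F : 𝓢(E × E, ℂ)) (x : E) : 𝓢(E, ℂ) where
  toFun t := F (x, t)
  smooth' := (F.smooth ⊤).comp (contDiff_const.prodMk contDiff_id)
  decay' k n := by
    obtain ⟨C, hC⟩ := F.decay' k n
    refine ⟨C, fun t => le_trans ?_ (hC (x, t))⟩
    gcongr
    · exact le_max_right ‖x‖ ‖t‖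
    · exact norm_iteratedFDeriv_slice_le F x n t

@[simp] theorem slice_apply (F : 𝓢(E × E, ℂ)) (x t : E) : slice F x t = F (x, t) := rfl

theorem pow_mul_seminorm_slice_le (F : 𝓢(E × E, ℂ)) (x : E) (j k n : ℕ) :
    ‖x‖ ^ j * SchwartzMap.seminorm ℂ k n (slice F x) ≤ SchwartzMap.seminorm ℂ (j + k) n F := by
  have h : SchwartzMap.seminorm ℂ k n (((‖x‖ ^ j : ℝ) : ℂ) • slice F x) ≤
      SchwartzMap.seminorm ℂ (j + k) n F := by
    refine SchwartzMap.seminorm_le_bound ℂ k n _ (apply_nonneg _ _) fun t => ?_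
    have e : (⇑(((‖x‖ ^ j : ℝ) : ℂ) • slice F x)) = ((‖x‖ ^ j : ℝ) : ℂ) • (fun t => F (x, t)) := rfl
    have hs : ContDiff ℝ n (fun t => F (x, t)) := (slice F x).smooth n
    rw [e, iteratedFDeriv_const_smul_apply hs.contDiffAt, norm_smul]
    simp only [ofReal_pow, norm_pow, norm_real, norm_norm]
    calc _ = ‖x‖ ^ j * ‖t‖ ^ k * ‖iteratedFDeriv ℝ n (fun t => F (x, t)) t‖ := by ring
      _ ≤ ‖(x, t)‖ ^ j * ‖(x, t)‖ ^ k * ‖iteratedFDeriv ℝ n F (x, t)‖ := by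
        gcongr
        · exact le_max_left ‖x‖ ‖t‖
        · exact le_max_right ‖x‖ ‖t‖
        · exact norm_iteratedFDeriv_slice_le F x n t
      _ ≤ _ := by
        rw [← pow_add]
        exact SchwartzMap.le_seminorm ℂ (j + k) n F (x, t)
  rw [map_smul_eq_mul] at h
  simpa using h

/-- The partial Fourier transform `(x, ξ) ↦ ∫ t, exp (-2 π i ⟨t, ξ⟩) F (x, t)`, as a function. -/
def partialFourierFun (F : 𝓢(E × E, ℂ)) (z : E × E) : ℂ := 𝓕 (slice F z.1) z.2

theorem partialFourierFun_decay (k : ℕ) :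
    ∃ (s : Finset (ℕ × ℕ)) (C : ℝ), 0 ≤ C ∧ ∀ (F : 𝓢(E × E, ℂ)) (z : E × E),
      ‖z‖ ^ k * ‖partialFourierFun F z‖ ≤ C * s.sup (schwartzSeminormFamily ℂ (E × E) ℂ) F := by
  -- continuity bound of the full Fourier transform on `𝓢(E, ℂ)`
  have key : ∀ m : ℕ, ∃ (s : Finset (ℕ × ℕ)) (C : ℝ), 0 ≤ C ∧ ∀ h : 𝓢(E, ℂ),
      SchwartzMap.seminorm ℂ m 0 (𝓕 h) ≤ C * ∑ i ∈ s, SchwartzMap.seminorm ℂ i.1 i.2 h := by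
    intro m
    have hc : Continuous ((SchwartzMap.seminorm ℂ m 0 : Seminorm ℂ 𝓢(E, ℂ)).comp
        (SchwartzMap.fourierTransformCLM ℂ : 𝓢(E, ℂ) →L[ℂ] 𝓢(E, ℂ)).toLinearMap) :=
      ((schwartz_withSeminorms ℂ E ℂ).continuous_seminorm (m, 0)).comp
        (SchwartzMap.fourierTransformCLM ℂ : 𝓢(E, ℂ) →L[ℂ] 𝓢(E, ℂ)).continuous
    obtain ⟨s, C, -, h⟩ := Seminorm.bound_of_continuous (schwartz_withSeminorms ℂ E ℂ) _ hc
    refine ⟨s, C, C.2, fun f => (h f).trans ?_⟩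
    rw [smul_apply, NNReal.smul_def, smul_eq_mul]
    gcongr
    exact Seminorm.finset_sup_apply_le (Finset.sum_nonneg fun i _ => apply_nonneg _ _) fun i hi =>
      Finset.single_le_sum (f := fun i : ℕ × ℕ => SchwartzMap.seminorm ℂ i.1 i.2 f)
        (fun i _ => apply_nonneg _ _) hi
  obtain ⟨s₀, C₀, hC₀, h₀⟩ := key 0
  obtain ⟨s₁, C₁, hC₁, h₁⟩ := key k
  refine ⟨(s₀.image fun i => (k + i.1, i.2)) ∪ (s₁.image fun i => (0 + i.1, i.2)),
    C₀ * s₀.card + C₁ * s₁.card, by positivity, fun F z => ?_⟩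
  set S := (s₀.image fun i => (k + i.1, i.2)) ∪ (s₁.image fun i => (0 + i.1, i.2)) with hS
  set Q := S.sup (schwartzSeminormFamily ℂ (E × E) ℂ) F with hQ
  have hQle : ∀ i ∈ S, SchwartzMap.seminorm ℂ i.1 i.2 F ≤ Q := fun i hi =>
    Seminorm.le_def.mp (Finset.le_sup (f := schwartzSeminormFamily ℂ (E × E) ℂ) hi) F
  have hQ0 : 0 ≤ Q := apply_nonneg _ _
  have a₀ : ‖z.1‖ ^ k * ‖partialFourierFun F z‖ ≤ C₀ * s₀.card * Q := by
    have := (SchwartzMap.norm_le_seminorm ℂ (𝓕 (slice F z.1)) z.2).trans (h₀ _)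
    calc _ ≤ ‖z.1‖ ^ k * (C₀ * ∑ i ∈ s₀, SchwartzMap.seminorm ℂ i.1 i.2 (slice F z.1)) := by
          gcongr; exact this
      _ = C₀ * ∑ i ∈ s₀, ‖z.1‖ ^ k * SchwartzMap.seminorm ℂ i.1 i.2 (slice F z.1) := by
          rw [Finset.mul_sum, Finset.mul_sum, Finset.mul_sum]
          exact Finset.sum_congr rfl fun i _ => by ring
      _ ≤ C₀ * ∑ i ∈ s₀, Q := by
          gcongr with i hi
          refine (pow_mul_seminorm_slice_le F z.1 k i.1 i.2).trans (hQle (k + i.1, i.2) ?_)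
          exact Finset.mem_union_left _ (Finset.mem_image_of_mem (fun i => (k + i.1, i.2)) hi)
      _ = _ := by rw [Finset.sum_const, nsmul_eq_mul]; ring
  have a₁ : ‖z.2‖ ^ k * ‖partialFourierFun F z‖ ≤ C₁ * s₁.card * Q := by
    have := (SchwartzMap.norm_pow_mul_le_seminorm ℂ (𝓕 (slice F z.1)) k z.2).trans (h₁ _)
    calc _ ≤ C₁ * ∑ i ∈ s₁, SchwartzMap.seminorm ℂ i.1 i.2 (slice F z.1) := this
      _ ≤ C₁ * ∑ i ∈ s₁, Q := by
          gcongr with i hi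
          have := pow_mul_seminorm_slice_le F z.1 0 i.1 i.2
          rw [pow_zero, one_mul] at this
          refine this.trans (hQle (0 + i.1, i.2) ?_)
          exact Finset.mem_union_right _ (Finset.mem_image_of_mem (fun i => (0 + i.1, i.2)) hi)
      _ = _ := by rw [Finset.sum_const, nsmul_eq_mul]; ring
  rw [add_mul]
  rcases le_total ‖z.1‖ ‖z.2‖ with h | h
  · rw [show ‖z‖ = ‖z.2‖ from max_eq_right h]
    have : 0 ≤ C₀ * s₀.card * Q := by positivity
    linarith
  · rw [show ‖z‖ = ‖z.1‖ from max_eq_left h]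
    have : 0 ≤ C₁ * s₁.card * Q := by positivity
    linarith

/-- The operation on Schwartz functions that corresponds to the derivative of the partial Fourier
transform in the direction `v`. -/
def partialFourierDeriv (v : E × E) : 𝓢(E × E, ℂ) →L[ℂ] 𝓢(E × E, ℂ) :=
  (SchwartzMap.evalCLM ℂ (E × E) ℂ (v.1, 0)) ∘L SchwartzMap.fderivCLM ℂ (E × E) ℂ +
  (-(2 * Real.pi * I) : ℂ) • SchwartzMap.smulLeftCLM ℂ fun z : E × E => ((⟪z.2, v.2⟫_ℝ : ℝ) : ℂ)

theorem partialFourierDeriv_apply (v : E × E) (F : 𝓢(E × E, ℂ)) (z : E × E) :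
    partialFourierDeriv v F z =
      fderiv ℝ F z (v.1, 0) + -(2 * Real.pi * I) * (((⟪z.2, v.2⟫_ℝ : ℝ) : ℂ) * F z) := by
  have h : Function.HasTemperateGrowth fun z : E × E => ((⟪z.2, v.2⟫_ℝ : ℝ) : ℂ) := by
    have := (Complex.ofRealCLM.comp ((innerSL ℝ v.2).comp
      (ContinuousLinearMap.snd ℝ E E))).hasTemperateGrowth
    convert this using 2 with z
    simp [real_inner_comm]
  simp [partialFourierDeriv, SchwartzMap.smulLeftCLM_apply_apply h]

/-- A real-linear map written in coordinates. -/
theorem eq_sum_coord (A : E × E →L[ℝ] ℂ) :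
    A = ∑ i, ((Module.finBasis ℝ (E × E)).coord i).toContinuousLinearMap.smulRight
      (A (Module.finBasis ℝ (E × E) i)) := by
  refine ContinuousLinearMap.ext fun v => ?_
  conv_lhs => rw [← (Module.finBasis ℝ (E × E)).sum_repr v, map_sum]
  simp

theorem hasFDerivAt_partialFourierFun (F : 𝓢(E × E, ℂ)) (z : E × E) :
    HasFDerivAt (partialFourierFun F)
      (∑ i, ((Module.finBasis ℝ (E × E)).coord i).toContinuousLinearMap.smulRight
        (partialFourierFun (partialFourierDeriv (Module.finBasis ℝ (E × E) i) F) z)) z := by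
  set b := Module.finBasis ℝ (E × E) with hb
  set c : Fin (Module.finrank ℝ (E × E)) → (E × E →L[ℝ] ℝ) :=
    fun i => (b.coord i).toContinuousLinearMap with hc
  set D := fun i => partialFourierDeriv (b i) F with hD
  have e1 : ∀ (H : 𝓢(E × E, ℂ)) (w : E × E), partialFourierFun H w =
      ∫ t, (Real.fourierChar (-(⟪t, w.2⟫_ℝ)) : ℂ) * H (w.1, t) := by
    intro H w
    rw [partialFourierFun, SchwartzMap.fourier_coe, Real.fourier_eq]
    rfl
  have hint : ∀ (H : 𝓢(E × E, ℂ)) (w : E × E),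
      Integrable fun t => (Real.fourierChar (-(⟪t, w.2⟫_ℝ)) : ℂ) * H (w.1, t) := fun H w =>
    (Real.fourierIntegral_convergent_iff w.2).2 (slice H w.1).integrable
  set N := (volume : Measure E).integrablePower with hN
  have hB : ∀ H : 𝓢(E × E, ℂ), ∃ B : ℝ, ∀ w : E × E, (1 + ‖w‖) ^ N * ‖H w‖ ≤ B := by
    refine fun H => ⟨2 ^ N * (Finset.Iic (N, 0)).sup (fun m => SchwartzMap.seminorm ℂ m.1 m.2) H,
      fun w => ?_⟩
    have := SchwartzMap.one_add_le_sup_seminorm_apply (𝕜 := ℂ) (m := (N, 0)) (k := N) (n := 0)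
      le_rfl le_rfl H w
    rwa [norm_iteratedFDeriv_zero] at this
  choose B hB using fun i => hB (D i)
  have e2 : (∑ i, (c i).smulRight (partialFourierFun (D i) z)) =
      ∫ t, ∑ i, (c i).smulRight ((Real.fourierChar (-(⟪t, z.2⟫_ℝ)) : ℂ) * D i (z.1, t)) := by
    rw [integral_finsetSum]
    · refine Finset.sum_congr rfl fun i _ => ?_
      rw [e1]
      exact ((ContinuousLinearMap.smulRightL ℝ (E × E) ℂ (c i)).integral_comp_comm
        (hint (D i) z)).symm
    · exact fun i _ => (ContinuousLinearMap.smulRightL ℝ (E × E) ℂ (c i)).integrable_comp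
        (hint (D i) z)
  rw [e2, show partialFourierFun F = _ from funext (e1 F)]
  refine hasFDerivAt_integral_of_dominated_of_fderiv_le (s := Set.univ)
    (F' := fun w t => ∑ i, (c i).smulRight ((Real.fourierChar (-(⟪t, w.2⟫_ℝ)) : ℂ) * D i (w.1, t)))
    (bound := fun t => (∑ i, ‖c i‖ * B i) * (1 + ‖t‖) ^ (-(N : ℝ))) Filter.univ_mem ?_ ?_ ?_ ?_ ?_ ?_
  · exact .of_forall fun w => (hint F w).aestronglyMeasurable
  · exact hint F z
  · exact Finset.aestronglyMeasurable_fun_sum _ fun i _ =>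
      ((ContinuousLinearMap.smulRightL ℝ (E × E) ℂ (c i)).integrable_comp
        (hint (D i) z)).aestronglyMeasurable
  · refine .of_forall fun t w _ => ?_
    rw [Finset.sum_mul]
    refine (norm_sum_le _ _).trans (Finset.sum_le_sum fun i _ => ?_)
    rw [ContinuousLinearMap.norm_smulRight_apply, norm_mul, Circle.norm_coe, one_mul, mul_assoc]
    gcongr
    rw [Real.rpow_neg (by positivity), Real.rpow_natCast, ← div_eq_mul_inv,
      le_div_iff₀ (by positivity), mul_comm]
    refine le_trans ?_ (hB i (w.1, t))
    gcongr
    exact le_max_right ‖w.1‖ ‖t‖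
  · exact (Measure.integrable_pow_neg_integrablePower volume).const_mul _
  · refine .of_forall fun t w _ => ?_
    have hF : HasFDerivAt (fun w : E × E => F (w.1, t))
        ((fderiv ℝ F (w.1, t)).comp
          ((ContinuousLinearMap.inl ℝ E E).comp (ContinuousLinearMap.fst ℝ E E))) w := by
      refine (F.hasFDerivAt (w.1, t)).comp w ?_
      have : HasFDerivAt (fun w : E × E => ((0 : E), t) +
          ((ContinuousLinearMap.inl ℝ E E).comp (ContinuousLinearMap.fst ℝ E E)) w) 
          ((ContinuousLinearMap.inl ℝ E E).comp (ContinuousLinearMap.fst ℝ E E)) w :=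
        (ContinuousLinearMap.hasFDerivAt _).const_add _
      exact this.congr_of_eventuallyEq (.of_forall fun w => by simp)
    have h0 : HasFDerivAt (fun w : E × E => ⟪t, w.2⟫_ℝ)
        ((innerSL ℝ t).comp (ContinuousLinearMap.snd ℝ E E)) w :=
      ((innerSL ℝ t).comp (ContinuousLinearMap.snd ℝ E E)).hasFDerivAt
    have h1 := (((Complex.ofRealCLM.hasFDerivAt.comp w h0).const_mul
      (-(2 * Real.pi * I) : ℂ)).cexp)
    have hχ : ∀ w : E × E, (Real.fourierChar (-(⟪t, w.2⟫_ℝ)) : ℂ) =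
        cexp (-(2 * Real.pi * I) * ((⟪t, w.2⟫_ℝ : ℝ) : ℂ)) := by
      intro w
      rw [Real.fourierChar_apply]
      congr 1
      push_cast
      ring
    simp only [hχ]
    have h2 := h1.mul hF
    refine h2.congr_fderiv ?_
    rw [eq_sum_coord (_ + _)]
    refine Finset.sum_congr rfl fun i _ => ?_
    congr 1
    simp only [hD, partialFourierDeriv_apply]
    simp
    ring

theorem fderiv_partialFourierFun (F : 𝓢(E × E, ℂ)) :
    fderiv ℝ (partialFourierFun F) = fun z =>
      ∑ i, ((Module.finBasis ℝ (E × E)).coord i).toContinuousLinearMap.smulRight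
        (partialFourierFun (partialFourierDeriv (Module.finBasis ℝ (E × E) i) F) z) :=
  funext fun z => (hasFDerivAt_partialFourierFun F z).fderiv

theorem contDiff_partialFourierFun (n : ℕ) :
    ∀ F : 𝓢(E × E, ℂ), ContDiff ℝ n (partialFourierFun F) := by
  induction n with
  | zero =>
    intro F
    exact contDiff_zero.2 (continuous_iff_continuousAt.2 fun z =>
      (hasFDerivAt_partialFourierFun F z).continuousAt)
  | succ n ih =>
    intro F
    rw [Nat.cast_add, Nat.cast_one, contDiff_succ_iff_fderiv]
    refine ⟨fun z => (hasFDerivAt_partialFourierFun F z).differentiableAt, fun h => ?_, ?_⟩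
    · exact absurd h (by simp)
    · rw [fderiv_partialFourierFun]
      exact ContDiff.sum fun i _ => contDiff_const.smulRight (ih _)

theorem continuous_sup_schwartzSeminorm (s : Finset (ℕ × ℕ)) :
    Continuous (s.sup (schwartzSeminormFamily ℂ (E × E) ℂ) : Seminorm ℂ 𝓢(E × E, ℂ)) := by
  induction s using Finset.cons_induction with
  | empty => rw [Finset.sup_empty]; exact continuous_zero
  | cons a s ha ih =>
    rw [Finset.sup_cons]
    exact ((schwartz_withSeminorms ℂ (E × E) ℂ).continuous_seminorm a).sup ih

theorem partialFourierFun_bound (k n : ℕ) :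
    ∃ (s : Finset (ℕ × ℕ)) (C : ℝ), 0 ≤ C ∧ ∀ (F : 𝓢(E × E, ℂ)) (z : E × E),
      ‖z‖ ^ k * ‖iteratedFDeriv ℝ n (partialFourierFun F) z‖ ≤
        C * s.sup (schwartzSeminormFamily ℂ (E × E) ℂ) F := by
  induction n with
  | zero => simpa only [norm_iteratedFDeriv_zero] using partialFourierFun_decay k
  | succ n ih =>
    obtain ⟨s, C, hC, h⟩ := ih
    set b := Module.finBasis ℝ (E × E) with hb
    set c : Fin (Module.finrank ℝ (E × E)) → (E × E →L[ℝ] ℝ) :=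
      fun i => (b.coord i).toContinuousLinearMap with hc
    have h' : ∀ i, ∃ (s' : Finset (ℕ × ℕ)) (C' : ℝ≥0), ∀ F : 𝓢(E × E, ℂ),
        s.sup (schwartzSeminormFamily ℂ (E × E) ℂ) (partialFourierDeriv (b i) F) ≤
          C' * s'.sup (schwartzSeminormFamily ℂ (E × E) ℂ) F := by
      intro i
      have hc : Continuous ((s.sup (schwartzSeminormFamily ℂ (E × E) ℂ)).comp
          (partialFourierDeriv (b i)).toLinearMap) :=
        (continuous_sup_schwartzSeminorm s).comp (partialFourierDeriv (b i)).continuous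
      obtain ⟨s', C', -, h'⟩ := Seminorm.bound_of_continuous (schwartz_withSeminorms ℂ _ _) _ hc
      exact ⟨s', C', fun F => h' F⟩
    choose s' C' h' using h'
    refine ⟨Finset.univ.biUnion s', ∑ i, ‖c i‖ * (C * C' i), by positivity, fun F z => ?_⟩
    rw [← norm_iteratedFDeriv_fderiv, fderiv_partialFourierFun]
    have hs : ∀ i, ContDiff ℝ n fun z =>
        (c i).smulRight (partialFourierFun (partialFourierDeriv (b i) F) z) := fun i =>
      contDiff_const.smulRight (contDiff_partialFourierFun n _)
    rw [iteratedFDeriv_fun_sum_apply fun i _ => (hs i).contDiffAt]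
    calc _ ≤ ‖z‖ ^ k * ∑ i, ‖c i‖ * ‖iteratedFDeriv ℝ n
            (partialFourierFun (partialFourierDeriv (b i) F)) z‖ := by
          gcongr
          refine (norm_sum_le _ _).trans (Finset.sum_le_sum fun i _ => ?_)
          have e : (fun z => (c i).smulRight (partialFourierFun (partialFourierDeriv (b i) F) z)) =
            ContinuousLinearMap.smulRightL ℝ (E × E) ℂ (c i) ∘
              partialFourierFun (partialFourierDeriv (b i) F) := rfl
          rw [e, ContinuousLinearMap.iteratedFDeriv_comp_left _
            (contDiff_partialFourierFun n _).contDiffAt le_rfl]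
          refine (ContinuousLinearMap.norm_compContinuousMultilinearMap_le _ _).trans ?_
          gcongr
          refine (ContinuousLinearMap.opNorm_le_bound _ (norm_nonneg (c i)) fun y => ?_)
          exact (ContinuousLinearMap.norm_smulRight_apply _ _).le
      _ = ∑ i, ‖c i‖ * (‖z‖ ^ k * ‖iteratedFDeriv ℝ n
            (partialFourierFun (partialFourierDeriv (b i) F)) z‖) := by
          rw [Finset.mul_sum]
          exact Finset.sum_congr rfl fun i _ => by ring
      _ ≤ ∑ i, ‖c i‖ * (C * (C' i *
            (Finset.univ.biUnion s').sup (schwartzSeminormFamily ℂ (E × E) ℂ) F)) := by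
          refine Finset.sum_le_sum fun i _ => mul_le_mul_of_nonneg_left ?_ (norm_nonneg (c i))
          refine (h (partialFourierDeriv (b i) F) z).trans ?_
          refine mul_le_mul_of_nonneg_left ((h' i F).trans ?_) hC
          refine mul_le_mul_of_nonneg_left ?_ (C' i).2
          exact Seminorm.le_def.mp (Finset.sup_mono
            (Finset.subset_biUnion_of_mem s' (Finset.mem_univ i))) F
      _ = _ := by
          rw [Finset.sum_mul]
          exact Finset.sum_congr rfl fun i _ => by ring

/-- The partial Fourier transform in the second variable,
`(x, ξ) ↦ ∫ t, exp (-2 π i ⟨t, ξ⟩) F (x, t)`, as a continuous map of the Schwartz space. -/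
def partialFourier : 𝓢(E × E, ℂ) →L[ℂ] 𝓢(E × E, ℂ) :=
  SchwartzMap.mkCLM (σ := RingHom.id ℂ) partialFourierFun
    (fun F G z => by
      have : slice (F + G) z.1 = slice F z.1 + slice G z.1 := rfl
      simp only [partialFourierFun, this, FourierTransform.fourier_add]
      rfl)
    (fun c F z => by
      have : slice (c • F) z.1 = c • slice F z.1 := rfl
      simp only [partialFourierFun, this, FourierTransform.fourier_smul]
      rfl)
    (fun F => contDiff_infty.2 fun n => contDiff_partialFourierFun n F)
    (fun n => partialFourierFun_bound n.1 n.2)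

theorem norm_iteratedFDeriv_comp_clm_le (f : 𝓢(E, ℂ)) (A : E × E →L[ℝ] E) (hA : ‖A‖ ≤ 1) (n : ℕ)
    (z : E × E) : ‖iteratedFDeriv ℝ n (fun z => f (A z)) z‖ ≤ ‖iteratedFDeriv ℝ n f (A z)‖ := by
  have h := ContinuousLinearMap.iteratedFDeriv_comp_right A (f.smooth n) z le_rfl
  rw [show (fun z => f (A z)) = f ∘ A from rfl, h]
  refine (ContinuousMultilinearMap.norm_compContinuousLinearMap_le _ _).trans ?_
  simp only [Finset.prod_const, Finset.card_univ, Fintype.card_fin]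
  exact mul_le_of_le_one_right (norm_nonneg _) (pow_le_one₀ (norm_nonneg _) hA)

theorem tensor_bound (h : 𝓢(E, ℂ)) (k n : ℕ) :
    ∃ (s : Finset (ℕ × ℕ)) (C : ℝ), 0 ≤ C ∧ ∀ (f : 𝓢(E, ℂ)) (z : E × E),
      ‖z‖ ^ k * ‖iteratedFDeriv ℝ n (fun z : E × E => f z.1 * h z.2) z‖ ≤
        C * s.sup (schwartzSeminormFamily ℂ E ℂ) f := by
  refine ⟨Finset.Iic (k, n), ∑ i ∈ Finset.range (n + 1), (n.choose i : ℝ) *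
    (SchwartzMap.seminorm ℂ 0 (n - i) h + SchwartzMap.seminorm ℂ k (n - i) h), by positivity,
    fun f z => ?_⟩
  set Q := (Finset.Iic (k, n)).sup (schwartzSeminormFamily ℂ E ℂ) f with hQ
  have hQle : ∀ j i, j ≤ k → i ≤ n → SchwartzMap.seminorm ℂ j i f ≤ Q := fun j i hj hi =>
    Seminorm.le_def.mp (Finset.le_sup (f := schwartzSeminormFamily ℂ E ℂ) (b := (j, i))
      (Finset.mem_Iic.2 (Prod.mk_le_mk.2 ⟨hj, hi⟩))) f
  have hf : ContDiff ℝ n fun z : E × E => f z.1 := (f.smooth n).comp contDiff_fst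
  have hh : ContDiff ℝ n fun z : E × E => h z.2 := (h.smooth n).comp contDiff_snd
  have hk : ‖z‖ ^ k ≤ ‖z.1‖ ^ k + ‖z.2‖ ^ k := by
    rcases le_total ‖z.1‖ ‖z.2‖ with h | h
    · rw [show ‖z‖ = ‖z.2‖ from max_eq_right h]
      exact le_add_of_nonneg_left (by positivity)
    · rw [show ‖z‖ = ‖z.1‖ from max_eq_left h]
      exact le_add_of_nonneg_right (by positivity)
  calc _ ≤ ‖z‖ ^ k * ∑ i ∈ Finset.range (n + 1), (n.choose i : ℝ) *
          ‖iteratedFDeriv ℝ i (fun z : E × E => f z.1) z‖ *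
          ‖iteratedFDeriv ℝ (n - i) (fun z : E × E => h z.2) z‖ := by
        gcongr
        exact norm_iteratedFDeriv_mul_le hf hh z le_rfl
    _ ≤ (‖z.1‖ ^ k + ‖z.2‖ ^ k) * ∑ i ∈ Finset.range (n + 1), (n.choose i : ℝ) *
          ‖iteratedFDeriv ℝ i f z.1‖ * ‖iteratedFDeriv ℝ (n - i) h z.2‖ := by
        gcongr with i hi
        · exact norm_iteratedFDeriv_comp_clm_le f (ContinuousLinearMap.fst ℝ E E)
            (ContinuousLinearMap.norm_fst_le _ _ _) i z
        · exact norm_iteratedFDeriv_comp_clm_le h (ContinuousLinearMap.snd ℝ E E)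
            (ContinuousLinearMap.norm_snd_le _ _ _) (n - i) z
    _ = ∑ i ∈ Finset.range (n + 1), (n.choose i : ℝ) *
          ((‖z.1‖ ^ k * ‖iteratedFDeriv ℝ i f z.1‖) *
            (‖z.2‖ ^ 0 * ‖iteratedFDeriv ℝ (n - i) h z.2‖) +
          (‖z.1‖ ^ 0 * ‖iteratedFDeriv ℝ i f z.1‖) *
            (‖z.2‖ ^ k * ‖iteratedFDeriv ℝ (n - i) h z.2‖)) := by
        rw [Finset.mul_sum]
        exact Finset.sum_congr rfl fun i _ => by ring
    _ ≤ ∑ i ∈ Finset.range (n + 1), (n.choose i : ℝ) *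
          (Q * SchwartzMap.seminorm ℂ 0 (n - i) h + Q * SchwartzMap.seminorm ℂ k (n - i) h) := by
        gcongr with i hi i hi
        · exact (SchwartzMap.le_seminorm ℂ k i f z.1).trans
            (hQle k i le_rfl (Nat.lt_succ_iff.1 (Finset.mem_range.1 hi)))
        · exact SchwartzMap.le_seminorm ℂ 0 (n - i) h z.2
        · exact (SchwartzMap.le_seminorm ℂ 0 i f z.1).trans
            (hQle 0 i (Nat.zero_le _) (Nat.lt_succ_iff.1 (Finset.mem_range.1 hi)))
        · exact SchwartzMap.le_seminorm ℂ k (n - i) h z.2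
    _ = _ := by
        rw [Finset.sum_mul]
        exact Finset.sum_congr rfl fun i _ => by ring

/-- The tensor product `(x, y) ↦ f x * h y` of two Schwartz functions, for a fixed `h`. -/
def tensor (h : 𝓢(E, ℂ)) : 𝓢(E, ℂ) →L[ℂ] 𝓢(E × E, ℂ) :=
  SchwartzMap.mkCLM (σ := RingHom.id ℂ) (fun f z => f z.1 * h z.2)
    (fun f g z => by simp [add_mul])
    (fun c f z => by simp [mul_assoc])
    (fun f => ((f.smooth ⊤).comp contDiff_fst).mul ((h.smooth ⊤).comp contDiff_snd))
    (fun n => tensor_bound h n.1 n.2)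

/-- The change of coordinates `(x, t) ↦ (x + t / 2, x - t / 2)`. -/
def midpointCoord : (E × E) ≃L[ℝ] (E × E) :=
  ContinuousLinearEquiv.equivOfInverse
    ((ContinuousLinearMap.fst ℝ E E + (2⁻¹ : ℝ) • ContinuousLinearMap.snd ℝ E E).prod
      (ContinuousLinearMap.fst ℝ E E - (2⁻¹ : ℝ) • ContinuousLinearMap.snd ℝ E E))
    (((2⁻¹ : ℝ) • (ContinuousLinearMap.fst ℝ E E + ContinuousLinearMap.snd ℝ E E)).prod
      (ContinuousLinearMap.fst ℝ E E - ContinuousLinearMap.snd ℝ E E))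
    (fun z => by
      ext
      · simp only [ContinuousLinearMap.prod_apply, add_apply, smul_apply, sub_apply,
          ContinuousLinearMap.coe_fst', ContinuousLinearMap.coe_snd']
        module
      · simp only [ContinuousLinearMap.prod_apply, add_apply, smul_apply, sub_apply,
          ContinuousLinearMap.coe_fst', ContinuousLinearMap.coe_snd']
        module)
    (fun z => by
      ext
      · simp only [ContinuousLinearMap.prod_apply, add_apply, smul_apply, sub_apply,
          ContinuousLinearMap.coe_fst', ContinuousLinearMap.coe_snd']
        module
      · simp only [ContinuousLinearMap.prod_apply, add_apply, smul_apply, sub_apply,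
          ContinuousLinearMap.coe_fst', ContinuousLinearMap.coe_snd']
        module)

/-- The phase space `E × E` with its Euclidean structure, so `ℝ^{2d}` if `E` is `ℝ^d`. -/
abbrev Phase (E : Type*) := WithLp 2 (E × E)

/-- Complex conjugation of a Schwartz function. -/
def conjS {G : Type*} [NormedAddCommGroup G] [NormedSpace ℝ G] : 𝓢(G, ℂ) →L[ℝ] 𝓢(G, ℂ) :=
  SchwartzMap.postcompCLM (𝕜 := ℝ) (Complex.conjCLE : ℂ →L[ℝ] ℂ)

@[simp] theorem conjS_apply {G : Type*} [NormedAddCommGroup G] [NormedSpace ℝ G] (f : 𝓢(G, ℂ))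
    (x : G) : conjS f x = conj (f x) := rfl

/-- The cross-Wigner distribution `W(f₁, f₂)` of two Schwartz functions as a continuous linear
function of `f₁`. -/
def crossWignerCLM (f₂ : 𝓢(E, ℂ)) : 𝓢(E, ℂ) →L[ℂ] 𝓢(Phase E, ℂ) :=
  SchwartzMap.compCLMOfContinuousLinearEquiv ℂ (WithLp.prodContinuousLinearEquiv 2 ℝ E E) ∘L
    partialFourier ∘L SchwartzMap.compCLMOfContinuousLinearEquiv ℂ midpointCoord ∘L
      tensor (conjS f₂)

/-- The cross-Wigner distribution `W(f₁, f₂)` of two Schwartz functions, a Schwartz function on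
phase space. The integral formula is `crossWigner_apply`. -/
def crossWigner (f₁ f₂ : 𝓢(E, ℂ)) : 𝓢(Phase E, ℂ) := crossWignerCLM f₂ f₁

/-- `W(f₁, f₂)(x, ξ) = ∫ f₁(x + t/2) conj(f₂(x - t/2)) exp(-2πi ξt) dt`. -/
theorem crossWigner_apply (f₁ f₂ : 𝓢(E, ℂ)) (z : Phase E) :
    crossWigner f₁ f₂ z = ∫ t : E, f₁ (z.fst + (2⁻¹ : ℝ) • t) * conj (f₂ (z.fst - (2⁻¹ : ℝ) • t)) *
      cexp (-(2 * Real.pi * I * (⟪z.snd, t⟫_ℝ : ℝ))) := by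
  have h : crossWigner f₁ f₂ z = 𝓕 (slice (SchwartzMap.compCLMOfContinuousLinearEquiv ℂ
    midpointCoord (tensor (conjS f₂) f₁)) z.fst) z.snd := rfl
  rw [h, SchwartzMap.fourier_coe, Real.fourier_eq]
  refine integral_congr_ae (.of_forall fun t => ?_)
  have e : (slice (SchwartzMap.compCLMOfContinuousLinearEquiv ℂ
    midpointCoord (tensor (conjS f₂) f₁)) z.fst) t =
      f₁ (z.fst + (2⁻¹ : ℝ) • t) * conj (f₂ (z.fst - (2⁻¹ : ℝ) • t)) := rfl
  simp only [e, Circle.smul_def, Real.fourierChar_apply, smul_eq_mul]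
  rw [mul_comm, real_inner_comm]
  congr 2
  push_cast
  ring

theorem conjS_smul {G : Type*} [NormedAddCommGroup G] [NormedSpace ℝ G] (c : ℂ) (f : 𝓢(G, ℂ)) :
    conjS (c • f) = conj c • conjS f := by
  ext; simp

theorem crossWigner_add_right (f g₁ g₂ : 𝓢(E, ℂ)) :
    crossWigner f (g₁ + g₂) = crossWigner f g₁ + crossWigner f g₂ := by
  have h : tensor (conjS (g₁ + g₂)) f = tensor (conjS g₁) f + tensor (conjS g₂) f := by
    ext z
    change f z.1 * conj ((g₁ + g₂) z.2) = f z.1 * conj (g₁ z.2) + f z.1 * conj (g₂ z.2)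
    simp [mul_add]
  rw [crossWigner, crossWignerCLM]
  simp only [ContinuousLinearMap.comp_apply]
  rw [h, map_add, map_add, map_add]
  rfl

theorem crossWigner_smul_right (c : ℂ) (f g : 𝓢(E, ℂ)) :
    crossWigner f (c • g) = conj c • crossWigner f g := by
  have h : tensor (conjS (c • g)) f = conj c • tensor (conjS g) f := by
    ext z
    change f z.1 * conj ((c • g) z.2) = conj c * (f z.1 * conj (g z.2))
    simp only [smul_apply, smul_eq_mul, map_mul]
    ring
  rw [crossWigner, crossWignerCLM]
  simp only [ContinuousLinearMap.comp_apply]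
  rw [h, map_smul, map_smul, map_smul]
  rfl

/-- The Weyl operator `L_σ : 𝓢 → 𝓢'` with symbol `σ ∈ 𝓢'(ℝ^{2d})`, given by
`⟨L_σ f, g⟩ = ⟨σ, W(g, f)⟩`. These brackets extend the inner product of `L²` and are conjugate
linear in the second entry, while a tempered distribution `u` is a linear functional in Lean, so
`⟨u, g⟩ = u (conj g)`; compare `weylOperator_pairing`. -/
def weylOperator (σ : 𝓢'(Phase E, ℂ)) : 𝓢(E, ℂ) →ₗ[ℂ] 𝓢'(E, ℂ) where
  toFun f := ContinuousLinearMap.toPointwiseConvergenceCLM _ _ _ _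
    { toFun := fun φ => σ (conjS (crossWigner (conjS φ) f))
      map_add' := fun φ ψ => by simp [crossWigner]
      map_smul' := fun c φ => by
        simp only [crossWigner, conjS_smul, map_smul, RCLike.conj_conj, RingHom.id_apply]
      cont := σ.continuous.comp (conjS.continuous.comp
        ((crossWignerCLM f).continuous.comp conjS.continuous)) }
  map_add' f₁ f₂ := by
    ext φ
    change σ (conjS (crossWigner (conjS φ) (f₁ + f₂))) =
      σ (conjS (crossWigner (conjS φ) f₁)) + σ (conjS (crossWigner (conjS φ) f₂))
    rw [crossWigner_add_right, map_add, map_add]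
  map_smul' c f := by
    ext φ
    change σ (conjS (crossWigner (conjS φ) (c • f))) =
      c • σ (conjS (crossWigner (conjS φ) f))
    rw [crossWigner_smul_right, conjS_smul, RCLike.conj_conj, map_smul]

theorem weylOperator_pairing (σ : 𝓢'(Phase E, ℂ)) (f g : 𝓢(E, ℂ)) :
    weylOperator σ f (conjS g) = σ (conjS (crossWigner g f)) := by
  have h : conjS (conjS g) = g := by ext; simp
  change σ (conjS (crossWigner (conjS (conjS g)) f)) = _
  rw [h]

/-! ### The short-time Fourier transform and modulation spaces -/

theorem hasTemperateGrowth_exp (ξ : E) :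
    Function.HasTemperateGrowth fun t : E => cexp (2 * Real.pi * I * (⟪ξ, t⟫_ℝ : ℝ)) := by
  have hd : ∀ n : ℕ, iteratedDeriv n (fun r : ℝ => cexp (2 * Real.pi * I * r)) =
      fun r : ℝ => (2 * Real.pi * I) ^ n * cexp (2 * Real.pi * I * r) := by
    intro n
    induction n with
    | zero => simp
    | succ n ih =>
      rw [iteratedDeriv_succ, ih]
      ext r
      have h : HasDerivAt (fun r : ℝ => 2 * Real.pi * I * (r : ℂ)) (2 * Real.pi * I * 1) r :=
        (Complex.ofRealCLM.hasDerivAt (x := r)).const_mul _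
      rw [(h.cexp.const_mul _).deriv]
      ring
  have h : Function.HasTemperateGrowth fun r : ℝ => cexp (2 * Real.pi * I * r) := by
    refine ⟨(contDiff_const.mul Complex.ofRealCLM.contDiff).cexp, fun n => ⟨0, (2 * Real.pi) ^ n, fun r => le_of_eq ?_⟩⟩
    rw [norm_iteratedFDeriv_eq_norm_iteratedDeriv, hd, norm_mul,
      show (2 * Real.pi * I * r : ℂ) = ((2 * Real.pi * r : ℝ) : ℂ) * I by push_cast; ring,
      Complex.norm_exp_ofReal_mul_I]
    simp [abs_of_pos Real.pi_pos]
  exact h.comp (Function.hasTemperateGrowth_inner_right ξ)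

/-- The time-frequency shift `M_ξ T_x g`. -/
def tfShift (x ξ : E) (g : 𝓢(E, ℂ)) : 𝓢(E, ℂ) :=
  SchwartzMap.smulLeftCLM ℂ (fun t : E => cexp (2 * Real.pi * I * (⟪ξ, t⟫_ℝ : ℝ)))
    (SchwartzMap.compSubConstCLM ℂ x g)

theorem tfShift_apply (x ξ : E) (g : 𝓢(E, ℂ)) (t : E) :
    tfShift x ξ g t = cexp (2 * Real.pi * I * (⟪ξ, t⟫_ℝ : ℝ)) * g (t - x) := by
  simp [tfShift, SchwartzMap.smulLeftCLM_apply_apply (hasTemperateGrowth_exp ξ)]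

/-- The short-time Fourier transform `V_g f(x, ξ) = ⟨f, M_ξ T_x g⟩` of a tempered distribution. -/
def stft (g : 𝓢(E, ℂ)) (f : 𝓢'(E, ℂ)) (x ξ : E) : ℂ := f (conjS (tfShift x ξ g))

/-- The mixed norm of `L^{p,q}`: the `L^p` norm in `x`, then the `L^q` norm in `ξ`. -/
def mixedNorm (p q : ℝ≥0∞) (F : E → E → ℂ) : ℝ≥0∞ :=
  eLpNorm (fun ξ => eLpNorm (fun x => F x ξ) p volume) q volume

/-- The norm of `M^{p,q}_m`, with window `g`; it is `∞` outside the modulation space. -/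
def modulationNorm (g : 𝓢(E, ℂ)) (p q : ℝ≥0∞) (m : E → E → ℝ) (f : 𝓢'(E, ℂ)) : ℝ≥0∞ :=
  mixedNorm p q fun x ξ => (m x ξ : ℂ) * stft g f x ξ

/-- The modulation space `M^{p,q}_m`, with window `g`. -/
def modulationSpace (g : 𝓢(E, ℂ)) (p q : ℝ≥0∞) (m : E → E → ℝ) : Set 𝓢'(E, ℂ) :=
  {f | modulationNorm g p q m f < ∞}

/-- The weight `⟨z⟩^s = (1 + |z|²)^{s/2}`. -/
def bracket {G : Type*} [NormedAddCommGroup G] (s : ℝ) (z : G) : ℝ := (1 + ‖z‖ ^ 2) ^ (s / 2)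

/-- The weight `v_s(x, ξ) = (1 + |x|² + |ξ|²)^{s/2}` on phase space. -/
def vWeight (s : ℝ) (x ξ : E) : ℝ := bracket s (WithLp.toLp 2 (x, ξ) : Phase E)

/-- The weight `(1 ⊗ v_s)(z, ζ) = v_s(ζ)` for symbols, with `z` and `ζ` in phase space. -/
def symbolWeight (s : ℝ) (_z ζ : Phase E) : ℝ := bracket s ζ

/-- The tempered distribution given by a Schwartz function. -/
def toDistribution : 𝓢(E, ℂ) →L[ℂ] 𝓢'(E, ℂ) := SchwartzMap.toTemperedDistributionCLM E ℂ volume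

/-- `T` is a linear operator on all of `M^{p₁,q₁}_m` (its domain) that agrees with `L` on Schwartz
functions and is bounded into `M^{p₂,q₂}_m` with operator norm at most `K`. -/
structure IsBoundedExtension (g : 𝓢(E, ℂ)) (p₁ q₁ p₂ q₂ : ℝ≥0∞) (m : E → E → ℝ)
    (L : 𝓢(E, ℂ) →ₗ[ℂ] 𝓢'(E, ℂ)) (K : ℝ≥0∞) (T : 𝓢'(E, ℂ) →ₗ.[ℂ] 𝓢'(E, ℂ)) : Prop where
  domain_eq : (T.domain : Set 𝓢'(E, ℂ)) = modulationSpace g p₁ q₁ m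
  extends_schwartz : ∀ φ : 𝓢(E, ℂ), ∃ h : toDistribution φ ∈ T.domain,
    T ⟨toDistribution φ, h⟩ = L φ
  mem_codomain : ∀ f : T.domain, T f ∈ modulationSpace g p₂ q₂ m
  norm_le : ∀ f : T.domain,
    modulationNorm g p₂ q₂ m (T f) ≤ K * modulationNorm g p₁ q₁ m (f : 𝓢'(E, ℂ))

/-- The closure of the Schwartz functions in `M^{p,q}_m`. -/
def schwartzClosure (g : 𝓢(E, ℂ)) (p q : ℝ≥0∞) (m : E → E → ℝ) : Set 𝓢'(E, ℂ) :=
  {f | ∀ ε : ℝ≥0∞, 0 < ε → ∃ φ : 𝓢(E, ℂ), modulationNorm g p q m (f - toDistribution φ) < ε}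

/-- The index conditions `min {1/p₁ + 1/p₂', 1/q₁ + 1/q₂'} ≥ 1/p' + 1/q'` and
`q ≤ min {p₁', q₁', p₂, q₂}`, where `'` denotes the conjugate exponent. -/
def AdmissibleExponents (p₁ q₁ p₂ q₂ p q : ℝ≥0∞) : Prop :=
  p.conjExponent⁻¹ + q.conjExponent⁻¹ ≤
      min (p₁⁻¹ + p₂.conjExponent⁻¹) (q₁⁻¹ + q₂.conjExponent⁻¹) ∧
    q ≤ min (min p₁.conjExponent q₁.conjExponent) (min p₂ q₂)

end WeylMod

end

open WeylMod

noncomputable section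

namespace WeylMod

open Filter Topology

/-! ### Mixed norms of nonnegative functions -/

section Duality

variable {X Y : Type*} [MeasurableSpace X] [MeasurableSpace Y] {μ : Measure X} {ν : Measure Y}

/-! Write π(z)g for the time-frequency shift of the window by a point z of phase space, and J(x, ξ)
= (ξ, -x).

Sufficiency. The cross-Wigner distribution is covariant: W(π(z)g, π(w)g) is, up to a unimodular
factor, the time-frequency shift of W(g, g) by ((z + w)/2, J(z - w)) (`crossWigner_tfShift`). Hence
the matrix entry ⟨L_σ π(w)g, π(z)g⟩ has the modulus of the short-time Fourier transform of σ, with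
window W(g, g), at ((z + w)/2, J(z - w)) (`weylKernel_eq`). Boundedness of L_σ becomes boundedness
of a positive integral operator on weighted mixed Lebesgue spaces. Paired with a function A, and
with w = z - u, it is a form in S, A and B, where S comes from σ and B from f. Hölder in z with
exponents p, P = p' and then in u with q, Q = q' splits off the norm of σ and leaves the L^Q norm in
u of the L^P norm of A times the translate of B by u. Raised to the power P this is a correlation of
A^P and B^P in L^{Q/P}, and Young's inequality for mixed norms bounds it when 1/b + 1/a = 1/P + 1/Q,
P ≤ Q and a, b ≥ P (`eLpNorm_mul_comp_sub_le`, `lintegral_midpoint_form_le`).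

The general exponents reduce to this equality. Modulation spaces grow with their exponents, because
the short-time Fourier transform is dominated by its convolution with a Schwartz function
(`exists_modulationNorm_le`). So p may be replaced by max p q, and the index conditions are exactly
what is needed to find suitable a, b (`exists_intermediate_exponents`). The weights cost nothing: J
is an isometry, so Peetre's inequality moves v_s from z to w at the price of v_s(J(z - w)), which is
the weight of the symbol (`vWeight_le_mul`).

The extension is T f = ‖g‖₂⁻⁴ ∬ ⟨L_σ π(w)g, π(z)g⟩ V_g f(w) π(z)g dw dz, which makes sense for every
f in the space, dense or not (`exists_weylExtension`). Uniqueness comes from the approximation of f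
by the inversion formula cut off to balls (`mem_schwartzClosure`).

Necessity. Take σ = W(φ, f) with Gaussians f, φ of variable widths. By Moyal's identity ⟨L_σ f, φ⟩ =
‖φ‖₂² ‖f‖₂², and the short-time Fourier transform of σ is a product of those of φ and f, so every
norm is controlled by explicit powers of the width parameters (`exists_one_le_gaussianFactor`).
Letting both widths degenerate together gives the conditions on sums; letting one degenerate alone
gives the bounds on q. The symmetries of the estimate produce the remaining cases. -/

theorem eLpNorm_ennreal {f : X → ℝ≥0∞} {p : ℝ≥0∞} (h0 : p ≠ 0) (h1 : p ≠ ∞) :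
    eLpNorm f p μ = (∫⁻ x, f x ^ p.toReal ∂μ) ^ (1 / p.toReal) := by
  rw [eLpNorm_eq_lintegral_rpow_enorm_toReal h0 h1]
  simp

theorem eLpNorm_ennreal_top {f : X → ℝ≥0∞} : eLpNorm f ∞ μ = essSup f μ := by
  rw [eLpNorm_exponent_top, eLpNormEssSup_eq_essSup_enorm]
  simp

theorem eLpNorm_ennreal_one {f : X → ℝ≥0∞} : eLpNorm f 1 μ = ∫⁻ x, f x ∂μ := by
  rw [eLpNorm_one_eq_lintegral_enorm]
  simp

theorem eLpNorm_ennreal_const_mul (c : ℝ≥0∞) (f : X → ℝ≥0∞) (p : ℝ≥0∞) (hf : Measurable f) :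
    eLpNorm (fun x => c * f x) p μ = c * eLpNorm f p μ := by
  by_cases h0 : p = 0
  · simp [h0]
  by_cases h1 : p = ∞
  · subst h1
    simp only [eLpNorm_ennreal_top]
    exact ENNReal.essSup_const_mul
  have hp : 0 < p.toReal := ENNReal.toReal_pos h0 h1
  rw [eLpNorm_ennreal h0 h1, eLpNorm_ennreal h0 h1]
  simp_rw [ENNReal.mul_rpow_of_nonneg _ _ hp.le]
  rw [lintegral_const_mul _ (hf.pow_const _), ENNReal.mul_rpow_of_nonneg _ _ (by positivity),
    ← ENNReal.rpow_mul, mul_one_div_cancel hp.ne', ENNReal.rpow_one]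

theorem measurable_eLpNorm_slice [SFinite μ] {F : X → Y → ℝ≥0∞}
    (hF : Measurable (Function.uncurry F)) (p : ℝ≥0∞) :
    Measurable fun y => eLpNorm (fun x => F x y) p μ := by
  by_cases h0 : p = 0
  · simp [h0]
  by_cases h1 : p = ∞
  · subst h1
    simp only [eLpNorm_ennreal_top]
    refine measurable_of_Iic fun a => ?_
    -- An essential supremum is at most a exactly when the slice of {F > a} is null, and measures of
    -- slices depend measurably on the parameter.
    have h : (fun y => essSup (fun x => F x y) μ) ⁻¹' Set.Iic a =
        {y | μ ((fun x => (x, y)) ⁻¹' {z | a < Function.uncurry F z}) = 0} := by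
      ext y
      simp only [Set.mem_preimage, Set.mem_Iic, Set.mem_ofPred_eq]
      constructor
      · intro h
        have := ENNReal.ae_le_essSup (μ := μ) fun x => F x y
        refine measure_mono_null ?_ (ae_iff.1 this)
        intro x hx
        simp only [Set.preimage_ofPred_eq, Set.mem_ofPred_eq, Function.uncurry_apply_pair] at hx
        simpa using h.trans_lt hx
      · intro h
        refine essSup_le_of_ae_le a (ae_iff.2 ?_)
        simpa [Function.uncurry] using h
    rw [h]
    exact measurable_measure_prodMk_right (measurableSet_lt measurable_const hF)
      (measurableSet_singleton 0)
  · simp only [eLpNorm_ennreal h0 h1]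
    exact ((hF.pow_const _).lintegral_prod_left').pow_const _

theorem lintegral_mul_le_eLpNorm {p q : ℝ≥0∞} [hpq : p.HolderConjugate q] {f g : X → ℝ≥0∞}
    (hf : Measurable f) (hg : Measurable g) :
    ∫⁻ x, f x * g x ∂μ ≤ eLpNorm f p μ * eLpNorm g q μ := by
  have key : ∀ {f g : X → ℝ≥0∞}, Measurable g →
      ∫⁻ x, f x * g x ∂μ ≤ eLpNorm f ∞ μ * eLpNorm g 1 μ := by
    intro f g hg
    rw [eLpNorm_ennreal_one, eLpNorm_ennreal_top, ← lintegral_const_mul _ hg]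
    refine lintegral_mono_ae ?_
    filter_upwards [ENNReal.ae_le_essSup (μ := μ) f] with x hx
    gcongr
  by_cases hp1 : p = ∞
  · subst hp1
    have hq : q = 1 := (ENNReal.HolderConjugate.unique ∞ q 1)
    subst hq
    exact key hg
  by_cases hq1 : q = ∞
  · subst hq1
    have hp : p = 1 := by
      have := hpq.symm
      exact (ENNReal.HolderConjugate.unique ∞ p 1)
    subst hp
    simp_rw [mul_comm (f _)]
    rw [mul_comm]
    exact key hf
  have hp0 : p ≠ 0 := ENNReal.HolderConjugate.ne_zero p q
  have hq0 : q ≠ 0 := ENNReal.HolderConjugate.ne_zero q p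
  rw [eLpNorm_ennreal hp0 hp1, eLpNorm_ennreal hq0 hq1]
  have h : p.toReal.HolderConjugate q.toReal := by
    refine ⟨?_, ENNReal.toReal_pos hp0 hp1, ENNReal.toReal_pos hq0 hq1⟩
    have := ENNReal.HolderConjugate.inv_add_inv_eq_one p q
    rw [← ENNReal.toReal_inv, ← ENNReal.toReal_inv, ← ENNReal.toReal_add (by simpa) (by simpa), this]
    simp
  exact ENNReal.lintegral_mul_le_Lp_mul_Lq μ h hf.aemeasurable hg.aemeasurable

/-- Measurable families of functions in the unit ball of `L^q` that norm the slices of a measurable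
function in `L^p`. -/
theorem exists_dual_seq [SigmaFinite μ] {p q : ℝ≥0∞} [hpq : p.HolderConjugate q]
    {H : X → Y → ℝ≥0∞} (hH : Measurable (Function.uncurry H)) :
    ∃ G : ℕ → X → Y → ℝ≥0∞, (∀ n, Measurable (Function.uncurry (G n))) ∧
      (∀ n y, eLpNorm (fun x => G n x y) q μ ≤ 1) ∧
      ∀ y, eLpNorm (fun x => H x y) p μ ≤ liminf (fun n => ∫⁻ x, H x y * G n x y ∂μ) atTop := by
  -- A strictly positive function of finite integral. It replaces an exhaustion by sets of finite
  -- measure: cut off against w, the integrals below are finite for all y at once.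
  obtain ⟨w, hw0, hw, hw1⟩ := exists_pos_lintegral_lt_of_sigmaFinite μ one_ne_zero
  have hHs : ∀ y, Measurable fun x => H x y := fun y => hH.comp measurable_prodMk_right
  by_cases hq1 : q = ∞
  · subst hq1
    have hp : p = 1 := by
      have := hpq.symm
      exact (ENNReal.HolderConjugate.unique ∞ p 1)
    subst hp
    refine ⟨fun _ _ _ => 1, fun n => measurable_const, fun n y => ?_, fun y => ?_⟩
    · rw [eLpNorm_ennreal_top]
      exact essSup_le_of_ae_le 1 (Eventually.of_forall fun _ => le_rfl)
    · simp [eLpNorm_ennreal_one]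
  have hq0 : q ≠ 0 := ENNReal.HolderConjugate.ne_zero q p
  by_cases hp1 : p = ∞
  · subst hp1
    have hq : q = 1 := (ENNReal.HolderConjugate.unique ∞ q 1)
    subst hq
    set N : Y → ℝ≥0∞ := fun y => essSup (fun x => H x y) μ with hN
    have hNm : Measurable N := by
      have := measurable_eLpNorm_slice (μ := μ) hH ∞
      simpa only [eLpNorm_ennreal_top] using this
    -- A level strictly below the essential supremum N y that increases to it. The minimum with n
    -- keeps it finite, so that subtraction of 1/n is strict even if N y = ∞. The norming function
    -- is w, restricted to the set where H exceeds the level and normalised in L¹.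
    set l : ℕ → Y → ℝ≥0∞ := fun n y => min (n : ℝ≥0∞) (N y) - (n : ℝ≥0∞)⁻¹ with hl
    have hlm : ∀ n, Measurable (l n) := fun n => (measurable_const.min hNm).sub measurable_const
    set A : ℕ → Set (X × Y) := fun n => {z | l n z.2 < H z.1 z.2} with hA
    have hAm : ∀ n, MeasurableSet (A n) := fun n =>
      measurableSet_lt ((hlm n).comp measurable_snd) hH
    set m : ℕ → X × Y → ℝ≥0∞ := fun n => (A n).indicator fun z => (w z.1 : ℝ≥0∞) with hm
    have hmm : ∀ n, Measurable (m n) := fun n =>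
      (hw.coe_nnreal_ennreal.comp measurable_fst).indicator (hAm n)
    set I : ℕ → Y → ℝ≥0∞ := fun n y => ∫⁻ x, m n (x, y) ∂μ with hI
    have hIm : ∀ n, Measurable (I n) := fun n => (hmm n).lintegral_prod_left'
    have hms : ∀ n y, Measurable fun x => m n (x, y) := fun n y =>
      (hmm n).comp measurable_prodMk_right
    have hItop : ∀ n y, I n y ≠ ∞ := fun n y => by
      refine ne_top_of_le_ne_top (hw1.trans ENNReal.one_lt_top).ne (lintegral_mono fun x => ?_)
      exact Set.indicator_le_self _ _ _
    refine ⟨fun n x y => m n (x, y) / I n y, fun n => (hmm n).div ((hIm n).comp measurable_snd),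
      fun n y => ?_, fun y => ?_⟩
    · rw [eLpNorm_ennreal_one]
      simp_rw [div_eq_mul_inv]
      rw [lintegral_mul_const _ (hms n y), ← div_eq_mul_inv]
      exact ENNReal.div_self_le_one
    · rw [eLpNorm_ennreal_top]
      change N y ≤ _
      rcases eq_or_ne (N y) 0 with h0 | h0
      · rw [h0]; exact zero_le
      have htl : Tendsto (fun n => l n y) atTop (𝓝 (N y)) := by
        have h1 : Tendsto (fun n : ℕ => min (n : ℝ≥0∞) (N y)) atTop (𝓝 (min ∞ (N y))) :=
          ENNReal.tendsto_nat_nhds_top.min tendsto_const_nhds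
        have h2 := ENNReal.Tendsto.sub h1 ENNReal.tendsto_inv_nat_nhds_zero (Or.inr (by simp))
        simpa using h2
      rw [← htl.liminf_eq]
      refine liminf_le_liminf (Filter.eventually_atTop.2 ⟨1, fun n hn => ?_⟩)
      have hlt : l n y < N y := by
        rcases eq_or_ne (min (n : ℝ≥0∞) (N y)) 0 with h3 | h3
        · rw [hl]; simp only [h3, zero_tsub]; exact pos_iff_ne_zero.2 h0
        · have hnt : min (n : ℝ≥0∞) (N y) ≠ ∞ :=
            ((min_le_left _ _).trans_lt (ENNReal.natCast_lt_top n)).ne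
          exact (ENNReal.sub_lt_self hnt h3 (by simp)).trans_le (min_le_right _ _)
      have hIpos : I n y ≠ 0 := by
        intro h4
        rw [hI] at h4
        simp only at h4
        rw [lintegral_eq_zero_iff (hms n y)] at h4
        refine absurd (essSup_le_of_ae_le (μ := μ) (f := fun x => H x y) (l n y) ?_) (not_le.2 hlt)
        filter_upwards [h4] with x hx
        by_contra h5
        have : (x, y) ∈ A n := not_le.1 h5
        simp [hm, this, (hw0 x).ne'] at hx
      calc l n y = l n y * (I n y / I n y) := by rw [ENNReal.div_self hIpos (hItop n y), mul_one]
        _ = ∫⁻ x, l n y * (m n (x, y) / I n y) ∂μ := by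
          rw [lintegral_const_mul _ ((hms n y).div_const _)]
          simp_rw [div_eq_mul_inv]
          rw [lintegral_mul_const _ (hms n y)]
        _ ≤ _ := by
          refine lintegral_mono fun x => ?_
          by_cases hx : (x, y) ∈ A n
          · have : l n y < H x y := hx
            gcongr
          · simp [hm, hx]
  have hp0 : p ≠ 0 := ENNReal.HolderConjugate.ne_zero p q
  set P := p.toReal with hP
  set Q := q.toReal with hQ
  have hPQ : P.HolderConjugate Q := by
    refine ⟨?_, ENNReal.toReal_pos hp0 hp1, ENNReal.toReal_pos hq0 hq1⟩
    have := ENNReal.HolderConjugate.inv_add_inv_eq_one p q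
    rw [← ENNReal.toReal_inv, ← ENNReal.toReal_inv, ← ENNReal.toReal_add (by simpa) (by simpa), this]
    simp
  have hP0 : 0 < P := hPQ.pos
  have hQ0 : 0 < Q := hPQ.symm.pos
  -- The extremal function of Hölder's inequality is K^(P-1) divided by the norm of K to the power
  -- P/Q. The truncation K of H makes that norm finite; monotone convergence recovers H, even if its
  -- norm is infinite.
  set K : ℕ → X → Y → ℝ≥0∞ := fun n x y => min (H x y) (n * (w x : ℝ≥0∞) ^ (1 / P)) with hK
  have hKm : ∀ n, Measurable (Function.uncurry (K n)) := fun n =>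
    hH.min (((hw.coe_nnreal_ennreal.pow_const _).comp measurable_fst).const_mul _)
  have hKs : ∀ n y, Measurable fun x => K n x y := fun n y => (hKm n).comp measurable_prodMk_right
  set I : ℕ → Y → ℝ≥0∞ := fun n y => ∫⁻ x, K n x y ^ P ∂μ with hI
  have hIm : ∀ n, Measurable (I n) := fun n => ((hKm n).pow_const P).lintegral_prod_left'
  have hItop : ∀ n y, I n y ≠ ∞ := fun n y => by
    have : I n y ≤ ∫⁻ x, (n : ℝ≥0∞) ^ P * w x ∂μ := by
      refine lintegral_mono fun x => ?_
      calc K n x y ^ P ≤ (n * (w x : ℝ≥0∞) ^ (1 / P)) ^ P := by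
            gcongr; exact min_le_right _ _
        _ = _ := by
            rw [ENNReal.mul_rpow_of_nonneg _ _ hP0.le, ← ENNReal.rpow_mul,
              one_div_mul_cancel hP0.ne', ENNReal.rpow_one]
    rw [lintegral_const_mul _ hw.coe_nnreal_ennreal] at this
    refine ne_top_of_le_ne_top (ENNReal.mul_ne_top ?_ (hw1.trans ENNReal.one_lt_top).ne) this
    exact ENNReal.rpow_ne_top_of_nonneg hP0.le (ENNReal.natCast_ne_top n)
  refine ⟨fun n x y => K n x y ^ (P - 1) / I n y ^ (1 / Q), fun n => ((hKm n).pow_const _).div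
    (((hIm n).pow_const _).comp measurable_snd), fun n y => ?_, fun y => ?_⟩
  · rw [eLpNorm_ennreal hq0 hq1]
    have h1 : ∀ x, (K n x y ^ (P - 1) / I n y ^ (1 / Q)) ^ Q = K n x y ^ P / I n y := by
      intro x
      rw [ENNReal.div_rpow_of_nonneg _ _ hQ0.le, ← ENNReal.rpow_mul, ← ENNReal.rpow_mul,
        one_div_mul_cancel hQ0.ne', ENNReal.rpow_one, hPQ.sub_one_mul_conj]
    simp_rw [← hQ, h1, div_eq_mul_inv]
    rw [lintegral_mul_const _ ((hKs n y).pow_const _)]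
    refine (ENNReal.rpow_le_rpow (z := 1 * Q⁻¹) ?_ (by positivity)).trans_eq (ENNReal.one_rpow _)
    rw [← div_eq_mul_inv]
    exact ENNReal.div_self_le_one
  · rw [eLpNorm_ennreal hp0 hp1]
    have hmono : ∀ x, Monotone fun n => K n x y := fun x n k hnk => by
      simp only [hK]; gcongr
    have h1 : Tendsto (fun n => I n y ^ (1 / P)) atTop
        (𝓝 ((∫⁻ x, H x y ^ P ∂μ) ^ (1 / P))) := by
      refine (ENNReal.continuous_rpow_const.tendsto _).comp ?_
      refine lintegral_tendsto_of_tendsto_of_monotone (fun n => ((hKs n y).pow_const P).aemeasurable)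
        (.of_forall fun x n k hnk => ENNReal.rpow_le_rpow (hmono x hnk) hP0.le)
        (.of_forall fun x => (ENNReal.continuous_rpow_const.tendsto _).comp ?_)
      have hw' : (w x : ℝ≥0∞) ^ (1 / P) ≠ 0 := by
        have : (w x : ℝ≥0∞) ≠ 0 := by simpa using (hw0 x).ne'
        exact (ENNReal.rpow_pos (pos_iff_ne_zero.2 this) ENNReal.coe_ne_top).ne'
      have h2 : Tendsto (fun n : ℕ => (n : ℝ≥0∞) * (w x : ℝ≥0∞) ^ (1 / P)) atTop (𝓝 ∞) := by
        have := ENNReal.Tendsto.mul_const (b := (w x : ℝ≥0∞) ^ (1 / P))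
          ENNReal.tendsto_nat_nhds_top (Or.inl ENNReal.top_ne_zero)
        rwa [ENNReal.top_mul hw'] at this
      have h3 : Tendsto (fun n : ℕ => min (H x y) (n * (w x : ℝ≥0∞) ^ (1 / P))) atTop
          (𝓝 (min (H x y) ∞)) := tendsto_const_nhds.min h2
      simpa [hK] using h3
    rw [← h1.liminf_eq]
    refine liminf_le_liminf (Eventually.of_forall fun n => ?_)
    calc I n y ^ (1 / P) ≤ I n y / I n y ^ (1 / Q) := by
          rcases eq_or_ne (I n y) 0 with h0 | h0
          · simp [h0, hP0]
          · have e : (1 / P : ℝ) = 1 - 1 / Q := by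
              have := hPQ.inv_add_inv_eq_one
              simp only [one_div]; linarith
            rw [e, ENNReal.rpow_sub _ _ h0 (hItop n y), ENNReal.rpow_one]
      _ = ∫⁻ x, K n x y * (K n x y ^ (P - 1) / I n y ^ (1 / Q)) ∂μ := by
          simp_rw [hI, div_eq_mul_inv]
          rw [← lintegral_mul_const _ ((hKs n y).pow_const _)]
          refine lintegral_congr fun x => ?_
          rw [← mul_assoc]
          congr 1
          conv_rhs => rw [← ENNReal.rpow_one (K n x y)]
          rw [ENNReal.rpow_one, ← ENNReal.rpow_one (K n x y), ← ENNReal.rpow_mul, one_mul,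
            ← ENNReal.rpow_mul, one_mul,
            ← ENNReal.rpow_add_of_nonneg _ _ zero_le_one (by linarith [hPQ.lt])]
          congr 1; ring
      _ ≤ _ := by
          gcongr with x
          exact min_le_left _ _

/-- The converse of Hölder's inequality, from `exists_dual_seq` over a one-point parameter space.
Finiteness of the norm is a conclusion, not an assumption, which allows use on functions not yet
known to be in L^p. -/
theorem eLpNorm_le_of_dual [SigmaFinite μ] {p q : ℝ≥0∞} [hpq : p.HolderConjugate q]
    {H : X → ℝ≥0∞} (hH : Measurable H) {C : ℝ≥0∞}
    (h : ∀ G : X → ℝ≥0∞, Measurable G → ∫⁻ x, H x * G x ∂μ ≤ C * eLpNorm G q μ) :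
    eLpNorm H p μ ≤ C := by
  obtain ⟨G, hG, hG1, hG2⟩ := exists_dual_seq (μ := μ) (p := p) (q := q) (Y := Unit)
    (H := fun x _ => H x) (hH.comp measurable_fst)
  refine (hG2 ()).trans ?_
  refine liminf_le_of_le (by isBoundedDefault) fun b hb => ?_
  obtain ⟨n, hn⟩ := hb.exists
  refine hn.trans ((h _ ((hG n).comp measurable_prodMk_right)).trans ?_)
  calc C * _ ≤ C * 1 := by gcongr; exact hG1 n ()
    _ = C := mul_one C

end Duality

/-! ### Mixed Lebesgue norms: Hölder, duality and powers. -/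

section Mixed

variable {X Y : Type*} [MeasureSpace X] [MeasureSpace Y]

/-- The norm of `L^{p,q}` of a nonnegative function: the `L^p` norm in the first variable, then the
`L^q` norm in the second variable. -/
def mixE (p q : ℝ≥0∞) (F : X → Y → ℝ≥0∞) : ℝ≥0∞ :=
  eLpNorm (fun y => eLpNorm (fun x => F x y) p volume) q volume

theorem eLpNorm_ennreal_mono {μ : Measure X} {f g : X → ℝ≥0∞} (p : ℝ≥0∞) (h : ∀ x, f x ≤ g x) :
    eLpNorm f p μ ≤ eLpNorm g p μ :=
  eLpNorm_mono_enorm fun x => by simpa using h x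

theorem mixE_mono {p q : ℝ≥0∞} {F G : X → Y → ℝ≥0∞} (h : ∀ x y, F x y ≤ G x y) :
    mixE p q F ≤ mixE p q G :=
  eLpNorm_ennreal_mono q fun y => eLpNorm_ennreal_mono p fun x => h x y

theorem mixE_const_mul [SFinite (volume : Measure X)] (c : ℝ≥0∞) {p q : ℝ≥0∞} {F : X → Y → ℝ≥0∞}
    (hF : Measurable (Function.uncurry F)) :
    mixE p q (fun x y => c * F x y) = c * mixE p q F := by
  unfold mixE
  rw [← eLpNorm_ennreal_const_mul _ _ _ (measurable_eLpNorm_slice hF p)]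
  congr 1
  ext y
  exact eLpNorm_ennreal_const_mul _ _ _ (hF.comp measurable_prodMk_right)

theorem mixE_add_le [SFinite (volume : Measure X)] {p q : ℝ≥0∞} (hp : 1 ≤ p) (hq : 1 ≤ q)
    {F G : X → Y → ℝ≥0∞}
    (hF : Measurable (Function.uncurry F)) (hG : Measurable (Function.uncurry G)) :
    mixE p q (fun x y => F x y + G x y) ≤ mixE p q F + mixE p q G := by
  unfold mixE
  refine le_trans ?_ (eLpNorm_add_le (measurable_eLpNorm_slice hF p).aestronglyMeasurable
    (measurable_eLpNorm_slice hG p).aestronglyMeasurable hq)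
  refine eLpNorm_ennreal_mono q fun y => ?_
  exact eLpNorm_add_le (hF.comp measurable_prodMk_right).aestronglyMeasurable
    (hG.comp measurable_prodMk_right).aestronglyMeasurable hp

theorem mixE_rpow {p q : ℝ≥0∞} {t : ℝ} (ht : 0 < t) (F : X → Y → ℝ≥0∞) :
    mixE p q (fun x y => F x y ^ t) =
      mixE (p * ENNReal.ofReal t) (q * ENNReal.ofReal t) F ^ t := by
  unfold mixE
  have h2 : ∀ y, eLpNorm (fun x => F x y ^ t) p volume =
    eLpNorm (fun x => F x y) (p * ENNReal.ofReal t) volume ^ t := fun y => by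
      have := eLpNorm_enorm_rpow (μ := (volume : Measure X)) (p := p) (fun x => F x y) ht
      simpa using this
  simp_rw [h2]
  have := eLpNorm_enorm_rpow (μ := (volume : Measure Y)) (p := q)
    (fun y => eLpNorm (fun x => F x y) (p * ENNReal.ofReal t) volume) ht
  simpa using this

theorem lintegral_mul_le_mixE [SFinite (volume : Measure X)] {p q p' q' : ℝ≥0∞}
    [p.HolderConjugate p'] [q.HolderConjugate q']
    {F G : X → Y → ℝ≥0∞} (hF : Measurable (Function.uncurry F))
    (hG : Measurable (Function.uncurry G)) :
    ∫⁻ y, ∫⁻ x, F x y * G x y ≤ mixE p q F * mixE p' q' G := by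
  refine le_trans (lintegral_mono fun y => ?_) (lintegral_mul_le_eLpNorm
    (measurable_eLpNorm_slice hF p) (measurable_eLpNorm_slice hG p'))
  exact lintegral_mul_le_eLpNorm (hF.comp measurable_prodMk_right) (hG.comp measurable_prodMk_right)

/-- The norming functions of the slices depend measurably on y, so their products with a test
function g of y alone are admissible. Fatou's lemma passes to the limit in n, and scalar duality in
y finishes. -/
theorem mixE_le_of_dual [SigmaFinite (volume : Measure X)] [SigmaFinite (volume : Measure Y)]
    {p q p' q' : ℝ≥0∞} [p.HolderConjugate p'] [q.HolderConjugate q'] {H : X → Y → ℝ≥0∞}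
    (hH : Measurable (Function.uncurry H)) {C : ℝ≥0∞}
    (h : ∀ G : X → Y → ℝ≥0∞, Measurable (Function.uncurry G) →
      ∫⁻ y, ∫⁻ x, H x y * G x y ≤ C * mixE p' q' G) :
    mixE p q H ≤ C := by
  obtain ⟨G, hG, hG1, hG2⟩ := exists_dual_seq (μ := (volume : Measure X)) (p := p) (q := p') hH
  refine eLpNorm_le_of_dual (q := q') (measurable_eLpNorm_slice hH p) fun g hg => ?_
  have hGs : ∀ n y, Measurable fun x => G n x y := fun n y => (hG n).comp measurable_prodMk_right
  have hHs : ∀ y, Measurable fun x => H x y := fun y => hH.comp measurable_prodMk_right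
  have hm : ∀ n, Measurable fun z : X × Y => G n z.1 z.2 * g z.2 := fun n =>
    (hG n).mul (hg.comp measurable_snd)
  calc ∫⁻ y, eLpNorm (fun x => H x y) p volume * g y
      ≤ ∫⁻ y, liminf (fun n => ∫⁻ x, H x y * (G n x y * g y)) atTop := by
        refine lintegral_mono fun y => ?_
        have h1 : (fun n => ∫⁻ x, H x y * (G n x y * g y)) =
            (fun n => ∫⁻ x, H x y * G n x y) * fun _ => g y := by
          ext n
          simp only [Pi.mul_apply]
          rw [← lintegral_mul_const (f := fun x => H x y * G n x y) _ ((hHs y).mul (hGs n y))]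
          simp_rw [mul_assoc]
        rw [h1]
        refine le_trans ?_ ENNReal.le_liminf_mul
        rw [liminf_const]
        gcongr
        exact hG2 y
    _ ≤ liminf (fun n => ∫⁻ y, ∫⁻ x, H x y * (G n x y * g y)) atTop :=
        lintegral_liminf_le fun n => (hH.mul (hm n)).lintegral_prod_left'
    _ ≤ C * eLpNorm g q' volume := by
        refine liminf_le_of_le (by isBoundedDefault) fun b hb => ?_
        obtain ⟨n, hn⟩ := hb.exists
        refine hn.trans ((h (fun x y => G n x y * g y) (hm n)).trans ?_)
        gcongr
        refine eLpNorm_ennreal_mono q' fun y => ?_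
        simp_rw [mul_comm (G n _ y)]
        rw [eLpNorm_ennreal_const_mul _ _ _ (hGs n y)]
        calc g y * _ ≤ g y * 1 := by gcongr; exact hG1 n y
          _ = g y := mul_one _

/-- Tonelli for finite p; for p = ∞ the point is that a measurable set of the product is null if and
only if almost all its slices are. -/
theorem eLpNorm_prod_eq_mixE [SFinite (volume : Measure X)] [SFinite (volume : Measure Y)]
    {p : ℝ≥0∞} {F : X × Y → ℝ≥0∞} (hF : Measurable F) :
    eLpNorm F p volume = mixE p p fun x y => F (x, y) := by
  unfold mixE
  by_cases h0 : p = 0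
  · simp [h0]
  by_cases h1 : p = ∞
  · subst h1
    simp only [eLpNorm_ennreal_top]
    refine le_antisymm (essSup_le_of_ae_le _ ?_) (essSup_le_of_ae_le _ ?_)
    · set M := essSup (fun y => essSup (fun x => F (x, y)) volume) volume
      have hs : MeasurableSet {z : X × Y | F z ≤ M} := measurableSet_le hF measurable_const
      have h2 : ∀ᵐ y : Y, ∀ᵐ x : X, F (x, y) ≤ M := by
        filter_upwards [ENNReal.ae_le_essSup (μ := volume)
          (fun y => essSup (fun x => F (x, y)) volume)] with y hy
        filter_upwards [ENNReal.ae_le_essSup (μ := volume) (fun x => F (x, y))] with x hx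
        exact hx.trans hy
      exact (Measure.ae_prod_iff_ae_ae hs).2 ((Measure.ae_ae_comm hs).2 h2)
    · have hs : MeasurableSet {z : X × Y | F z ≤ essSup F volume} :=
        measurableSet_le hF measurable_const
      have h2 := (Measure.ae_ae_comm hs).1
        (Measure.ae_ae_of_ae_prod (ENNReal.ae_le_essSup (μ := volume) F))
      filter_upwards [h2] with y hy
      exact essSup_le_of_ae_le _ hy
  · have hp : 0 < p.toReal := ENNReal.toReal_pos h0 h1
    simp only [eLpNorm_ennreal h0 h1]
    congr 1
    rw [Measure.volume_eq_prod, lintegral_prod_symm' _ (hF.pow_const _)]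
    refine lintegral_congr fun y => ?_
    rw [← ENNReal.rpow_mul, one_div_mul_cancel hp.ne', ENNReal.rpow_one]

end Mixed

end WeylMod

namespace WeylMod

open Filter Topology

/-! ### Young's inequality on a group. -/

section Young

variable {G : Type*} [AddCommGroup G] [MeasureSpace G] [MeasurableAdd₂ G] [MeasurableNeg G]
  [SigmaFinite (volume : Measure G)] [(volume : Measure G).IsAddLeftInvariant]
  [(volume : Measure G).IsNegInvariant]

/-- In Young's inequality an infinite exponent forces the two others to be 1. This disposes of the
endpoint cases, to which the power argument does not apply. -/
theorem inv_eq_one_of_add_add_eq_two {b c : ℝ≥0∞} (hb : 1 ≤ b) (hc : 1 ≤ c)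
    (h : b⁻¹ + c⁻¹ = 2) : b = 1 ∧ c = 1 := by
  have hb' : b⁻¹ ≤ 1 := ENNReal.inv_le_one.2 hb
  have hc' : c⁻¹ ≤ 1 := ENNReal.inv_le_one.2 hc
  have e : ∀ {x y : ℝ≥0∞}, x ≤ 1 → y ≤ 1 → x + y = 2 → x = 1 := by
    intro x y hx hy hxy
    refine le_antisymm hx (not_lt.1 fun hlt => ?_)
    have : x + y < 1 + 1 := ENNReal.add_lt_add_of_lt_of_le (hy.trans_lt ENNReal.one_lt_top).ne hlt hy
    rw [hxy, one_add_one_eq_two] at this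
    exact lt_irrefl _ this
  exact ⟨ENNReal.inv_eq_one.1 (e hb' hc' h), ENNReal.inv_eq_one.1 (e hc' hb' (by rwa [add_comm]))⟩

theorem lintegral_lintegral_mul_comp_sub {f h : G → ℝ≥0∞} (hf : Measurable f) (hh : Measurable h) :
    ∫⁻ x, ∫⁻ y, f x * h (x - y) = (∫⁻ x, f x) * ∫⁻ x, h x := by
  have h1 : ∀ x, ∫⁻ y, f x * h (x - y) = f x * ∫⁻ y, h y := fun x => by
    have hm : Measurable fun y => h (x - y) := by fun_prop
    rw [lintegral_const_mul _ hm, lintegral_sub_left_eq_self (fun y => h y)]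
  simp_rw [h1]
  rw [lintegral_mul_const _ hf]

theorem lintegral_lintegral_mul_comp_sub' {g h : G → ℝ≥0∞} (hg : Measurable g) (hh : Measurable h) :
    ∫⁻ x, ∫⁻ y, g y * h (x - y) = (∫⁻ x, g x) * ∫⁻ x, h x := by
  rw [lintegral_lintegral_swap]
  · have h1 : ∀ y, ∫⁻ x, g y * h (x - y) = g y * ∫⁻ x, h x := fun y => by
      have hm : Measurable fun x => h (x - y) := by fun_prop
      rw [lintegral_const_mul _ hm, lintegral_sub_right_eq_self (fun y => h y)]
    simp_rw [h1]
    rw [lintegral_mul_const _ hg]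
  · exact ((hg.comp measurable_snd).mul (hh.comp measurable_sub)).aemeasurable

/-- Young's inequality in its trilinear form. -/
theorem lintegral_young {a b c : ℝ≥0∞} (ha : 1 ≤ a) (hb : 1 ≤ b) (hc : 1 ≤ c)
    (habc : a⁻¹ + b⁻¹ + c⁻¹ = 2) {f g h : G → ℝ≥0∞} (hf : Measurable f) (hg : Measurable g)
    (hh : Measurable h) :
    ∫⁻ x, ∫⁻ y, f x * g y * h (x - y) ≤
      eLpNorm f a volume * eLpNorm g b volume * eLpNorm h c volume := by
  by_cases ha1 : a = ∞
  · subst ha1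
    obtain ⟨rfl, rfl⟩ := inv_eq_one_of_add_add_eq_two hb hc (by simpa using habc)
    simp only [eLpNorm_ennreal_one, eLpNorm_ennreal_top]
    rw [mul_assoc, ← lintegral_lintegral_mul_comp_sub' hg hh, ← lintegral_const_mul]
    · refine lintegral_mono_ae ?_
      filter_upwards [ENNReal.ae_le_essSup (μ := volume) f] with x hx
      simp_rw [mul_assoc]
      have hm : Measurable fun y => g y * h (x - y) := by fun_prop
      rw [lintegral_const_mul _ hm]
      gcongr
    · exact Measurable.lintegral_prod_right' (f := fun z : G × G => g z.2 * h (z.1 - z.2))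
        ((hg.comp measurable_snd).mul (hh.comp measurable_sub))
  by_cases hb1 : b = ∞
  · subst hb1
    obtain ⟨rfl, rfl⟩ := inv_eq_one_of_add_add_eq_two ha hc (by simpa using habc)
    simp only [eLpNorm_ennreal_one, eLpNorm_ennreal_top]
    rw [mul_comm (∫⁻ x, f x), mul_assoc, ← lintegral_lintegral_mul_comp_sub hf hh,
      ← lintegral_const_mul]
    · refine lintegral_mono fun x => ?_
      have hm : Measurable fun y => f x * h (x - y) := by fun_prop
      rw [← lintegral_const_mul _ hm]
      refine lintegral_mono_ae ?_
      filter_upwards [ENNReal.ae_le_essSup (μ := volume) g] with y hy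
      calc _ = g y * (f x * h (x - y)) := by ring
        _ ≤ _ := by gcongr
    · exact Measurable.lintegral_prod_right' (f := fun z : G × G => f z.1 * h (z.1 - z.2))
        ((hf.comp measurable_fst).mul (hh.comp measurable_sub))
  by_cases hc1 : c = ∞
  · subst hc1
    obtain ⟨rfl, rfl⟩ := inv_eq_one_of_add_add_eq_two ha hb (by simpa using habc)
    simp only [eLpNorm_ennreal_one, eLpNorm_ennreal_top]
    have h0 : ∀ x, ∫⁻ y, f x * g y * h (x - y) ≤ f x * ((∫⁻ y, g y) * essSup h volume) := by
      intro x
      rw [← lintegral_mul_const _ hg, ← lintegral_const_mul _ (hg.mul_const _)]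
      refine lintegral_mono_ae ?_
      have hmp : MeasurePreserving (fun y : G => x - y) volume volume :=
        Measure.measurePreserving_sub_left volume x
      filter_upwards [hmp.quasiMeasurePreserving.ae (ENNReal.ae_le_essSup (μ := volume) h)] with y hy
      rw [mul_assoc]
      gcongr
    refine (lintegral_mono h0).trans_eq ?_
    rw [lintegral_mul_const _ hf]
    ring
  have ha0 : a ≠ 0 := (zero_lt_one.trans_le ha).ne'
  have hb0 : b ≠ 0 := (zero_lt_one.trans_le hb).ne'
  have hc0 : c ≠ 0 := (zero_lt_one.trans_le hc).ne'
  rw [eLpNorm_ennreal ha0 ha1, eLpNorm_ennreal hb0 hb1, eLpNorm_ennreal hc0 hc1]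
  have hinv : a.toReal⁻¹ + b.toReal⁻¹ + c.toReal⁻¹ = 2 := by
    have := congrArg ENNReal.toReal habc
    rwa [ENNReal.toReal_add (by simp [ha0, hb0]) (by simp [hc0]),
      ENNReal.toReal_add (by simp [ha0]) (by simp [hb0]), ENNReal.toReal_inv, ENNReal.toReal_inv,
      ENNReal.toReal_inv] at this
  have ha' : 1 ≤ a.toReal := by simpa using ENNReal.toReal_mono ha1 ha
  have hb' : 1 ≤ b.toReal := by simpa using ENNReal.toReal_mono hb1 hb
  have hc' : 1 ≤ c.toReal := by simpa using ENNReal.toReal_mono hc1 hc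
  generalize a.toReal = α at *
  generalize b.toReal = β at *
  generalize c.toReal = γ at *
  have iα : α⁻¹ ≤ 1 := inv_le_one_of_one_le₀ ha'
  have iβ : β⁻¹ ≤ 1 := inv_le_one_of_one_le₀ hb'
  have iγ : γ⁻¹ ≤ 1 := inv_le_one_of_one_le₀ hc'
  -- Hölder with three factors, each the product of two of the powers f^α, g^β, h^γ. The exponents 1
  -- - 1/γ, 1 - 1/α, 1 - 1/β add up to 1, and each function occurs with total power 1, for instance
  -- α(2 - 1/γ - 1/β) = 1. Each factor integrates to a product of two integrals.
  set F : Fin 3 → G × G → ℝ≥0∞ := ![fun z => f z.1 ^ α * g z.2 ^ β,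
    fun z => g z.2 ^ β * h (z.1 - z.2) ^ γ, fun z => f z.1 ^ α * h (z.1 - z.2) ^ γ] with hF
  set θ : Fin 3 → ℝ := ![1 - γ⁻¹, 1 - α⁻¹, 1 - β⁻¹] with hθ
  have m1 : Measurable fun z : G × G => f z.1 ^ α := (hf.comp measurable_fst).pow_const _
  have m2 : Measurable fun z : G × G => g z.2 ^ β := (hg.comp measurable_snd).pow_const _
  have m3 : Measurable fun z : G × G => h (z.1 - z.2) ^ γ := (hh.comp measurable_sub).pow_const _
  have key := ENNReal.lintegral_prod_norm_pow_le (μ := (volume : Measure (G × G))) Finset.univ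
    (f := F) (p := θ) (by
      intro i _
      fin_cases i
      · exact (m1.mul m2).aemeasurable
      · exact (m2.mul m3).aemeasurable
      · exact (m1.mul m3).aemeasurable)
    (by simp [hθ, Fin.sum_univ_three]; linarith)
    (by intro i _; fin_cases i <;> simp [hθ] <;> assumption)
  have split : ∀ (x : ℝ≥0∞) {r s t : ℝ}, 1 ≤ t → 0 ≤ r → 0 ≤ s → r + s = t⁻¹ →
      (x ^ t) ^ r * (x ^ t) ^ s = x := by
    intro x r s t ht hr hs hrs
    rw [← ENNReal.rpow_add_of_nonneg _ _ hr hs, hrs, ← ENNReal.rpow_mul,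
      mul_inv_cancel₀ (by positivity), ENNReal.rpow_one]
  have n1 : 0 ≤ 1 - α⁻¹ := by linarith
  have n2 : 0 ≤ 1 - β⁻¹ := by linarith
  have n3 : 0 ≤ 1 - γ⁻¹ := by linarith
  calc ∫⁻ x, ∫⁻ y, f x * g y * h (x - y)
      = ∫⁻ z : G × G, f z.1 * g z.2 * h (z.1 - z.2) := by
        rw [Measure.volume_eq_prod, lintegral_prod]
        exact (((hf.comp measurable_fst).mul (hg.comp measurable_snd)).mul
          (hh.comp measurable_sub)).aemeasurable
    _ = ∫⁻ z : G × G, ∏ i, F i z ^ θ i := by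
        refine lintegral_congr fun z => ?_
        rw [Fin.prod_univ_three]
        simp only [hF, hθ, Matrix.cons_val]
        rw [ENNReal.mul_rpow_of_nonneg _ _ n1, ENNReal.mul_rpow_of_nonneg _ _ n2,
          ENNReal.mul_rpow_of_nonneg _ _ n3]
        conv_lhs => rw [← split (f z.1) ha' n3 n2 (by linarith),
          ← split (g z.2) hb' n3 n1 (by linarith), ← split (h (z.1 - z.2)) hc' n1 n2 (by linarith)]
        ring
    _ ≤ ∏ i, (∫⁻ z, F i z) ^ θ i := key
    _ = _ := by
        have e1 : ∫⁻ z : G × G, f z.1 ^ α * g z.2 ^ β = (∫⁻ x, f x ^ α) * ∫⁻ x, g x ^ β := by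
          rw [Measure.volume_eq_prod, lintegral_prod_mul (hf.pow_const _).aemeasurable
            (hg.pow_const _).aemeasurable]
        have e2 : ∫⁻ z : G × G, g z.2 ^ β * h (z.1 - z.2) ^ γ =
            (∫⁻ x, g x ^ β) * ∫⁻ x, h x ^ γ := by
          rw [Measure.volume_eq_prod, lintegral_prod]
          · exact lintegral_lintegral_mul_comp_sub' (hg.pow_const β) (hh.pow_const γ)
          · exact (m2.mul m3).aemeasurable
        have e3 : ∫⁻ z : G × G, f z.1 ^ α * h (z.1 - z.2) ^ γ =
            (∫⁻ x, f x ^ α) * ∫⁻ x, h x ^ γ := by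
          rw [Measure.volume_eq_prod, lintegral_prod]
          · exact lintegral_lintegral_mul_comp_sub (hf.pow_const α) (hh.pow_const γ)
          · exact (m1.mul m3).aemeasurable
        rw [Fin.prod_univ_three]
        simp only [hF, hθ, Matrix.cons_val, e1, e2, e3, one_div]
        rw [ENNReal.mul_rpow_of_nonneg _ _ n1, ENNReal.mul_rpow_of_nonneg _ _ n2,
          ENNReal.mul_rpow_of_nonneg _ _ n3]
        have s1 : α⁻¹ = (1 - γ⁻¹) + (1 - β⁻¹) := by linarith
        have s2 : β⁻¹ = (1 - γ⁻¹) + (1 - α⁻¹) := by linarith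
        have s3 : γ⁻¹ = (1 - α⁻¹) + (1 - β⁻¹) := by linarith
        conv_rhs => rw [s1, ENNReal.rpow_add_of_nonneg _ _ n3 n2]
        conv_rhs => enter [1,2]; rw [s2, ENNReal.rpow_add_of_nonneg _ _ n3 n1]
        conv_rhs => enter [2]; rw [s3, ENNReal.rpow_add_of_nonneg _ _ n1 n2]
        ring

end Young

end WeylMod

namespace WeylMod

open Filter Topology

variable {E : Type*} [NormedAddCommGroup E] [InnerProductSpace ℝ E] [FiniteDimensional ℝ E]
  [MeasurableSpace E] [BorelSpace E]

/-! ### Young's inequality in mixed norms and the bilinear estimate for midpoint kernels. -/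

instance isAddHaarMeasure_volume_prod : (volume : Measure (E × E)).IsAddHaarMeasure :=
  inferInstanceAs (((volume : Measure E).prod volume).IsAddHaarMeasure)

/-- Young's inequality for mixed norms, in its trilinear form. -/
theorem lintegral_young_mixE {a₁ b₁ c₁ a₂ b₂ c₂ : ℝ≥0∞} (ha₁ : 1 ≤ a₁) (hb₁ : 1 ≤ b₁) (hc₁ : 1 ≤ c₁)
    (h₁ : a₁⁻¹ + b₁⁻¹ + c₁⁻¹ = 2) (ha₂ : 1 ≤ a₂) (hb₂ : 1 ≤ b₂) (hc₂ : 1 ≤ c₂)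
    (h₂ : a₂⁻¹ + b₂⁻¹ + c₂⁻¹ = 2) {F G H : E → E → ℝ≥0∞} (hF : Measurable (Function.uncurry F))
    (hG : Measurable (Function.uncurry G)) (hH : Measurable (Function.uncurry H)) :
    ∫⁻ z : E × E, ∫⁻ w : E × E, F z.1 z.2 * G w.1 w.2 * H (z.1 - w.1) (z.2 - w.2) ≤
      mixE a₁ a₂ F * mixE b₁ b₂ G * mixE c₁ c₂ H := by
  have hF' : Measurable fun z : E × E => F z.1 z.2 := hF
  have hG' : Measurable fun z : E × E => G z.1 z.2 := hG
  have hH' : Measurable fun z : E × E => H z.1 z.2 := hH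
  have mF : Measurable fun t : (E × E) × (E × E) => F t.1.1 t.1.2 := hF'.comp measurable_fst
  have mG : Measurable fun t : (E × E) × (E × E) => G t.2.1 t.2.2 := hG'.comp measurable_snd
  have mH : Measurable fun t : (E × E) × (E × E) => H (t.1.1 - t.2.1) (t.1.2 - t.2.2) :=
    hH'.comp (measurable_fst.sub measurable_snd)
  have mK : Measurable fun t : (E × E) × (E × E) =>
      F t.1.1 t.1.2 * G t.2.1 t.2.2 * H (t.1.1 - t.2.1) (t.1.2 - t.2.2) := (mF.mul mG).mul mH
  calc ∫⁻ z : E × E, ∫⁻ w : E × E, F z.1 z.2 * G w.1 w.2 * H (z.1 - w.1) (z.2 - w.2)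
      = ∫⁻ ξ, ∫⁻ x, ∫⁻ η, ∫⁻ y, F x ξ * G y η * H (x - y) (ξ - η) := by
        rw [Measure.volume_eq_prod, lintegral_prod_symm' _
          (Measurable.lintegral_prod_right' (f := fun t : (E × E) × (E × E) =>
            F t.1.1 t.1.2 * G t.2.1 t.2.2 * H (t.1.1 - t.2.1) (t.1.2 - t.2.2)) mK)]
        refine lintegral_congr fun ξ => lintegral_congr fun x => ?_
        rw [lintegral_prod_symm']
        exact mK.comp (measurable_prodMk_left (x := (x, ξ)))
    -- With both frequencies outside, scalar Young applies in the positions for fixed ξ, η; it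
    -- leaves the slice norms as functions of the frequencies, to which scalar Young applies again.
    _ = ∫⁻ ξ, ∫⁻ η, ∫⁻ x, ∫⁻ y, F x ξ * G y η * H (x - y) (ξ - η) := by
        refine lintegral_congr fun ξ => ?_
        rw [lintegral_lintegral_swap]
        refine Measurable.aemeasurable ?_
        have : Measurable fun t : (E × E) × E => F t.1.1 ξ * G t.2 t.1.2 * H (t.1.1 - t.2) (ξ - t.1.2) :=
          mK.comp (f := fun t : (E × E) × E => ((t.1.1, ξ), (t.2, t.1.2))) (by fun_prop)
        exact this.lintegral_prod_right'
    _ ≤ ∫⁻ ξ, ∫⁻ η, eLpNorm (fun x => F x ξ) a₁ volume * eLpNorm (fun x => G x η) b₁ volume *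
          eLpNorm (fun x => H x (ξ - η)) c₁ volume := by
        refine lintegral_mono fun ξ => lintegral_mono fun η => ?_
        exact lintegral_young ha₁ hb₁ hc₁ h₁ (hF.comp measurable_prodMk_right)
          (hG.comp measurable_prodMk_right) (hH.comp measurable_prodMk_right)
    _ ≤ _ := lintegral_young (h := fun ξ => eLpNorm (fun x => H x ξ) c₁ volume) ha₂ hb₂ hc₂ h₂
          (measurable_eLpNorm_slice hF a₁) (measurable_eLpNorm_slice hG b₁)
          (measurable_eLpNorm_slice hH c₁)

/-- The exponent `r` with `1 / p + 1 / r = 1 + 1 / p'`. -/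
def youngExponent (p p' : ℝ≥0∞) : ℝ≥0∞ := (1 + p'⁻¹ - p⁻¹)⁻¹

theorem one_le_youngExponent {p p' : ℝ≥0∞} (h : p ≤ p') : 1 ≤ youngExponent p p' := by
  rw [youngExponent, ENNReal.one_le_inv]
  refine tsub_le_iff_right.2 ?_
  gcongr

theorem youngExponent_add {p p' : ℝ≥0∞} (hp : 1 ≤ p) :
    p⁻¹ + (youngExponent p p')⁻¹ = 1 + p'⁻¹ := by
  rw [youngExponent, inv_inv]
  exact add_tsub_cancel_of_le ((ENNReal.inv_le_one.2 hp).trans le_self_add)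

/-- Convolution with `Q` maps `L^{p,q}` to `L^{p',q'}` for larger exponents. -/
theorem mixE_le_of_le_convolution {p p' q q' : ℝ≥0∞} (hp : 1 ≤ p) (hpp' : p ≤ p') (hq : 1 ≤ q)
    (hqq' : q ≤ q') {U U' Q : E → E → ℝ≥0∞} (hU : Measurable (Function.uncurry U))
    (hU' : Measurable (Function.uncurry U')) (hQ : Measurable (Function.uncurry Q))
    (h : ∀ x ξ, U' x ξ ≤ ∫⁻ z : E × E, U z.1 z.2 * Q (z.1 - x) (z.2 - ξ)) :
    mixE p' q' U' ≤ mixE p q U * mixE (youngExponent p p') (youngExponent q q') Q := by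
  have hp' : 1 ≤ p' := hp.trans hpp'
  have hq' : 1 ≤ q' := hq.trans hqq'
  have : p'.HolderConjugate p'.conjExponent := .conjExponent hp'
  have : q'.HolderConjugate q'.conjExponent := .conjExponent hq'
  -- The exponent of the kernel is chosen so that, after dualising the target, the three reciprocals
  -- add up to 1 + 1/p' + (1 - 1/p') = 2.
  have key : ∀ {p p' : ℝ≥0∞} [p'.HolderConjugate p'.conjExponent], 1 ≤ p →
      p⁻¹ + p'.conjExponent⁻¹ + (youngExponent p p')⁻¹ = 2 := by
    intro p p' _ hp
    rw [add_right_comm, youngExponent_add hp, add_assoc,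
      ENNReal.HolderConjugate.inv_add_inv_eq_one p' p'.conjExponent, one_add_one_eq_two]
  refine mixE_le_of_dual (p' := p'.conjExponent) (q' := q'.conjExponent) hU' fun G hG => ?_
  have hU2 : Measurable fun z : E × E => U z.1 z.2 := hU
  have hU3 : Measurable fun z : E × E => U' z.1 z.2 := hU'
  have hG2 : Measurable fun z : E × E => G z.1 z.2 := hG
  have hQ2 : Measurable fun z : E × E => Q z.1 z.2 := hQ
  have mK : Measurable fun t : (E × E) × (E × E) => U t.1.1 t.1.2 * G t.2.1 t.2.2 *
      Q (t.1.1 - t.2.1) (t.1.2 - t.2.2) := ((hU2.comp measurable_fst).mul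
        (hG2.comp measurable_snd)).mul (hQ2.comp (measurable_fst.sub measurable_snd))
  calc ∫⁻ ξ, ∫⁻ x, U' x ξ * G x ξ = ∫⁻ w : E × E, U' w.1 w.2 * G w.1 w.2 := by
        rw [Measure.volume_eq_prod, lintegral_prod_symm']
        exact hU3.mul hG2
    _ ≤ ∫⁻ w : E × E, ∫⁻ z : E × E, U z.1 z.2 * G w.1 w.2 * Q (z.1 - w.1) (z.2 - w.2) := by
        refine lintegral_mono fun w => ?_
        have hm : Measurable fun z : E × E => U z.1 z.2 * Q (z.1 - w.1) (z.2 - w.2) :=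
          hU2.mul (hQ2.comp (measurable_id.sub (measurable_const (a := w))))
        calc U' w.1 w.2 * G w.1 w.2
            ≤ (∫⁻ z : E × E, U z.1 z.2 * Q (z.1 - w.1) (z.2 - w.2)) * G w.1 w.2 := by
              gcongr; exact h _ _
          _ = _ := by
              rw [← lintegral_mul_const _ hm]
              exact lintegral_congr fun z => by ring
    _ = ∫⁻ z : E × E, ∫⁻ w : E × E, U z.1 z.2 * G w.1 w.2 * Q (z.1 - w.1) (z.2 - w.2) :=
        (lintegral_lintegral_swap mK.aemeasurable).symm
    _ ≤ mixE p q U * mixE p'.conjExponent q'.conjExponent G *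
          mixE (youngExponent p p') (youngExponent q q') Q :=
        lintegral_young_mixE hp (ENNReal.HolderConjugate.one_le _ p') (one_le_youngExponent hpp')
          (key hp) hq (ENNReal.HolderConjugate.one_le _ q') (one_le_youngExponent hqq') (key hq)
          hU hG hQ
    _ = _ := by ring

theorem ae_mul_comp_sub_le {A B : E × E → ℝ≥0∞} (hA : Measurable A) (hB : Measurable B) (u : E × E) :
    eLpNorm (fun z => A z * B (z - u)) ∞ volume ≤ mixE ∞ ∞ (fun x ξ => A (x, ξ)) *
      mixE ∞ ∞ (fun x ξ => B (x, ξ)) := by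
  rw [← eLpNorm_prod_eq_mixE hA, ← eLpNorm_prod_eq_mixE hB]
  simp only [eLpNorm_ennreal_top]
  refine essSup_le_of_ae_le _ ?_
  have hmp : MeasurePreserving (fun y : E × E => y - u) volume volume :=
    measurePreserving_sub_right volume u
  filter_upwards [ENNReal.ae_le_essSup (μ := volume) A,
    hmp.quasiMeasurePreserving.ae (ENNReal.ae_le_essSup (μ := volume) B)] with z h1 h2
  gcongr

/-- The product of `A` and a translate of `B` in `L^P`, as a function of the translation. -/
theorem eLpNorm_mul_comp_sub_le {P Q a₁ a₂ b₁ b₂ : ℝ≥0∞} (hP : 1 ≤ P) (hPQ : P ≤ Q)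
    (ha₁ : P ≤ a₁) (ha₂ : P ≤ a₂) (hb₁ : P ≤ b₁) (hb₂ : P ≤ b₂)
    (h₁ : b₁⁻¹ + a₁⁻¹ = P⁻¹ + Q⁻¹) (h₂ : b₂⁻¹ + a₂⁻¹ = P⁻¹ + Q⁻¹)
    {A B : E × E → ℝ≥0∞} (hA : Measurable A) (hB : Measurable B) :
    eLpNorm (fun u => eLpNorm (fun z => A z * B (z - u)) P volume) Q volume ≤
      mixE b₁ b₂ (fun x ξ => A (x, ξ)) * mixE a₁ a₂ (fun x ξ => B (x, ξ)) := by
  by_cases hP1 : P = ∞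
  · subst hP1
    obtain rfl := top_le_iff.1 hPQ
    obtain rfl := top_le_iff.1 ha₁
    obtain rfl := top_le_iff.1 ha₂
    obtain rfl := top_le_iff.1 hb₁
    obtain rfl := top_le_iff.1 hb₂
    rw [eLpNorm_ennreal_top]
    exact essSup_le_of_ae_le _ (Eventually.of_forall fun u => ae_mul_comp_sub_le hA hB u)
  have hP0 : P ≠ 0 := (zero_lt_one.trans_le hP).ne'
  set t := P.toReal with ht
  have ht0 : 0 < t := ENNReal.toReal_pos hP0 hP1
  have htP : ENNReal.ofReal t = P := ENNReal.ofReal_toReal hP1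
  -- The power trick: the P-th power of the inner norm is the correlation Ψ of A^P and B^P, to be
  -- estimated in L^r. Young needs P/b + P/a + 1 - P/Q = 2, which is the relation assumed between
  -- the exponents; r ≥ 1 and a/P, b/P ≥ 1 are the remaining hypotheses.
  set r := Q * P⁻¹ with hr
  have hr1 : 1 ≤ r := by
    rw [hr, ← ENNReal.mul_inv_cancel hP0 hP1]
    gcongr
  have hcon : r.HolderConjugate r.conjExponent := .conjExponent hr1
  set Ψ : E × E → ℝ≥0∞ := fun u => ∫⁻ z, A z ^ t * B (z - u) ^ t with hΨ
  have mK : Measurable fun s : (E × E) × (E × E) => A s.2 ^ t * B (s.2 - s.1) ^ t :=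
    ((hA.comp measurable_snd).pow_const _).mul
      ((hB.comp (measurable_snd.sub measurable_fst)).pow_const _)
  have hΨm : Measurable Ψ := mK.lintegral_prod_right'
  have e1 : ∀ u, eLpNorm (fun z => A z * B (z - u)) P volume = Ψ u ^ t⁻¹ := fun u => by
    rw [eLpNorm_ennreal hP0 hP1, ← ht, one_div]
    simp only [ENNReal.mul_rpow_of_nonneg _ _ ht0.le, hΨ]
  simp_rw [e1]
  have e2 : eLpNorm (fun u => Ψ u ^ t⁻¹) Q volume = eLpNorm Ψ r volume ^ t⁻¹ := by
    have := eLpNorm_enorm_rpow (μ := (volume : Measure (E × E))) (p := Q) Ψ (inv_pos.2 ht0)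
    rw [ENNReal.ofReal_inv_of_pos ht0, htP] at this
    simpa using this
  rw [e2, ENNReal.rpow_inv_le_iff ht0, ENNReal.mul_rpow_of_nonneg _ _ ht0.le]
  have e3 : ∀ (a₁ a₂ : ℝ≥0∞) (F : E × E → ℝ≥0∞), mixE a₁ a₂ (fun x ξ => F (x, ξ)) ^ t =
      mixE (a₁ * P⁻¹) (a₂ * P⁻¹) (fun x ξ => F (x, ξ) ^ t) := by
    intro a₁ a₂ F
    rw [mixE_rpow ht0, htP, mul_assoc, mul_assoc, ENNReal.inv_mul_cancel hP0 hP1, mul_one, mul_one]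
  rw [e3, e3]
  have ex : ∀ {a b : ℝ≥0∞}, P ≤ a → P ≤ b → b⁻¹ + a⁻¹ = P⁻¹ + Q⁻¹ →
      (b * P⁻¹)⁻¹ + (a * P⁻¹)⁻¹ + (r.conjExponent)⁻¹ = 2 ∧ 1 ≤ a * P⁻¹ ∧ 1 ≤ b * P⁻¹ := by
    intro a b ha hb hab
    have i1 : ∀ c : ℝ≥0∞, (c * P⁻¹)⁻¹ = c⁻¹ * P := fun c => by
      rw [ENNReal.mul_inv (Or.inr (by simpa)) (Or.inr (by simpa)), inv_inv]
    have i2 : ∀ c : ℝ≥0∞, P ≤ c → 1 ≤ c * P⁻¹ := fun c hc => by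
      rw [← ENNReal.mul_inv_cancel hP0 hP1]; gcongr
    refine ⟨?_, i2 a ha, i2 b hb⟩
    rw [i1, i1, ← add_mul, hab, add_mul, ENNReal.inv_mul_cancel hP0 hP1, ← i1 Q, ← hr, add_assoc,
      ENNReal.HolderConjugate.inv_add_inv_eq_one r r.conjExponent, one_add_one_eq_two]
  obtain ⟨x1, y1, z1⟩ := ex ha₁ hb₁ h₁
  obtain ⟨x2, y2, z2⟩ := ex ha₂ hb₂ h₂
  have hr' : 1 ≤ r.conjExponent := ENNReal.HolderConjugate.one_le _ r
  refine eLpNorm_le_of_dual (q := r.conjExponent) hΨm fun G hG => ?_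
  calc ∫⁻ u, Ψ u * G u = ∫⁻ u, ∫⁻ z, A z ^ t * B (z - u) ^ t * G u := by
        refine lintegral_congr fun u => ?_
        rw [hΨ, ← lintegral_mul_const]
        exact mK.comp measurable_prodMk_left
    _ = ∫⁻ z, ∫⁻ u, A z ^ t * B (z - u) ^ t * G u :=
        lintegral_lintegral_swap (mK.mul (hG.comp measurable_fst)).aemeasurable
    _ = ∫⁻ z, ∫⁻ w, A z ^ t * B w ^ t * G (z - w) := by
        refine lintegral_congr fun z => ?_
        rw [← lintegral_sub_left_eq_self _ z]
        simp
    _ ≤ _ := by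
        rw [eLpNorm_prod_eq_mixE hG]
        exact lintegral_young_mixE (F := fun x ξ => A (x, ξ) ^ t) (G := fun x ξ => B (x, ξ) ^ t)
          (H := fun x ξ => G (x, ξ)) z1 y1 hr' x1 z2 y2 hr' x2 (hA.pow_const _) (hB.pow_const _) hG

theorem measurePreserving_rotate :
    MeasurePreserving (fun u : E × E => (u.2, -u.1)) volume volume := by
  have h1 : MeasurePreserving (Prod.swap : E × E → E × E) volume volume := Measure.measurePreserving_swap
  have h2 : MeasurePreserving (Prod.map id Neg.neg : E × E → E × E) volume volume :=
    (MeasurePreserving.id volume).prod (Measure.measurePreserving_neg volume)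
  exact h2.comp h1

/-- The boundedness of the form that corresponds to the Weyl pairing, in terms of short-time Fourier
transforms. -/
theorem lintegral_midpoint_form_le {p q P Q a₁ a₂ b₁ b₂ : ℝ≥0∞} [p.HolderConjugate P]
    [q.HolderConjugate Q] (hPQ : P ≤ Q) (ha₁ : P ≤ a₁) (ha₂ : P ≤ a₂) (hb₁ : P ≤ b₁) (hb₂ : P ≤ b₂)
    (h₁ : b₁⁻¹ + a₁⁻¹ = P⁻¹ + Q⁻¹) (h₂ : b₂⁻¹ + a₂⁻¹ = P⁻¹ + Q⁻¹)
    {A B : E × E → ℝ≥0∞} (hA : Measurable A) (hB : Measurable B) {S : E × E → E × E → ℝ≥0∞}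
    (hS : Measurable (Function.uncurry S)) :
    ∫⁻ z : E × E, ∫⁻ w : E × E,
      S ((2⁻¹ : ℝ) • (z + w)) ((z - w).2, -(z - w).1) * A z * B w ≤
      mixE p q S * mixE b₁ b₂ (fun x ξ => A (x, ξ)) * mixE a₁ a₂ (fun x ξ => B (x, ξ)) := by
  have hS2 : Measurable fun z : (E × E) × (E × E) => S z.1 z.2 := hS
  have mJ : Measurable fun u : E × E => (u.2, -u.1) := measurable_snd.prodMk measurable_fst.neg
  have mS : Measurable fun s : (E × E) × (E × E) => S (s.1 - (2⁻¹ : ℝ) • s.2) (s.2.2, -s.2.1) :=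
    hS2.comp (f := fun s : (E × E) × (E × E) => (s.1 - (2⁻¹ : ℝ) • s.2, (s.2.2, -s.2.1)))
      ((measurable_fst.sub (measurable_snd.const_smul (2⁻¹ : ℝ))).prodMk (mJ.comp measurable_snd))
  have mAB : Measurable fun s : (E × E) × (E × E) => A s.1 * B (s.1 - s.2) :=
    (hA.comp measurable_fst).mul (hB.comp (measurable_fst.sub measurable_snd))
  calc ∫⁻ z : E × E, ∫⁻ w : E × E, S ((2⁻¹ : ℝ) • (z + w)) ((z - w).2, -(z - w).1) * A z * B w
      -- The substitution w = z - u turns the difference into u and the midpoint into z - u/2.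
      = ∫⁻ z : E × E, ∫⁻ u : E × E, S (z - (2⁻¹ : ℝ) • u) (u.2, -u.1) * (A z * B (z - u)) := by
        refine lintegral_congr fun z => ?_
        rw [← lintegral_sub_left_eq_self _ z]
        refine lintegral_congr fun u => ?_
        rw [sub_sub_cancel, mul_assoc]
        congr 2
        module
    _ = ∫⁻ u : E × E, ∫⁻ z : E × E, S (z - (2⁻¹ : ℝ) • u) (u.2, -u.1) * (A z * B (z - u)) :=
        lintegral_lintegral_swap (mS.mul mAB).aemeasurable
    _ ≤ ∫⁻ u : E × E, eLpNorm (fun z => S z (u.2, -u.1)) p volume *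
          eLpNorm (fun z => A z * B (z - u)) P volume := by
        refine lintegral_mono fun u => ?_
        -- For fixed u the shift by u/2 is a translation in z and does not change the L^p norm. So
        -- the midpoint disappears from the estimate.
        have e : eLpNorm (fun z => S z (u.2, -u.1)) p volume =
            eLpNorm (fun z => S (z - (2⁻¹ : ℝ) • u) (u.2, -u.1)) p volume :=
          (eLpNorm_comp_measurePreserving (g := fun z => S z (u.2, -u.1))
            (hS2.comp measurable_prodMk_right).aestronglyMeasurable
            (measurePreserving_sub_right volume ((2⁻¹ : ℝ) • u))).symm
        rw [e]
        exact lintegral_mul_le_eLpNorm (mS.comp measurable_prodMk_right)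
          (mAB.comp measurable_prodMk_right)
    _ ≤ eLpNorm (fun u : E × E => eLpNorm (fun z => S z (u.2, -u.1)) p volume) q volume *
          eLpNorm (fun u : E × E => eLpNorm (fun z => A z * B (z - u)) P volume) Q volume :=
        lintegral_mul_le_eLpNorm ((measurable_eLpNorm_slice hS p).comp mJ)
          (measurable_eLpNorm_slice (F := fun z u => A z * B (z - u)) mAB P)
    _ ≤ _ := by
        rw [mul_assoc]
        gcongr
        · exact (eLpNorm_comp_measurePreserving (g := fun v => eLpNorm (fun z => S z v) p volume)
            (measurable_eLpNorm_slice hS p).aestronglyMeasurable measurePreserving_rotate).le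
        · exact eLpNorm_mul_comp_sub_le (ENNReal.HolderConjugate.one_le P p) hPQ ha₁ ha₂ hb₁ hb₂ h₁ h₂ hA hB

end WeylMod

namespace WeylMod

open Filter Topology
open scoped ContDiff BoundedContinuousFunction

/-! ### Integrals with values in the Schwartz space -/

section SchwartzIntegral

set_option maxSynthPendingDepth 3

variable {V : Type*} [NormedAddCommGroup V] [NormedSpace ℝ V]

/-- The weighted derivative `x ↦ ‖x‖ ^ k • D^n φ (x)` of a Schwartz function as a bounded continuous
function. -/
def weightedDeriv (k n : ℕ) :
    𝓢(V, ℂ) →L[ℂ] (V →ᵇ V [×n]→L[ℝ] ℂ) :=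
  SchwartzMap.mkCLMtoNormedSpace (σ := RingHom.id ℂ)
    (fun φ => BoundedContinuousFunction.ofNormedAddCommGroup
      (fun x => ‖x‖ ^ k • iteratedFDeriv ℝ n φ x)
      ((continuous_norm.pow k).smul ((φ.smooth n).continuous_iteratedFDeriv le_rfl))
      (SchwartzMap.seminorm ℂ k n φ) fun x => by
        rw [norm_smul, norm_pow, norm_norm]
        exact SchwartzMap.le_seminorm ℂ k n φ x)
    (fun φ ψ => by
      ext1 x
      have h : iteratedFDeriv ℝ n (⇑(φ + ψ)) x = iteratedFDeriv ℝ n φ x + iteratedFDeriv ℝ n ψ x :=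
        iteratedFDeriv_add_apply (φ.smooth n).contDiffAt (ψ.smooth n).contDiffAt
      change ‖x‖ ^ k • iteratedFDeriv ℝ n (⇑(φ + ψ)) x = _
      rw [h, smul_add]
      rfl)
    (fun c φ => by
      ext1 x
      have h : iteratedFDeriv ℝ n (⇑(c • φ)) x = c • iteratedFDeriv ℝ n φ x :=
        iteratedFDeriv_const_smul_apply (φ.smooth n).contDiffAt
      simp only [BoundedContinuousFunction.coe_ofNormedAddCommGroup, h, RingHom.id_apply,
        BoundedContinuousFunction.coe_smul]
      exact smul_comm _ _ _)
    ⟨{(k, n)}, 1, zero_le_one, fun φ => by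
      rw [one_mul, Finset.sup_singleton]
      exact BoundedContinuousFunction.norm_ofNormedAddCommGroup_le _ (apply_nonneg _ _) _⟩

theorem weightedDeriv_apply (k n : ℕ) (φ : 𝓢(V, ℂ)) (x : V) :
    weightedDeriv k n φ x = ‖x‖ ^ k • iteratedFDeriv ℝ n φ x := rfl

theorem norm_weightedDeriv_le (k n : ℕ) (φ : 𝓢(V, ℂ)) :
    ‖weightedDeriv k n φ‖ ≤ SchwartzMap.seminorm ℂ k n φ :=
  (BoundedContinuousFunction.norm_le (apply_nonneg _ _)).2 fun x => by
    rw [weightedDeriv_apply, norm_smul, norm_pow, norm_norm]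
    exact SchwartzMap.le_seminorm ℂ k n φ x

theorem seminorm_le_norm_weightedDeriv (k n : ℕ) (φ : 𝓢(V, ℂ)) :
    SchwartzMap.seminorm ℂ k n φ ≤ ‖weightedDeriv k n φ‖ := by
  refine SchwartzMap.seminorm_le_bound ℂ k n φ (norm_nonneg _) fun x => ?_
  have := (weightedDeriv k n φ).norm_coe_le_norm x
  rwa [weightedDeriv_apply, norm_smul, norm_pow, norm_norm] at this

variable {Z : Type*} [TopologicalSpace Z] [SecondCountableTopology Z] [MeasurableSpace Z]
  [OpensMeasurableSpace Z] {μ : Measure Z} {F : Z → ℂ} {Γ : Z → 𝓢(V, ℂ)}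

theorem integrable_smul_weightedDeriv (hF : AEStronglyMeasurable F μ) (hΓ : Continuous Γ)
    (hint : ∀ k n, Integrable (fun z => ‖F z‖ * SchwartzMap.seminorm ℂ k n (Γ z)) μ) (k n : ℕ) :
    Integrable (fun z => F z • weightedDeriv k n (Γ z)) μ := by
  refine (hint k n).mono'
    (hF.smul ((weightedDeriv k n).continuous.comp hΓ).aestronglyMeasurable) (.of_forall fun z => ?_)
  rw [norm_smul]
  gcongr
  exact norm_weightedDeriv_le k n _

theorem integrable_smul_iteratedFDeriv (hF : AEStronglyMeasurable F μ) (hΓ : Continuous Γ)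
    (hint : ∀ k n, Integrable (fun z => ‖F z‖ * SchwartzMap.seminorm ℂ k n (Γ z)) μ) (n : ℕ) (x : V) :
    Integrable (fun z => F z • iteratedFDeriv ℝ n (Γ z) x) μ := by
  have h := (BoundedContinuousFunction.evalCLM ℂ x :
    (V →ᵇ V [×n]→L[ℝ] ℂ) →L[ℂ] _).integrable_comp
    (integrable_smul_weightedDeriv hF hΓ hint 0 n)
  simpa [weightedDeriv_apply] using h

/-- Differentiation under the integral sign: the seminorm of order (0, n + 1) bounds the next
derivative uniformly in x, so it gives a dominating function. -/
theorem hasFDerivAt_integral_iteratedFDeriv (hF : AEStronglyMeasurable F μ) (hΓ : Continuous Γ)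
    (hint : ∀ k n, Integrable (fun z => ‖F z‖ * SchwartzMap.seminorm ℂ k n (Γ z)) μ) (n : ℕ) (x : V) :
    HasFDerivAt (fun x => ∫ z, F z • iteratedFDeriv ℝ n (Γ z) x ∂μ)
      (continuousMultilinearCurryLeftEquiv ℝ (fun _ : Fin (n + 1) => V) ℂ
        (∫ z, F z • iteratedFDeriv ℝ (n + 1) (Γ z) x ∂μ)) x := by
  set e := continuousMultilinearCurryLeftEquiv ℝ (fun _ : Fin (n + 1) => V) ℂ with he
  have h0 : e (∫ z, F z • iteratedFDeriv ℝ (n + 1) (Γ z) x ∂μ) =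
      ∫ z, e (F z • iteratedFDeriv ℝ (n + 1) (Γ z) x) ∂μ :=
    (e.toContinuousLinearEquiv.toContinuousLinearMap.integral_comp_comm
      (integrable_smul_iteratedFDeriv hF hΓ hint (n + 1) x)).symm
  rw [h0]
  refine hasFDerivAt_integral_of_dominated_of_fderiv_le (s := Set.univ)
    (F' := fun x z => e (F z • iteratedFDeriv ℝ (n + 1) (Γ z) x))
    (bound := fun z => ‖F z‖ * SchwartzMap.seminorm ℂ 0 (n + 1) (Γ z)) Filter.univ_mem
    (.of_forall fun y => (integrable_smul_iteratedFDeriv hF hΓ hint n y).aestronglyMeasurable)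
    (integrable_smul_iteratedFDeriv hF hΓ hint n x)
    (e.continuous.comp_aestronglyMeasurable
      (integrable_smul_iteratedFDeriv hF hΓ hint (n + 1) x).aestronglyMeasurable)
    (.of_forall fun z y _ => ?_) (hint 0 (n + 1)) (.of_forall fun z y _ => ?_)
  · rw [LinearIsometryEquiv.norm_map, norm_smul]
    gcongr
    simpa using SchwartzMap.norm_iteratedFDeriv_le_seminorm ℂ (Γ z) (n + 1) y
  · have h1 : HasFDerivAt (iteratedFDeriv ℝ n (Γ z)) (fderiv ℝ (iteratedFDeriv ℝ n (Γ z)) y) y :=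
      (((Γ z).smooth (n + 1 : ℕ)).differentiable_iteratedFDeriv
        (by exact_mod_cast Nat.lt_succ_self n) y).hasFDerivAt
    have h2 := h1.const_smul (F z)
    refine h2.congr_fderiv ?_
    rw [fderiv_iteratedFDeriv]
    rfl

/-- The integral of a continuous family of Schwartz functions exists in the Schwartz space, and it
commutes with continuous linear functionals. -/
theorem exists_schwartz_integral (hF : AEStronglyMeasurable F μ) (hΓ : Continuous Γ)
    (hint : ∀ k n, Integrable (fun z => ‖F z‖ * SchwartzMap.seminorm ℂ k n (Γ z)) μ) :
    ∃ u : 𝓢(V, ℂ), (∀ x, u x = ∫ z, F z * Γ z x ∂μ) ∧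
      ∀ f : 𝓢(V, ℂ) →L[ℂ] ℂ, f u = ∫ z, F z * f (Γ z) ∂μ := by
  set u : V → ℂ := fun x => ∫ z, F z * Γ z x ∂μ with hu
  have hD : ∀ n, iteratedFDeriv ℝ n u = fun x => ∫ z, F z • iteratedFDeriv ℝ n (Γ z) x ∂μ := by
    intro n
    induction n with
    | zero =>
      ext x m
      rw [ContinuousMultilinearMap.integral_apply (integrable_smul_iteratedFDeriv hF hΓ hint 0 x)]
      simp [hu]
    | succ n ih =>
      ext1 x
      rw [iteratedFDeriv_succ_eq_comp_left, ih]
      simp only [Function.comp_apply]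
      rw [(hasFDerivAt_integral_iteratedFDeriv hF hΓ hint n x).fderiv,
        LinearIsometryEquiv.symm_apply_apply]
  have hsmooth : ContDiff ℝ (⊤ : ℕ∞) u := by
    refine contDiff_of_differentiable_iteratedFDeriv fun n _ => ?_
    rw [hD]
    exact fun x => (hasFDerivAt_integral_iteratedFDeriv hF hΓ hint n x).differentiableAt
  set U : 𝓢(V, ℂ) := ⟨u, hsmooth, fun k n => by
    refine ⟨∫ z, ‖F z‖ * SchwartzMap.seminorm ℂ k n (Γ z) ∂μ, fun x => ?_⟩
    rw [hD]
    calc ‖x‖ ^ k * ‖∫ z, F z • iteratedFDeriv ℝ n (Γ z) x ∂μ‖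
        ≤ ‖x‖ ^ k * ∫ z, ‖F z • iteratedFDeriv ℝ n (Γ z) x‖ ∂μ := by
          gcongr; exact norm_integral_le_integral_norm _
      _ = ∫ z, ‖x‖ ^ k * ‖F z • iteratedFDeriv ℝ n (Γ z) x‖ ∂μ := (integral_const_mul _ _).symm
      _ ≤ _ := by
          refine integral_mono ((integrable_smul_iteratedFDeriv hF hΓ hint n x).norm.const_mul _)
            (hint k n) fun z => ?_
          simp only [norm_smul]
          calc _ = ‖F z‖ * (‖x‖ ^ k * ‖iteratedFDeriv ℝ n (Γ z) x‖) := by ring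
            _ ≤ _ := by gcongr; exact SchwartzMap.le_seminorm ℂ k n _ x⟩ with hU
  have hUu : ⇑U = u := rfl
  refine ⟨U, fun x => rfl, fun f => ?_⟩
  obtain ⟨s, C, -, hs⟩ := Seminorm.bound_of_continuous (schwartz_withSeminorms ℂ V ℂ)
    ((normSeminorm ℂ ℂ).comp f.toLinearMap) (continuous_norm.comp f.continuous)
  -- A continuous functional is controlled by finitely many seminorms, hence by the norm of the
  -- image under a map J into a finite product of normed spaces of bounded continuous functions. The
  -- index (0, 0) is added to make J injective.
  set s' := insert (0, 0) s with hs'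
  set J : 𝓢(V, ℂ) →L[ℂ] ((i : s') → (V →ᵇ V [×i.1.2]→L[ℝ] ℂ)) :=
    ContinuousLinearMap.pi fun i => weightedDeriv i.1.1 i.1.2 with hJ
  have hsem : ∀ i : s', ∀ φ, SchwartzMap.seminorm ℂ i.1.1 i.1.2 φ ≤ ‖J φ‖ := fun i φ =>
    (seminorm_le_norm_weightedDeriv _ _ φ).trans (norm_le_pi_norm (J φ) i)
  have hinj : Function.Injective J.toLinearMap := by
    rw [← LinearMap.ker_eq_bot, LinearMap.ker_eq_bot']
    intro φ hφ
    have h1 := hsem ⟨(0, 0), Finset.mem_insert_self _ _⟩ φ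
    have h2 : J φ = 0 := hφ
    rw [h2, norm_zero] at h1
    ext x
    have h3 := (SchwartzMap.norm_le_seminorm ℂ φ x).trans h1
    simpa using h3
  have hbound : ∀ φ, ‖f φ‖ ≤ C * ‖J φ‖ := by
    intro φ
    refine (hs φ).trans ?_
    rw [smul_apply, NNReal.smul_def, smul_eq_mul]
    gcongr
    refine Seminorm.finset_sup_apply_le (norm_nonneg _) fun i hi => ?_
    exact hsem ⟨i, Finset.mem_insert_of_mem hi⟩ φ
  set e := LinearEquiv.ofInjective J.toLinearMap hinj with he
  set f' : StrongDual ℂ (LinearMap.range J.toLinearMap) :=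
    (f.toLinearMap ∘ₗ e.symm.toLinearMap).mkContinuous C (fun y => by
      obtain ⟨φ, rfl⟩ := e.surjective y
      simp only [LinearMap.comp_apply, LinearEquiv.coe_coe, LinearEquiv.symm_apply_apply]
      exact hbound φ) with hf'
  -- Hahn–Banach extends f ∘ J⁻¹ from the range of J to the whole normed space, where the Bochner
  -- integral commutes with it. This avoids integration in the Schwartz space, which is not normed.
  obtain ⟨ℓ, hℓ, -⟩ := exists_extension_norm_eq (LinearMap.range J.toLinearMap) f'
  have hℓJ : ∀ φ, ℓ (J φ) = f φ := by
    intro φ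
    have h1 := hℓ (e φ)
    have h2 : f' (e φ) = f φ := by
      simp [hf']
    rw [h2] at h1
    exact h1
  have hJint : Integrable (fun z => F z • J (Γ z)) μ := by
    refine Integrable.of_eval fun i => ?_
    exact integrable_smul_weightedDeriv hF hΓ hint i.1.1 i.1.2
  have hJU : J U = ∫ z, F z • J (Γ z) ∂μ := by
    ext1 i
    have h0 := (ContinuousLinearMap.proj (R := ℂ) (φ := fun i : s' => (V →ᵇ V [×i.1.2]→L[ℝ] ℂ))
      i).integral_comp_comm hJint
    simp only [ContinuousLinearMap.proj_apply] at h0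
    rw [← h0]
    ext1 x
    have h1 := (BoundedContinuousFunction.evalCLM ℂ x : (V →ᵇ V [×i.1.2]→L[ℝ] ℂ) →L[ℂ] _).integral_comp_comm
      (integrable_smul_weightedDeriv hF hΓ hint i.1.1 i.1.2)
    simp only [BoundedContinuousFunction.evalCLM_apply] at h1
    change weightedDeriv i.1.1 i.1.2 U x = (∫ z, F z • weightedDeriv i.1.1 i.1.2 (Γ z) ∂μ) x
    rw [← h1, weightedDeriv_apply, hUu, hD, ← integral_smul]
    refine integral_congr_ae (.of_forall fun z => ?_)
    simp only [BoundedContinuousFunction.coe_smul, weightedDeriv_apply]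
    exact smul_comm _ _ _
  rw [← hℓJ, hJU, ← ℓ.integral_comp_comm hJint]
  refine integral_congr_ae (.of_forall fun z => ?_)
  simp [hℓJ]

end SchwartzIntegral

end WeylMod

namespace WeylMod

open Filter Topology
open scoped ContDiff BoundedContinuousFunction

variable {E : Type*} [NormedAddCommGroup E] [InnerProductSpace ℝ E] [FiniteDimensional ℝ E]
  [MeasurableSpace E] [BorelSpace E]

/-! ### Continuity of time-frequency shifts -/

section Translation

variable {V : Type*} [NormedAddCommGroup V] [NormedSpace ℝ V]

theorem iteratedFDeriv_compSubConstCLM (x : V) (h : 𝓢(V, ℂ)) (n : ℕ) (t : V) :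
    iteratedFDeriv ℝ n (compSubConstCLM ℂ x h) t = iteratedFDeriv ℝ n h (t - x) := by
  have : ⇑(compSubConstCLM ℂ x h) = fun t => h (t - x) := by ext; simp
  rw [this, iteratedFDeriv_comp_sub]

theorem one_add_pow_mul_le (h : 𝓢(V, ℂ)) (k n : ℕ) (t : V) :
    (1 + ‖t‖) ^ k * ‖iteratedFDeriv ℝ n h t‖ ≤
      2 ^ k * (Finset.Iic (k, n)).sup (schwartzSeminormFamily ℂ V ℂ) h :=
  SchwartzMap.one_add_le_sup_seminorm_apply (𝕜 := ℂ) (m := (k, n)) le_rfl le_rfl h t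

theorem seminorm_compSubConstCLM_le (x : V) (h : 𝓢(V, ℂ)) (k n : ℕ) :
    SchwartzMap.seminorm ℂ k n (compSubConstCLM ℂ x h) ≤
      (1 + ‖x‖) ^ k * (2 ^ k * (Finset.Iic (k, n)).sup (schwartzSeminormFamily ℂ V ℂ) h) := by
  refine SchwartzMap.seminorm_le_bound ℂ k n _ (by positivity) fun t => ?_
  rw [iteratedFDeriv_compSubConstCLM]
  have ht : ‖t‖ ≤ (1 + ‖x‖) * (1 + ‖t - x‖) := by
    have h1 : ‖t‖ ≤ ‖t - x‖ + ‖x‖ := by simpa using norm_add_le (t - x) x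
    nlinarith [norm_nonneg x, norm_nonneg (t - x), mul_nonneg (norm_nonneg x) (norm_nonneg (t - x))]
  calc ‖t‖ ^ k * ‖iteratedFDeriv ℝ n h (t - x)‖
      ≤ ((1 + ‖x‖) * (1 + ‖t - x‖)) ^ k * ‖iteratedFDeriv ℝ n h (t - x)‖ := by gcongr
    _ = (1 + ‖x‖) ^ k * ((1 + ‖t - x‖) ^ k * ‖iteratedFDeriv ℝ n h (t - x)‖) := by
        rw [mul_pow]; ring
    _ ≤ _ := mul_le_mul_of_nonneg_left (one_add_pow_mul_le h k n _) (by positivity)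

theorem sup_seminorm_compSubConstCLM_le (s : Finset (ℕ × ℕ)) :
    ∃ (s' : Finset (ℕ × ℕ)) (N : ℕ), ∀ (x : V) (h : 𝓢(V, ℂ)),
      s.sup (schwartzSeminormFamily ℂ V ℂ) (compSubConstCLM ℂ x h) ≤
        (1 + ‖x‖) ^ N * (2 ^ N * s'.sup (schwartzSeminormFamily ℂ V ℂ) h) := by
  refine ⟨s.biUnion fun i => Finset.Iic i, s.sup Prod.fst, fun x h => ?_⟩
  refine Seminorm.finset_sup_apply_le (by positivity) fun i hi => ?_
  refine (seminorm_compSubConstCLM_le x h i.1 i.2).trans ?_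
  have h1 : i.1 ≤ s.sup Prod.fst := Finset.le_sup (f := Prod.fst) hi
  have h2 : (Finset.Iic (i.1, i.2)).sup (schwartzSeminormFamily ℂ V ℂ) h ≤
      (s.biUnion fun i => Finset.Iic i).sup (schwartzSeminormFamily ℂ V ℂ) h :=
    Seminorm.le_def.mp (Finset.sup_mono (Finset.subset_biUnion_of_mem (fun i => Finset.Iic i) hi)) h
  gcongr
  · linarith [norm_nonneg x]
  · norm_num

/-- The mean value inequality on the segment from t - x₀ to t - x. It has length at most 1, so 1 +
‖y‖ for y on it controls ‖t‖ up to a constant that depends on x₀, and the decay of the next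
derivative absorbs the weight ‖t‖ ^ k. -/
theorem seminorm_compSubConstCLM_sub_le (x₀ : V) (h : 𝓢(V, ℂ)) (k n : ℕ) :
    ∃ C : ℝ, ∀ x, ‖x - x₀‖ ≤ 1 → SchwartzMap.seminorm ℂ k n
      (compSubConstCLM ℂ x h - compSubConstCLM ℂ x₀ h) ≤ C * ‖x - x₀‖ := by
  set B := 2 ^ k * (Finset.Iic (k, n + 1)).sup (schwartzSeminormFamily ℂ V ℂ) h with hB
  have hB0 : 0 ≤ B := by positivity
  refine ⟨(2 + ‖x₀‖) ^ k * B, fun x hx => ?_⟩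
  refine SchwartzMap.seminorm_le_bound ℂ k n _ (by positivity) fun t => ?_
  have e : iteratedFDeriv ℝ n (⇑(compSubConstCLM ℂ x h - compSubConstCLM ℂ x₀ h)) t =
      iteratedFDeriv ℝ n h (t - x) - iteratedFDeriv ℝ n h (t - x₀) := by
    rw [← iteratedFDeriv_compSubConstCLM, ← iteratedFDeriv_compSubConstCLM]
    exact iteratedFDeriv_sub_apply (SchwartzMap.smooth _ n).contDiffAt
      (SchwartzMap.smooth _ n).contDiffAt
  rw [e]
  have key : ∀ y ∈ segment ℝ (t - x₀) (t - x),
      ‖fderiv ℝ (iteratedFDeriv ℝ n h) y‖ * ‖t‖ ^ k ≤ (2 + ‖x₀‖) ^ k * B := by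
    intro y hy
    have hy' : ‖y - (t - x₀)‖ ≤ 1 := by
      have := norm_sub_le_of_mem_segment hy
      rw [sub_sub_sub_cancel_left, norm_sub_rev x₀ x] at this
      exact this.trans hx
    have ht : ‖t‖ ≤ (2 + ‖x₀‖) * (1 + ‖y‖) := by
      have h1 : ‖t‖ ≤ ‖y‖ + ‖y - (t - x₀)‖ + ‖x₀‖ := by
        calc ‖t‖ = ‖y - (y - (t - x₀)) + x₀‖ := by congr 1; abel
          _ ≤ _ := (norm_add_le _ _).trans (by gcongr; exact norm_sub_le _ _)
      nlinarith [norm_nonneg x₀, norm_nonneg y, mul_nonneg (norm_nonneg x₀) (norm_nonneg y)]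
    rw [norm_fderiv_iteratedFDeriv]
    calc _ ≤ ‖iteratedFDeriv ℝ (n + 1) h y‖ * ((2 + ‖x₀‖) * (1 + ‖y‖)) ^ k := by gcongr
      _ = (2 + ‖x₀‖) ^ k * ((1 + ‖y‖) ^ k * ‖iteratedFDeriv ℝ (n + 1) h y‖) := by
        rw [mul_pow]; ring
      _ ≤ _ := mul_le_mul_of_nonneg_left (one_add_pow_mul_le h k (n + 1) y) (by positivity)
  rcases eq_or_ne (‖t‖ ^ k) 0 with h0 | h0
  · rw [h0, zero_mul]; positivity
  have h0' : 0 < ‖t‖ ^ k := lt_of_le_of_ne (by positivity) (Ne.symm h0)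
  have hmv := (convex_segment (t - x₀) (t - x)).norm_image_sub_le_of_norm_fderiv_le (𝕜 := ℝ)
    (f := iteratedFDeriv ℝ n h) (C := (2 + ‖x₀‖) ^ k * B / ‖t‖ ^ k)
    (fun y _ => (h.smooth (n + 1 : ℕ)).differentiable_iteratedFDeriv
        (by exact_mod_cast Nat.lt_succ_self n) y)
    (fun y hy => by rw [le_div_iff₀ h0']; exact key y hy)
    (left_mem_segment ℝ _ _) (right_mem_segment ℝ _ _)
  calc ‖t‖ ^ k * ‖iteratedFDeriv ℝ n h (t - x) - iteratedFDeriv ℝ n h (t - x₀)‖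
      ≤ ‖t‖ ^ k * ((2 + ‖x₀‖) ^ k * B / ‖t‖ ^ k * ‖t - x - (t - x₀)‖) := by gcongr
    _ = _ := by
      rw [sub_sub_sub_cancel_left, norm_sub_rev x₀ x]
      field_simp

/-- Joint continuity is needed because a time-frequency shift contains a translation of a function
that itself varies. -/
theorem continuous_compSubConstCLM :
    Continuous fun p : V × 𝓢(V, ℂ) => compSubConstCLM ℂ p.1 p.2 := by
  rw [continuous_iff_continuousAt]
  rintro ⟨x₀, h₀⟩
  unfold ContinuousAt
  rw [(schwartz_withSeminorms ℂ V ℂ).tendsto_nhds]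
  rintro ⟨k, n⟩ ε hε
  obtain ⟨C, hC⟩ := seminorm_compSubConstCLM_sub_le x₀ h₀ k n
  set q := (Finset.Iic (k, n)).sup (schwartzSeminormFamily ℂ V ℂ) with hq
  have hqc : Continuous q := by
    have h1 := (schwartz_withSeminorms ℂ V ℂ).continuous_seminorm
    have h2 : ∀ s : Finset (ℕ × ℕ),
        Continuous (s.sup (schwartzSeminormFamily ℂ V ℂ) : Seminorm ℂ 𝓢(V, ℂ)) := by
      intro s
      induction s using Finset.cons_induction with
      | empty => rw [Finset.sup_empty]; exact continuous_zero
      | cons a s ha ih => rw [Finset.sup_cons]; exact (h1 a).sup ih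
    exact h2 _
  have hcont : Continuous fun p : V × 𝓢(V, ℂ) =>
      (1 + ‖p.1‖) ^ k * (2 ^ k * q (p.2 - h₀)) + C * ‖p.1 - x₀‖ := by fun_prop
  have hlim := hcont.tendsto (x₀, h₀)
  simp only [sub_self, map_zero, mul_zero, norm_zero, add_zero] at hlim
  have hball : ∀ᶠ p : V × 𝓢(V, ℂ) in 𝓝 (x₀, h₀), ‖p.1 - x₀‖ ≤ 1 := by
    have h3 : Continuous fun p : V × 𝓢(V, ℂ) => ‖p.1 - x₀‖ := by fun_prop
    have h4 := h3.tendsto (x₀, h₀)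
    simp only [sub_self, norm_zero] at h4
    exact h4.eventually_le_const one_pos
  filter_upwards [hlim.eventually_lt_const hε, hball] with p hp hp1
  refine lt_of_le_of_lt ?_ hp
  have e : compSubConstCLM ℂ p.1 p.2 - compSubConstCLM ℂ x₀ h₀ =
      compSubConstCLM ℂ p.1 (p.2 - h₀) + (compSubConstCLM ℂ p.1 h₀ - compSubConstCLM ℂ x₀ h₀) := by
    rw [map_sub]; abel
  simp only [e]
  refine (map_add_le_add _ _ _).trans ?_
  gcongr
  · exact seminorm_compSubConstCLM_le p.1 _ k n
  · exact hC p.1 hp1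

end Translation

theorem exp_eq_fourierChar (ξ t : E) :
    cexp (2 * Real.pi * I * (⟪ξ, t⟫_ℝ : ℝ)) = Real.fourierChar ⟪ξ, t⟫_ℝ := by
  rw [Real.fourierChar_apply]
  congr 1
  push_cast
  ring

/-- Modulation is translation on the Fourier side. Continuity and polynomial growth of
time-frequency shifts thereby reduce to the same facts for translations and to the continuity of the
Fourier transform. -/
theorem tfShift_eq (x ξ : E) (g : 𝓢(E, ℂ)) :
    tfShift x ξ g = 𝓕⁻ (compSubConstCLM ℂ ξ (𝓕 (compSubConstCLM ℂ x g))) := by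
  have h : 𝓕 (tfShift x ξ g) = compSubConstCLM ℂ ξ (𝓕 (compSubConstCLM ℂ x g)) := by
    ext η
    rw [compSubConstCLM_apply, SchwartzMap.fourier_coe, SchwartzMap.fourier_coe, Real.fourier_eq,
      Real.fourier_eq]
    refine integral_congr_ae (.of_forall fun t => ?_)
    simp only [tfShift_apply, compSubConstCLM_apply, Circle.smul_def, smul_eq_mul,
      exp_eq_fourierChar]
    rw [← mul_assoc, ← Circle.coe_mul, ← AddChar.map_add_eq_mul]
    congr 3
    rw [inner_sub_right, real_inner_comm t ξ]
    ring
  rw [← h, FourierTransform.fourierInv_fourier_eq]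

theorem continuous_tfShift (g : 𝓢(E, ℂ)) : Continuous fun z : E × E => tfShift z.1 z.2 g := by
  simp_rw [tfShift_eq]
  refine (FourierTransform.fourierCLE ℂ 𝓢(E, ℂ)).symm.continuous.comp ?_
  refine continuous_compSubConstCLM.comp (continuous_snd.prodMk ?_)
  refine (FourierTransform.fourierCLE ℂ 𝓢(E, ℂ)).continuous.comp ?_
  exact continuous_compSubConstCLM.comp (continuous_fst.prodMk continuous_const)

theorem exists_seminorm_bound (A : 𝓢(E, ℂ) →L[ℂ] 𝓢(E, ℂ)) (s : Finset (ℕ × ℕ)) :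
    ∃ (s' : Finset (ℕ × ℕ)) (C : ℝ≥0), ∀ h, s.sup (schwartzSeminormFamily ℂ E ℂ) (A h) ≤
      C * s'.sup (schwartzSeminormFamily ℂ E ℂ) h := by
  have h2 : ∀ s : Finset (ℕ × ℕ),
      Continuous (s.sup (schwartzSeminormFamily ℂ E ℂ) : Seminorm ℂ 𝓢(E, ℂ)) := by
    intro s
    induction s using Finset.cons_induction with
    | empty => rw [Finset.sup_empty]; exact continuous_zero
    | cons a s ha ih =>
      rw [Finset.sup_cons]
      exact ((schwartz_withSeminorms ℂ E ℂ).continuous_seminorm a).sup ih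
  obtain ⟨s', C, -, h⟩ := Seminorm.bound_of_continuous (schwartz_withSeminorms ℂ E ℂ)
    ((s.sup (schwartzSeminormFamily ℂ E ℂ)).comp A.toLinearMap) ((h2 s).comp A.continuous)
  exact ⟨s', C, fun φ => h φ⟩

theorem seminorm_tfShift_le (g : 𝓢(E, ℂ)) (k n : ℕ) :
    ∃ (C : ℝ) (N : ℕ), 0 ≤ C ∧ ∀ z : E × E,
      SchwartzMap.seminorm ℂ k n (tfShift z.1 z.2 g) ≤ C * (1 + ‖z‖) ^ N := by
  obtain ⟨s₁, C₁, h₁⟩ := exists_seminorm_bound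
    ((FourierTransform.fourierCLE ℂ 𝓢(E, ℂ)).symm : 𝓢(E, ℂ) →L[ℂ] 𝓢(E, ℂ)) {(k, n)}
  obtain ⟨s₂, N₂, h₂⟩ := sup_seminorm_compSubConstCLM_le (V := E) s₁
  obtain ⟨s₃, C₃, h₃⟩ := exists_seminorm_bound
    ((FourierTransform.fourierCLE ℂ 𝓢(E, ℂ)) : 𝓢(E, ℂ) →L[ℂ] 𝓢(E, ℂ)) s₂
  obtain ⟨s₄, N₄, h₄⟩ := sup_seminorm_compSubConstCLM_le (V := E) s₃
  refine ⟨C₁ * (2 ^ N₂ * (C₃ * (2 ^ N₄ * s₄.sup (schwartzSeminormFamily ℂ E ℂ) g))), N₂ + N₄,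
    by positivity, fun z => ?_⟩
  have e := h₁ (compSubConstCLM ℂ z.2 (𝓕 (compSubConstCLM ℂ z.1 g)))
  rw [Finset.sup_singleton] at e
  rw [tfShift_eq]
  have hz1 : ‖z.1‖ ≤ ‖z‖ := norm_fst_le z
  have hz2 : ‖z.2‖ ≤ ‖z‖ := norm_snd_le z
  calc _ ≤ C₁ * s₁.sup (schwartzSeminormFamily ℂ E ℂ)
        (compSubConstCLM ℂ z.2 (𝓕 (compSubConstCLM ℂ z.1 g))) := e
    _ ≤ C₁ * ((1 + ‖z‖) ^ N₂ * (2 ^ N₂ * (C₃ * ((1 + ‖z‖) ^ N₄ *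
        (2 ^ N₄ * s₄.sup (schwartzSeminormFamily ℂ E ℂ) g))))) := by
      gcongr
      refine (h₂ z.2 _).trans ?_
      gcongr
      refine (h₃ _).trans ?_
      gcongr
      refine (h₄ z.1 g).trans ?_
      gcongr
    _ = C₁ * (2 ^ N₂ * (C₃ * (2 ^ N₄ * s₄.sup (schwartzSeminormFamily ℂ E ℂ) g))) *
        (1 + ‖z‖) ^ (N₂ + N₄) := by rw [pow_add]; ring

end WeylMod

namespace WeylMod

open Filter Topology
open scoped ContDiff BoundedContinuousFunction

variable {E : Type*} [NormedAddCommGroup E] [InnerProductSpace ℝ E] [FiniteDimensional ℝ E]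
  [MeasurableSpace E] [BorelSpace E]

/-! ### The short-time Fourier transform -/

theorem conjS_conjS {G : Type*} [NormedAddCommGroup G] [NormedSpace ℝ G] (f : 𝓢(G, ℂ)) :
    conjS (conjS f) = f := by
  ext; simp

theorem integrable_norm_mul_one_add_pow {V : Type*} [NormedAddCommGroup V] [NormedSpace ℝ V]
    [MeasurableSpace V] [BorelSpace V] [SecondCountableTopology V] (μ : Measure V)
    [μ.HasTemperateGrowth] (F : 𝓢(V, ℂ)) (N : ℕ) :
    Integrable (fun z => ‖F z‖ * (1 + ‖z‖) ^ N) μ := by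
  have h1 : Integrable (fun z => 2 ^ (N - 1) * (‖z‖ ^ 0 * ‖F z‖ + ‖z‖ ^ N * ‖F z‖)) μ :=
    ((F.integrable_pow_mul μ 0).add (F.integrable_pow_mul μ N)).const_mul _
  refine h1.mono' ?_ (.of_forall fun z => ?_)
  · exact (F.continuous.norm.mul (by fun_prop)).aestronglyMeasurable
  · rw [Real.norm_of_nonneg (by positivity)]
    have := add_pow_le zero_le_one (norm_nonneg z) N
    rw [one_pow] at this
    calc _ ≤ ‖F z‖ * (2 ^ (N - 1) * (1 + ‖z‖ ^ N)) := by gcongr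
      _ = _ := by ring

/-- The squared `L²` norm of a window. -/
def energy (g : 𝓢(E, ℂ)) : ℝ := ∫ t, ‖g t‖ ^ 2

theorem integrable_norm_sq (g : 𝓢(E, ℂ)) : Integrable fun t => ‖g t‖ ^ 2 :=
  (memLp_two_iff_integrable_sq_norm g.continuous.aestronglyMeasurable).1 (g.memLp 2 volume)

theorem energy_pos {g : 𝓢(E, ℂ)} (hg : g ≠ 0) : 0 < energy g := by
  obtain ⟨t, ht⟩ : ∃ t, g t ≠ 0 := by
    by_contra! h
    exact hg (SchwartzMap.ext h)
  rw [energy, integral_pos_iff_support_of_nonneg (fun t => by positivity) (integrable_norm_sq g)]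
  have hc : Continuous fun t => ‖g t‖ ^ 2 := g.continuous.norm.pow 2
  exact hc.isOpen_support.measure_pos _ ⟨t, by simpa using ht⟩

theorem integral_normSq_comp_sub (g : 𝓢(E, ℂ)) (t : E) :
    ∫ x, conj (g (t - x)) * g (t - x) = (energy g : ℂ) := by
  rw [integral_sub_left_eq_self (fun x => conj (g x) * g x), energy, ← integral_complex_ofReal]
  refine integral_congr_ae (.of_forall fun x => ?_)
  simp [← Complex.normSq_eq_conj_mul_self, Complex.normSq_eq_norm_sq]

/-- The change of coordinates `(x, t) ↦ (t, t - x)`. -/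
def shearCoord : (E × E) ≃L[ℝ] (E × E) :=
  ContinuousLinearEquiv.equivOfInverse
    ((ContinuousLinearMap.snd ℝ E E).prod
      (ContinuousLinearMap.snd ℝ E E - ContinuousLinearMap.fst ℝ E E))
    ((ContinuousLinearMap.fst ℝ E E - ContinuousLinearMap.snd ℝ E E).prod
      (ContinuousLinearMap.fst ℝ E E))
    (fun z => by ext <;> simp) (fun z => by ext <;> simp)

/-- The short-time Fourier transform of Schwartz functions. -/
def stftS (g : 𝓢(E, ℂ)) : 𝓢(E, ℂ) →L[ℂ] 𝓢(E × E, ℂ) :=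
  partialFourier ∘L SchwartzMap.compCLMOfContinuousLinearEquiv ℂ shearCoord ∘L tensor (conjS g)

theorem stftS_eq_fourier (g φ : 𝓢(E, ℂ)) (z : E × E) :
    stftS g φ z = 𝓕 (slice (SchwartzMap.compCLMOfContinuousLinearEquiv ℂ
      shearCoord (tensor (conjS g) φ)) z.1) z.2 := rfl

theorem slice_shearCoord (g φ : 𝓢(E, ℂ)) (x t : E) :
    slice (SchwartzMap.compCLMOfContinuousLinearEquiv ℂ shearCoord (tensor (conjS g) φ)) x t =
      φ t * conj (g (t - x)) := rfl

theorem stftS_apply (g φ : 𝓢(E, ℂ)) (z : E × E) :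
    stftS g φ z = ∫ t, φ t * conj (tfShift z.1 z.2 g t) := by
  rw [stftS_eq_fourier, SchwartzMap.fourier_coe, Real.fourier_eq]
  refine integral_congr_ae (.of_forall fun t => ?_)
  simp only [slice_shearCoord, tfShift_apply, Circle.smul_def, smul_eq_mul, exp_eq_fourierChar,
    map_mul]
  rw [real_inner_comm, AddChar.map_neg_eq_inv, Circle.coe_inv_eq_conj]
  ring

theorem stft_toDistribution (g φ : 𝓢(E, ℂ)) (x ξ : E) :
    stft g (toDistribution φ) x ξ = stftS g φ (x, ξ) := by
  rw [stftS_apply]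
  refine (SchwartzMap.toTemperedDistributionCLM_apply_apply volume φ _).trans ?_
  refine integral_congr_ae (.of_forall fun t => ?_)
  simp [mul_comm]

theorem norm_tfShift_apply (x ξ : E) (g : 𝓢(E, ℂ)) (t : E) :
    ‖tfShift x ξ g t‖ = ‖g (t - x)‖ := by
  rw [tfShift_apply, norm_mul, exp_eq_fourierChar, Circle.norm_coe, one_mul]

/-- The inversion formula of the short-time Fourier transform on Schwartz functions. -/
theorem integral_stftS_mul_tfShift (g φ : 𝓢(E, ℂ)) (t : E) :
    ∫ z, stftS g φ z * tfShift z.1 z.2 g t = energy g * φ t := by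
  obtain ⟨C, hC⟩ : ∃ C, ∀ t, ‖g t‖ ≤ C := ⟨_, fun t => g.norm_le_seminorm ℂ t⟩
  have hcont : Continuous fun z : E × E => tfShift z.1 z.2 g t := by
    simp_rw [tfShift_apply]
    have := g.continuous
    fun_prop
  have hint : Integrable (fun z : E × E => stftS g φ z * tfShift z.1 z.2 g t)
      ((volume : Measure E).prod volume) := by
    refine (SchwartzMap.integrable (μ := volume) (stftS g φ)).mul_bdd (c := C)
      hcont.aestronglyMeasurable (.of_forall fun z => ?_)
    rw [norm_tfShift_apply]
    exact hC _
  rw [Measure.volume_eq_prod, integral_prod _ hint]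
  have h1 : ∀ x, ∫ ξ, stftS g φ (x, ξ) * tfShift x ξ g t =
      φ t * (conj (g (t - x)) * g (t - x)) := by
    intro x
    set H := slice (SchwartzMap.compCLMOfContinuousLinearEquiv ℂ shearCoord
      (tensor (conjS g) φ)) x with hH
    -- For fixed x, the transform in ξ is the Fourier transform of the slice t ↦ φ(t) conj g(t - x).
    -- Fourier inversion gives the slice back, and the integral in x of |g(t - x)|² is the energy.
    have h2 : 𝓕⁻ (𝓕 H) t = H t := by rw [FourierTransform.fourierInv_fourier_eq]
    rw [SchwartzMap.fourierInv_coe, Real.fourierInv_eq] at h2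
    have h3 : ∀ ξ, stftS g φ (x, ξ) * tfShift x ξ g t =
        (Real.fourierChar ⟪ξ, t⟫_ℝ • 𝓕 H ξ) * g (t - x) := by
      intro ξ
      rw [stftS_eq_fourier, tfShift_apply, exp_eq_fourierChar, Circle.smul_def, smul_eq_mul]
      ring
    simp_rw [h3]
    rw [integral_mul_const, h2, hH, slice_shearCoord]
    ring
  simp only [h1]
  rw [integral_const_mul, integral_normSq_comp_sub]
  ring

theorem integrable_norm_mul_seminorm_tfShift (F : 𝓢(E × E, ℂ)) (g : 𝓢(E, ℂ)) (k n : ℕ) :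
    Integrable fun z : E × E => ‖F z‖ * SchwartzMap.seminorm ℂ k n (tfShift z.1 z.2 g) := by
  obtain ⟨C, N, hC, h⟩ := seminorm_tfShift_le g k n
  refine ((integrable_norm_mul_one_add_pow volume F N).const_mul C).mono' ?_ (.of_forall fun z => ?_)
  · have h1 := ((schwartz_withSeminorms ℂ E ℂ).continuous_seminorm (k, n)).comp
      (continuous_tfShift g)
    exact (F.continuous.norm.mul h1).aestronglyMeasurable
  · rw [Real.norm_of_nonneg (mul_nonneg (norm_nonneg _) (apply_nonneg _ _))]
    calc _ ≤ ‖F z‖ * (C * (1 + ‖z‖) ^ N) := by gcongr; exact h z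
      _ = _ := by ring

/-- The inversion formula holds as an integral with values in the Schwartz space, so every
continuous functional passes under it; pointwise inversion identifies that integral. -/
theorem integral_stftS_mul (g φ : 𝓢(E, ℂ)) (L : 𝓢(E, ℂ) →L[ℂ] ℂ) :
    ∫ z : E × E, stftS g φ z * L (tfShift z.1 z.2 g) = energy g * L φ := by
  obtain ⟨u, hu, hL⟩ := exists_schwartz_integral (μ := (volume : Measure (E × E)))
    (F := stftS g φ) (stftS g φ).continuous.aestronglyMeasurable (continuous_tfShift g)
    (integrable_norm_mul_seminorm_tfShift (stftS g φ) g)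
  have h : u = (energy g : ℂ) • φ := by
    ext t
    rw [hu, integral_stftS_mul_tfShift]
    rfl
  rw [← hL, h, map_smul, smul_eq_mul]

/-- A tempered distribution `f` as the continuous linear functional `φ ↦ conj (f (conj φ))`. -/
def conjFunctional (f : 𝓢'(E, ℂ)) : 𝓢(E, ℂ) →L[ℂ] ℂ where
  toFun φ := conj (f (conjS φ))
  map_add' φ ψ := by simp
  map_smul' c φ := by simp [conjS_smul]
  cont := continuous_conj.comp (f.continuous.comp conjS.continuous)

theorem conjFunctional_tfShift (f : 𝓢'(E, ℂ)) (g : 𝓢(E, ℂ)) (x ξ : E) :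
    conjFunctional f (tfShift x ξ g) = conj (stft g f x ξ) := rfl

/-- The inversion formula of the short-time Fourier transform on tempered distributions. -/
theorem integral_stft_mul (g φ : 𝓢(E, ℂ)) (f : 𝓢'(E, ℂ)) :
    ∫ z : E × E, stft g f z.1 z.2 * conj (stftS g φ z) = energy g * f (conjS φ) := by
  have h := congrArg conj (integral_stftS_mul g φ (conjFunctional f))
  rw [← integral_conj] at h
  simp only [conjFunctional_tfShift, map_mul, conj_conj, conj_ofReal] at h
  rw [show conjFunctional f φ = conj (f (conjS φ)) from rfl, conj_conj] at h
  rw [← h]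
  exact integral_congr_ae (.of_forall fun z => mul_comm _ _)

theorem continuous_stft (g : 𝓢(E, ℂ)) (f : 𝓢'(E, ℂ)) :
    Continuous fun z : E × E => stft g f z.1 z.2 :=
  f.continuous.comp (conjS.continuous.comp (continuous_tfShift g))

/-- Immediate from inversion, since the energy of a non-zero window does not vanish. It turns norm
estimates into equality of distributions. -/
theorem eq_zero_of_stft_eq_zero {g : 𝓢(E, ℂ)} (hg : g ≠ 0) {f : 𝓢'(E, ℂ)}
    (h : ∀ x ξ, stft g f x ξ = 0) : f = 0 := by
  ext φ
  have h1 := integral_stft_mul g (conjS φ) f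
  simp only [h, zero_mul, integral_zero, conjS_conjS] at h1
  have h2 : (energy g : ℂ) ≠ 0 := by exact_mod_cast (energy_pos hg).ne'
  simpa [h2] using h1.symm

/-- Substituting t + z'.1 for t merges the two shifts into one, up to a phase independent of t. This
makes the change of window a convolution. -/
theorem norm_stftS_tfShift (g γ : 𝓢(E, ℂ)) (z' z : E × E) :
    ‖stftS g (tfShift z'.1 z'.2 γ) z‖ = ‖stftS g γ (z - z')‖ := by
  have h : stftS g (tfShift z'.1 z'.2 γ) z =
      (Real.fourierChar ⟪z'.2 - z.2, z'.1⟫_ℝ : ℂ) * stftS g γ (z - z') := by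
    rw [stftS_apply, stftS_apply, ← integral_const_mul,
      ← integral_add_right_eq_self _ z'.1]
    refine integral_congr_ae (.of_forall fun t => ?_)
    simp only [tfShift_apply, exp_eq_fourierChar, map_mul, Prod.fst_sub, Prod.snd_sub,
      add_sub_cancel_right, ← Circle.coe_inv_eq_conj, ← AddChar.map_neg_eq_inv]
    have e : t - (z.1 - z'.1) = t + z'.1 - z.1 := by abel
    have e2 : (Real.fourierChar ⟪z'.2, t + z'.1⟫_ℝ : ℂ) * Real.fourierChar (-⟪z.2, t + z'.1⟫_ℝ) =
        (Real.fourierChar ⟪z'.2 - z.2, z'.1⟫_ℝ : ℂ) * Real.fourierChar (-⟪z.2 - z'.2, t⟫_ℝ) := by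
      rw [← Circle.coe_mul, ← Circle.coe_mul, ← AddChar.map_add_eq_mul, ← AddChar.map_add_eq_mul]
      congr 2
      simp only [inner_add_right, inner_sub_left]
      ring
    rw [e]
    linear_combination (γ t * conj (g (t + z'.1 - z.1))) * e2
  rw [h, norm_mul, Circle.norm_coe, one_mul]

/-- The pointwise estimate behind the independence of modulation spaces of the window. -/
theorem energy_mul_enorm_stft_le (g γ : 𝓢(E, ℂ)) (f : 𝓢'(E, ℂ)) (z' : E × E) :
    ENNReal.ofReal (energy g) * ‖stft γ f z'.1 z'.2‖ₑ ≤
      ∫⁻ z : E × E, ‖stft g f z.1 z.2‖ₑ * ‖stftS g γ (z - z')‖ₑ := by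
  have h := integral_stft_mul g (tfShift z'.1 z'.2 γ) f
  have h0 : 0 ≤ energy g := integral_nonneg fun t => by positivity
  have h1 : ENNReal.ofReal (energy g) * ‖stft γ f z'.1 z'.2‖ₑ =
      ‖(energy g : ℂ) * f (conjS (tfShift z'.1 z'.2 γ))‖ₑ := by
    rw [enorm_mul, ← ofReal_norm (energy g : ℂ), Complex.norm_real,
      Real.norm_of_nonneg h0]
    rfl
  rw [h1, ← h]
  refine (enorm_integral_le_lintegral_enorm _).trans (lintegral_mono fun z => le_of_eq ?_)
  rw [enorm_mul, RCLike.enorm_conj]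
  congr 1
  rw [enorm_eq_iff_norm_eq, norm_stftS_tfShift]

end WeylMod

namespace WeylMod

open Filter Topology

variable {E : Type*} [NormedAddCommGroup E] [InnerProductSpace ℝ E] [FiniteDimensional ℝ E]
  [MeasurableSpace E] [BorelSpace E]

/-! ### Moderate weights and decay -/

theorem eLpNorm_lt_top_of_le_one {X : Type*} [MeasurableSpace X] {μ : Measure X} {p : ℝ≥0∞}
    (hp : 1 ≤ p) {f : X → ℝ≥0∞} (h1 : ∀ x, f x ≤ 1) (hf : ∫⁻ x, f x ∂μ < ∞) :
    eLpNorm f p μ < ∞ := by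
  rcases eq_or_ne p ∞ with rfl | hp'
  · rw [eLpNorm_ennreal_top]
    exact (essSup_le_of_ae_le 1 (.of_forall h1)).trans_lt ENNReal.one_lt_top
  · have h0 : p ≠ 0 := (one_pos.trans_le hp).ne'
    have hp1 : 1 ≤ p.toReal := by
      rw [← ENNReal.toReal_one]
      exact ENNReal.toReal_mono hp' hp
    rw [eLpNorm_ennreal h0 hp']
    refine ENNReal.rpow_lt_top_of_nonneg (by positivity)
      (ne_top_of_le_ne_top hf.ne (lintegral_mono fun x => ?_))
    calc f x ^ p.toReal ≤ f x ^ (1 : ℝ) := ENNReal.rpow_le_rpow_of_exponent_ge (h1 x) hp1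
      _ = f x := ENNReal.rpow_one _

/-- The norm of the pair dominates both components, so the weight is at most a product of two
functions (1 + ‖·‖) ^ (-(dim E + 1)). Each is bounded by 1 and integrable, hence in every L^p. -/
theorem mixE_one_add_norm_lt_top {p q : ℝ≥0∞} (hp : 1 ≤ p) (hq : 1 ≤ q) :
    mixE p q (fun x ξ : E => ENNReal.ofReal
      (((1 + ‖(x, ξ)‖) ^ (2 * (Module.finrank ℝ E + 1)))⁻¹)) < ∞ := by
  set M := Module.finrank ℝ E + 1 with hM
  set w : E → ℝ≥0∞ := fun x => ENNReal.ofReal ((1 + ‖x‖) ^ (-(M : ℝ))) with hw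
  have hwm : Measurable w := by fun_prop
  have hw1 : ∀ x, w x ≤ 1 := by
    intro x
    rw [hw, ENNReal.ofReal_le_one]
    exact Real.rpow_le_one_of_one_le_of_nonpos (by linarith [norm_nonneg x])
      (by simp)
  have hwi : ∫⁻ x, w x < ∞ :=
    finite_integral_one_add_norm (r := (M : ℝ)) (by rw [hM]; push_cast; linarith)
  have hle : ∀ x ξ : E, ENNReal.ofReal (((1 + ‖(x, ξ)‖) ^ (2 * M))⁻¹) ≤ w x * w ξ := by
    intro x ξ
    rw [← ENNReal.ofReal_mul (by positivity)]
    refine ENNReal.ofReal_le_ofReal ?_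
    rw [Real.rpow_neg (by positivity), Real.rpow_neg (by positivity), Real.rpow_natCast,
      Real.rpow_natCast, ← mul_inv, two_mul, pow_add]
    have h1 : ‖x‖ ≤ ‖(x, ξ)‖ := norm_fst_le (x, ξ)
    have h2 : ‖ξ‖ ≤ ‖(x, ξ)‖ := norm_snd_le (x, ξ)
    gcongr
  refine (mixE_mono hle).trans_lt ?_
  have e : mixE p q (fun x ξ : E => w x * w ξ) = eLpNorm w p volume * eLpNorm w q volume := by
    unfold mixE
    rw [← eLpNorm_ennreal_const_mul _ _ _ hwm]
    congr 1
    ext ξ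
    simp_rw [mul_comm _ (w ξ)]
    rw [eLpNorm_ennreal_const_mul _ _ _ hwm]
  rw [e]
  exact ENNReal.mul_lt_top (eLpNorm_lt_top_of_le_one hp hw1 hwi)
    (eLpNorm_lt_top_of_le_one hq hw1 hwi)

/-- The Schwartz functions belong to all weighted mixed Lebesgue spaces. -/
theorem mixE_schwartz_lt_top {p q : ℝ≥0∞} (hp : 1 ≤ p) (hq : 1 ≤ q) (F : 𝓢(E × E, ℂ)) (N : ℕ) :
    mixE p q (fun x ξ => ENNReal.ofReal ((1 + ‖(x, ξ)‖) ^ N) * ‖F (x, ξ)‖ₑ) < ∞ := by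
  set M := 2 * (Module.finrank ℝ E + 1) with hM
  obtain ⟨C, hC⟩ : ∃ C : ℝ, ∀ z, (1 + ‖z‖) ^ (N + M) * ‖F z‖ ≤ C := by
    have := one_add_pow_mul_le F (N + M) 0
    simp only [norm_iteratedFDeriv_zero] at this
    exact ⟨_, this⟩
  have hle : ∀ x ξ : E, ENNReal.ofReal ((1 + ‖(x, ξ)‖) ^ N) * ‖F (x, ξ)‖ₑ ≤
      ENNReal.ofReal C * ENNReal.ofReal (((1 + ‖(x, ξ)‖) ^ M)⁻¹) := by
    intro x ξ
    rw [← ofReal_norm, ← ENNReal.ofReal_mul (by positivity), ← ENNReal.ofReal_mul' (by positivity)]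
    refine ENNReal.ofReal_le_ofReal ?_
    rw [← div_eq_mul_inv, le_div_iff₀ (by positivity)]
    calc _ = (1 + ‖(x, ξ)‖) ^ (N + M) * ‖F (x, ξ)‖ := by rw [pow_add]; ring
      _ ≤ C := hC _
  have hm : Measurable (Function.uncurry fun x ξ : E =>
      ENNReal.ofReal (((1 + ‖(x, ξ)‖) ^ M)⁻¹)) := by
    have : Measurable fun z : E × E => ENNReal.ofReal (((1 + ‖z‖) ^ M)⁻¹) := by fun_prop
    exact this
  refine (mixE_mono hle).trans_lt ?_
  rw [mixE_const_mul _ hm]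
  exact ENNReal.mul_lt_top ENNReal.ofReal_lt_top (mixE_one_add_norm_lt_top hp hq)

/-- A continuous positive weight on phase space that is moderate with respect to a polynomial. -/
structure IsModerate (m : E → E → ℝ) : Prop where
  continuous : Continuous fun z : E × E => m z.1 z.2
  pos : ∀ x ξ, 0 < m x ξ
  exists_le : ∃ (C : ℝ) (N : ℕ), 0 ≤ C ∧
    ∀ z w : E × E, m z.1 z.2 ≤ C * (1 + ‖z - w‖) ^ N * m w.1 w.2

theorem continuous_bracket {G : Type*} [NormedAddCommGroup G] (s : ℝ) :
    Continuous (bracket s : G → ℝ) := by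
  unfold bracket
  exact Continuous.rpow_const (by fun_prop) fun z => Or.inl (by positivity)

theorem bracket_pos {G : Type*} [NormedAddCommGroup G] (s : ℝ) (z : G) : 0 < bracket s z := by
  unfold bracket
  positivity

/-- Peetre's inequality. -/
theorem bracket_le_mul {G : Type*} [NormedAddCommGroup G] {s : ℝ} (hs : 0 ≤ s) (z w : G) :
    bracket s z ≤ 2 ^ (s / 2) * bracket s (z - w) * bracket s w := by
  unfold bracket
  rw [← Real.mul_rpow (by positivity) (by positivity), ← Real.mul_rpow (by positivity)
    (by positivity)]
  refine Real.rpow_le_rpow (by positivity) ?_ (by positivity)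
  have h : ‖z‖ ≤ ‖z - w‖ + ‖w‖ := by simpa using norm_add_le (z - w) w
  nlinarith [norm_nonneg z, norm_nonneg w, norm_nonneg (z - w), sq_nonneg (‖z - w‖ - ‖w‖),
    mul_nonneg (sq_nonneg ‖z - w‖) (sq_nonneg ‖w‖)]

theorem bracket_le_pow {G : Type*} [NormedAddCommGroup G] {s : ℝ} (hs : 0 ≤ s) (z : G) :
    bracket s z ≤ (1 + ‖z‖) ^ ⌈s⌉₊ := by
  have h1 : bracket s z ≤ (1 + ‖z‖) ^ s := by
    rw [bracket, show s = 2 * (s / 2) by ring, Real.rpow_mul (by positivity), Real.rpow_two,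
      show 2 * (s / 2) / 2 = s / 2 by ring]
    refine Real.rpow_le_rpow (by positivity) ?_ (by positivity)
    nlinarith [norm_nonneg z]
  refine h1.trans ?_
  rw [← Real.rpow_natCast]
  exact Real.rpow_le_rpow_of_exponent_le (by linarith [norm_nonneg z]) (Nat.le_ceil s)

theorem norm_toLp_prod_le (x ξ : E) : ‖(WithLp.toLp 2 (x, ξ) : Phase E)‖ ≤ 2 * ‖(x, ξ)‖ := by
  have h : (WithLp.toLp 2 (x, ξ) : Phase E) = WithLp.toLp 2 (x, 0) + WithLp.toLp 2 (0, ξ) := by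
    rw [← WithLp.toLp_add]; simp
  rw [h]
  refine (norm_add_le _ _).trans ?_
  rw [WithLp.norm_toLp_fst, WithLp.norm_toLp_snd]
  have h1 : ‖x‖ ≤ ‖(x, ξ)‖ := norm_fst_le (x, ξ)
  have h2 : ‖ξ‖ ≤ ‖(x, ξ)‖ := norm_snd_le (x, ξ)
  linarith

theorem isModerate_vWeight {s : ℝ} (hs : 0 ≤ s) : IsModerate (vWeight s : E → E → ℝ) where
  continuous := by
    unfold vWeight
    exact (continuous_bracket s).comp (WithLp.prod_continuous_toLp 2 E E)
  pos x ξ := bracket_pos s _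
  exists_le := by
    refine ⟨2 ^ (s / 2) * 2 ^ ⌈s⌉₊, ⌈s⌉₊, by positivity, fun z w => ?_⟩
    refine (bracket_le_mul hs _ (WithLp.toLp 2 (w.1, w.2))).trans ?_
    refine mul_le_mul_of_nonneg_right ?_ (bracket_pos s _).le
    rw [mul_assoc]
    gcongr
    refine (bracket_le_pow hs _).trans ?_
    rw [← mul_pow, ← WithLp.toLp_sub]
    gcongr
    have := norm_toLp_prod_le (z - w).1 (z - w).2
    have e : ((z.1, z.2) - (w.1, w.2) : E × E) = ((z - w).1, (z - w).2) := rfl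
    rw [e]
    rw [Prod.mk.eta] at this ⊢
    linarith

theorem isModerate_symbolWeight {s : ℝ} (hs : 0 ≤ s) :
    IsModerate (symbolWeight s : Phase E → Phase E → ℝ) where
  continuous := (continuous_bracket s).comp continuous_snd
  pos x ξ := bracket_pos s _
  exists_le := by
    refine ⟨2 ^ (s / 2), ⌈s⌉₊, by positivity, fun z w => ?_⟩
    refine (bracket_le_mul hs _ w.2).trans ?_
    refine mul_le_mul_of_nonneg_right ?_ (bracket_pos s _).le
    gcongr
    refine (bracket_le_pow hs _).trans ?_
    gcongr
    exact norm_snd_le (z - w)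

/-- Convolution with a Schwartz function maps weighted mixed Lebesgue spaces to each other. -/
theorem exists_mixE_weight_le {m : E → E → ℝ} (hm : IsModerate m) {p p' q q' : ℝ≥0∞} (hp : 1 ≤ p)
    (hpp' : p ≤ p') (hq : 1 ≤ q) (hqq' : q ≤ q') (F : 𝓢(E × E, ℂ)) :
    ∃ C : ℝ≥0, ∀ U U' : E → E → ℝ≥0∞, Measurable (Function.uncurry U) →
      Measurable (Function.uncurry U') →
      (∀ x ξ, U' x ξ ≤ ∫⁻ z : E × E, U z.1 z.2 * ‖F (z - (x, ξ))‖ₑ) →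
      mixE p' q' (fun x ξ => ENNReal.ofReal (m x ξ) * U' x ξ) ≤
        C * mixE p q (fun x ξ => ENNReal.ofReal (m x ξ) * U x ξ) := by
  obtain ⟨C, N, hC, hle⟩ := hm.exists_le
  have hmm : Measurable fun z : E × E => ENNReal.ofReal (m z.1 z.2) :=
    ENNReal.measurable_ofReal.comp hm.continuous.measurable
  -- The weight at (x, ξ) is bounded by the weight at z times a polynomial in the difference, and a
  -- Schwartz kernel absorbs that polynomial. So the weighted estimate is an unweighted convolution
  -- with Q.
  set Q : E → E → ℝ≥0∞ := fun x ξ =>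
    ENNReal.ofReal C * (ENNReal.ofReal ((1 + ‖(x, ξ)‖) ^ N) * ‖F (x, ξ)‖ₑ) with hQ
  have hFm : Measurable fun z : E × E => ‖F z‖ₑ := F.continuous.enorm.measurable
  have hQ0 : Measurable fun z : E × E => ENNReal.ofReal ((1 + ‖z‖) ^ N) * ‖F z‖ₑ := by fun_prop
  have hQm : Measurable (Function.uncurry Q) := hQ0.const_mul _
  have hQt : mixE (youngExponent p p') (youngExponent q q') Q < ∞ := by
    rw [hQ, mixE_const_mul _ hQ0]
    exact ENNReal.mul_lt_top ENNReal.ofReal_lt_top (mixE_schwartz_lt_top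
      (one_le_youngExponent hpp') (one_le_youngExponent hqq') F N)
  refine ⟨(mixE (youngExponent p p') (youngExponent q q') Q).toNNReal, fun U U' hU hU' h => ?_⟩
  rw [ENNReal.coe_toNNReal hQt.ne, mul_comm (mixE _ _ Q)]
  refine mixE_le_of_le_convolution hp hpp' hq hqq' (hmm.mul hU) (hmm.mul hU') hQm fun x ξ => ?_
  have hm1 : Measurable fun z : E × E => U z.1 z.2 * ‖F (z - (x, ξ))‖ₑ :=
    hU.mul (hFm.comp (measurable_id.sub_const _))
  calc _ ≤ ENNReal.ofReal (m x ξ) * ∫⁻ z : E × E, U z.1 z.2 * ‖F (z - (x, ξ))‖ₑ := by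
        gcongr; exact h x ξ
    _ = ∫⁻ z : E × E, ENNReal.ofReal (m x ξ) * (U z.1 z.2 * ‖F (z - (x, ξ))‖ₑ) := by
        rw [lintegral_const_mul _ hm1]
    _ ≤ _ := by
        refine lintegral_mono fun z => ?_
        have h1 : ENNReal.ofReal (m x ξ) ≤ ENNReal.ofReal C *
            ENNReal.ofReal ((1 + ‖z - (x, ξ)‖) ^ N) * ENNReal.ofReal (m z.1 z.2) := by
          rw [← ENNReal.ofReal_mul hC, ← ENNReal.ofReal_mul (by positivity)]
          refine ENNReal.ofReal_le_ofReal ?_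
          rw [norm_sub_rev]
          exact hle (x, ξ) z
        calc _ ≤ ENNReal.ofReal C * ENNReal.ofReal ((1 + ‖z - (x, ξ)‖) ^ N) *
              ENNReal.ofReal (m z.1 z.2) * (U z.1 z.2 * ‖F (z - (x, ξ))‖ₑ) := by gcongr
          _ = ENNReal.ofReal (m z.1 z.2) * U z.1 z.2 * (ENNReal.ofReal C *
              (ENNReal.ofReal ((1 + ‖z - (x, ξ)‖) ^ N) * ‖F (z - (x, ξ))‖ₑ)) := by ring
          _ = _ := rfl

end WeylMod

namespace WeylMod

open Filter Topology

variable {E : Type*} [NormedAddCommGroup E] [InnerProductSpace ℝ E] [FiniteDimensional ℝ E]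
  [MeasurableSpace E] [BorelSpace E]

/-! ### Modulation spaces -/

theorem measurable_enorm_stft (g : 𝓢(E, ℂ)) (f : 𝓢'(E, ℂ)) :
    Measurable (Function.uncurry fun x ξ => ‖stft g f x ξ‖ₑ) :=
  (continuous_stft g f).enorm.measurable

theorem IsModerate.measurable {m : E → E → ℝ} (hm : IsModerate m) :
    Measurable (Function.uncurry fun x ξ => ENNReal.ofReal (m x ξ)) :=
  ENNReal.measurable_ofReal.comp hm.continuous.measurable

theorem IsModerate.measurable_mul {m : E → E → ℝ} (hm : IsModerate m) {U : E → E → ℝ≥0∞}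
    (hU : Measurable (Function.uncurry U)) :
    Measurable (Function.uncurry fun x ξ => ENNReal.ofReal (m x ξ) * U x ξ) :=
  hm.measurable.mul hU

theorem modulationNorm_eq {m : E → E → ℝ} (hm : IsModerate m) (g : 𝓢(E, ℂ)) (p q : ℝ≥0∞)
    (f : 𝓢'(E, ℂ)) : modulationNorm g p q m f =
      mixE p q fun x ξ => ENNReal.ofReal (m x ξ) * ‖stft g f x ξ‖ₑ := by
  unfold modulationNorm mixedNorm mixE
  congr 1
  ext ξ
  rw [← eLpNorm_enorm]
  congr 1
  ext x
  rw [enorm_mul, ← ofReal_norm (m x ξ : ℂ), Complex.norm_real,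
    Real.norm_of_nonneg (hm.pos x ξ).le]

theorem stft_add (g : 𝓢(E, ℂ)) (f h : 𝓢'(E, ℂ)) (x ξ : E) :
    stft g (f + h) x ξ = stft g f x ξ + stft g h x ξ := rfl

theorem stft_sub (g : 𝓢(E, ℂ)) (f h : 𝓢'(E, ℂ)) (x ξ : E) :
    stft g (f - h) x ξ = stft g f x ξ - stft g h x ξ := rfl

theorem stft_smul (g : 𝓢(E, ℂ)) (c : ℂ) (f : 𝓢'(E, ℂ)) (x ξ : E) :
    stft g (c • f) x ξ = c * stft g f x ξ := rfl

theorem modulationNorm_add_le {m : E → E → ℝ} (hm : IsModerate m) (g : 𝓢(E, ℂ)) {p q : ℝ≥0∞}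
    (hp : 1 ≤ p) (hq : 1 ≤ q) (f h : 𝓢'(E, ℂ)) :
    modulationNorm g p q m (f + h) ≤ modulationNorm g p q m f + modulationNorm g p q m h := by
  simp_rw [modulationNorm_eq hm]
  refine le_trans (mixE_mono fun x ξ => ?_) (mixE_add_le hp hq
    (hm.measurable_mul (measurable_enorm_stft g f)) (hm.measurable_mul (measurable_enorm_stft g h)))
  rw [← mul_add, stft_add]
  gcongr
  exact enorm_add_le _ _

theorem modulationNorm_smul {m : E → E → ℝ} (hm : IsModerate m) (g : 𝓢(E, ℂ)) (p q : ℝ≥0∞)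
    (c : ℂ) (f : 𝓢'(E, ℂ)) :
    modulationNorm g p q m (c • f) = ‖c‖ₑ * modulationNorm g p q m f := by
  simp_rw [modulationNorm_eq hm]
  rw [← mixE_const_mul _ (hm.measurable_mul (measurable_enorm_stft g f))]
  congr 1
  ext x ξ
  rw [stft_smul, enorm_mul]
  ring

theorem modulationNorm_sub_le {m : E → E → ℝ} (hm : IsModerate m) (g : 𝓢(E, ℂ)) {p q : ℝ≥0∞}
    (hp : 1 ≤ p) (hq : 1 ≤ q) (f h : 𝓢'(E, ℂ)) :
    modulationNorm g p q m (f - h) ≤ modulationNorm g p q m f + modulationNorm g p q m h := by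
  rw [sub_eq_add_neg, ← neg_one_smul ℂ h]
  refine (modulationNorm_add_le hm g hp hq _ _).trans ?_
  rw [modulationNorm_smul hm]
  simp

/-- The modulation space as a subspace of the tempered distributions. -/
def modulationSubmodule (g : 𝓢(E, ℂ)) {p q : ℝ≥0∞} (hp : 1 ≤ p) (hq : 1 ≤ q) {m : E → E → ℝ}
    (hm : IsModerate m) : Submodule ℂ 𝓢'(E, ℂ) where
  carrier := modulationSpace g p q m
  add_mem' {f h} hf hh := (modulationNorm_add_le hm g hp hq f h).trans_lt (ENNReal.add_lt_top.2 ⟨hf, hh⟩)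
  zero_mem' := by
    have h := modulationNorm_smul hm g p q (0 : ℂ) (0 : 𝓢'(E, ℂ))
    have e : (0 : ℂ) • (0 : 𝓢'(E, ℂ)) = 0 := by ext φ; exact zero_mul _
    rw [e, enorm_zero, zero_mul] at h
    change modulationNorm g p q m 0 < ∞
    rw [h]
    exact ENNReal.zero_lt_top
  smul_mem' c f hf := by
    change modulationNorm g p q m (c • f) < ∞
    rw [modulationNorm_smul hm]
    exact ENNReal.mul_lt_top enorm_lt_top hf

theorem modulationNorm_toDistribution_lt_top {m : E → E → ℝ} (hm : IsModerate m) (g φ : 𝓢(E, ℂ))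
    {p q : ℝ≥0∞} (hp : 1 ≤ p) (hq : 1 ≤ q) :
    modulationNorm g p q m (toDistribution φ) < ∞ := by
  obtain ⟨C, N, hC, hle⟩ := hm.exists_le
  rw [modulationNorm_eq hm]
  have hF : Measurable fun z : E × E =>
      ENNReal.ofReal ((1 + ‖z‖) ^ N) * ‖stftS g φ z‖ₑ := by
    have := (stftS g φ).continuous.enorm.measurable
    fun_prop
  refine (mixE_mono (G := fun x ξ => ENNReal.ofReal (C * m 0 0) *
    (ENNReal.ofReal ((1 + ‖(x, ξ)‖) ^ N) * ‖stftS g φ (x, ξ)‖ₑ)) fun x ξ => ?_).trans_lt ?_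
  · rw [stft_toDistribution, ← mul_assoc, ← ENNReal.ofReal_mul' (by positivity)]
    gcongr
    have := hle (x, ξ) 0
    rw [sub_zero] at this
    exact this.trans_eq (by simp only [Prod.fst_zero, Prod.snd_zero]; ring)
  · rw [mixE_const_mul _ hF]
    exact ENNReal.mul_lt_top ENNReal.ofReal_lt_top (mixE_schwartz_lt_top hp hq _ _)

/-- A vanishing mixed norm only gives zero almost everywhere; continuity of the short-time Fourier
transform upgrades this to every point. -/
theorem eq_zero_of_modulationNorm_eq_zero {m : E → E → ℝ} (hm : IsModerate m) {g : 𝓢(E, ℂ)}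
    (hg : g ≠ 0) {p q : ℝ≥0∞} (hp : 1 ≤ p) (hq : 1 ≤ q) {f : 𝓢'(E, ℂ)}
    (h : modulationNorm g p q m f = 0) : f = 0 := by
  have hp0 : p ≠ 0 := (one_pos.trans_le hp).ne'
  have hq0 : q ≠ 0 := (one_pos.trans_le hq).ne'
  rw [modulationNorm_eq hm] at h
  have hU := hm.measurable_mul (measurable_enorm_stft g f)
  have hU' : Measurable fun z : E × E => ENNReal.ofReal (m z.1 z.2) * ‖stft g f z.1 z.2‖ₑ := hU
  unfold mixE at h
  rw [eLpNorm_eq_zero_iff (measurable_eLpNorm_slice hU p).aestronglyMeasurable hq0] at h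
  have h1 : ∫⁻ z : E × E, ENNReal.ofReal (m z.1 z.2) * ‖stft g f z.1 z.2‖ₑ = 0 := by
    rw [Measure.volume_eq_prod, lintegral_prod_symm _ hU'.aemeasurable]
    refine (lintegral_congr_ae ?_).trans lintegral_zero
    filter_upwards [h] with ξ hξ
    have hs : Measurable fun x => ENNReal.ofReal (m x ξ) * ‖stft g f x ξ‖ₑ :=
      hU.comp (measurable_id.prodMk measurable_const)
    rw [Pi.zero_apply, eLpNorm_eq_zero_iff hs.aestronglyMeasurable hp0] at hξ
    exact (lintegral_congr_ae hξ).trans lintegral_zero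
  rw [lintegral_eq_zero_iff hU'] at h1
  have h2 : (fun z : E × E => stft g f z.1 z.2) =ᵐ[volume] fun _ => 0 := by
    filter_upwards [h1] with z hz
    rw [Pi.zero_apply, mul_eq_zero, ENNReal.ofReal_eq_zero] at hz
    rcases hz with hz | hz
    · exact absurd hz (hm.pos z.1 z.2).not_ge
    · exact enorm_eq_zero.1 hz
  have h3 := ((continuous_stft g f).ae_eq_iff_eq volume continuous_const).1 h2
  exact eq_zero_of_stft_eq_zero hg fun x ξ => congrFun h3 (x, ξ)

/-- Change of window, and inclusion of modulation spaces for increasing exponents. -/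
theorem exists_modulationNorm_le {m : E → E → ℝ} (hm : IsModerate m) {g : 𝓢(E, ℂ)} (hg : g ≠ 0)
    (γ : 𝓢(E, ℂ)) {p p' q q' : ℝ≥0∞} (hp : 1 ≤ p) (hpp' : p ≤ p') (hq : 1 ≤ q) (hqq' : q ≤ q') :
    ∃ C : ℝ≥0, ∀ f, modulationNorm γ p' q' m f ≤ C * modulationNorm g p q m f := by
  obtain ⟨C, hC⟩ := exists_mixE_weight_le hm hp hpp' hq hqq' (stftS g γ)
  have he : ENNReal.ofReal (energy g) ≠ 0 := by
    simpa using energy_pos hg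
  refine ⟨(ENNReal.ofReal (energy g))⁻¹.toNNReal * C, fun f => ?_⟩
  simp_rw [modulationNorm_eq hm]
  have h := hC (fun x ξ => ‖stft g f x ξ‖ₑ)
    (fun x ξ => ENNReal.ofReal (energy g) * ‖stft γ f x ξ‖ₑ) (measurable_enorm_stft g f)
    ((measurable_enorm_stft γ f).const_mul _) (fun x ξ => energy_mul_enorm_stft_le g γ f (x, ξ))
  simp_rw [mul_left_comm _ (ENNReal.ofReal (energy g))] at h
  rw [mixE_const_mul _ (hm.measurable_mul (measurable_enorm_stft γ f))] at h
  rw [ENNReal.coe_mul, ENNReal.coe_toNNReal (ENNReal.inv_ne_top.2 he), mul_assoc,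
    ← ENNReal.mul_le_iff_le_inv he ENNReal.ofReal_ne_top]
  exact h

theorem exists_norm_le_of_continuous (L : 𝓢(E, ℂ) →L[ℂ] ℂ) (g : 𝓢(E, ℂ)) :
    ∃ (C : ℝ) (N : ℕ), 0 ≤ C ∧ ∀ z : E × E, ‖L (tfShift z.1 z.2 g)‖ ≤ C * (1 + ‖z‖) ^ N := by
  obtain ⟨s, C, -, h⟩ := Seminorm.bound_of_continuous (schwartz_withSeminorms ℂ E ℂ)
    ((normSeminorm ℂ ℂ).comp L.toLinearMap) (continuous_norm.comp L.continuous)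
  choose D N hD hN using fun i : ℕ × ℕ => seminorm_tfShift_le g i.1 i.2
  refine ⟨C * ∑ i ∈ s, D i, s.sup N, mul_nonneg C.2 (Finset.sum_nonneg fun i _ => hD i),
    fun z => ?_⟩
  have hz : 1 ≤ 1 + ‖z‖ := by linarith [norm_nonneg z]
  refine (h _).trans ?_
  rw [smul_apply, NNReal.smul_def, smul_eq_mul, mul_assoc]
  refine mul_le_mul_of_nonneg_left ?_ C.2
  have h0 : ∀ i, 0 ≤ D i * (1 + ‖z‖) ^ s.sup N := fun i =>
    mul_nonneg (hD i) (pow_nonneg (by linarith) _)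
  rw [Finset.sum_mul]
  refine Seminorm.finset_sup_apply_le (Finset.sum_nonneg fun i _ => h0 i) fun i hi => ?_
  refine le_trans ?_ (Finset.single_le_sum (f := fun i => D i * (1 + ‖z‖) ^ s.sup N)
    (fun i _ => h0 i) hi)
  refine (hN i z).trans (mul_le_mul_of_nonneg_left ?_ (hD i))
  exact pow_le_pow_right₀ hz (Finset.le_sup hi)

theorem exists_norm_stft_le (g : 𝓢(E, ℂ)) (f : 𝓢'(E, ℂ)) :
    ∃ (C : ℝ) (N : ℕ), 0 ≤ C ∧ ∀ z : E × E, ‖stft g f z.1 z.2‖ ≤ C * (1 + ‖z‖) ^ N := by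
  obtain ⟨C, N, hC, h⟩ := exists_norm_le_of_continuous (conjFunctional f) g
  refine ⟨C, N, hC, fun z => ?_⟩
  have := h z
  rwa [conjFunctional_tfShift, RCLike.norm_conj] at this

theorem integrable_stft_mul (g : 𝓢(E, ℂ)) (f : 𝓢'(E, ℂ)) (F : 𝓢(E × E, ℂ)) :
    Integrable fun z : E × E => stft g f z.1 z.2 * conj (F z) := by
  obtain ⟨C, N, hC, h⟩ := exists_norm_stft_le g f
  refine ((integrable_norm_mul_one_add_pow volume F N).const_mul C).mono'
    ((continuous_stft g f).mul (continuous_conj.comp F.continuous)).aestronglyMeasurable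
    (.of_forall fun z => ?_)
  rw [norm_mul, RCLike.norm_conj]
  calc _ ≤ C * (1 + ‖z‖) ^ N * ‖F z‖ := by gcongr; exact h z
    _ = _ := by ring

theorem tendsto_eLpNorm_ennreal_zero {X : Type*} [MeasurableSpace X] {μ : Measure X} {p : ℝ≥0∞}
    (h0 : p ≠ 0) (h1 : p ≠ ∞) {F : ℕ → X → ℝ≥0∞} {G : X → ℝ≥0∞} (hF : ∀ n, Measurable (F n))
    (hle : ∀ n x, F n x ≤ G x) (hG : eLpNorm G p μ ≠ ∞)
    (hlim : ∀ᵐ x ∂μ, Tendsto (fun n => F n x) atTop (𝓝 0)) :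
    Tendsto (fun n => eLpNorm (F n) p μ) atTop (𝓝 0) := by
  have hp : 0 < p.toReal := ENNReal.toReal_pos h0 h1
  simp_rw [eLpNorm_ennreal h0 h1]
  rw [eLpNorm_ennreal h0 h1] at hG
  have hG' : ∫⁻ x, G x ^ p.toReal ∂μ ≠ ∞ := fun h => hG (by
    rw [h, ENNReal.top_rpow_of_pos (by positivity)])
  have key : Tendsto (fun n => ∫⁻ x, F n x ^ p.toReal ∂μ) atTop (𝓝 (∫⁻ _, 0 ∂μ)) := by
    refine tendsto_lintegral_of_dominated_convergence (fun x => G x ^ p.toReal)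
      (fun n => (hF n).pow_const _) (fun n => .of_forall fun x =>
        ENNReal.rpow_le_rpow (hle n x) hp.le) hG' ?_
    filter_upwards [hlim] with x hx
    have := hx.ennrpow_const p.toReal
    rwa [ENNReal.zero_rpow_of_pos hp] at this
  rw [lintegral_zero] at key
  have := key.ennrpow_const (1 / p.toReal)
  rwa [ENNReal.zero_rpow_of_pos (by positivity)] at this

/-- Dominated convergence in x and then in ξ. The inner one is available only for almost every ξ,
where the slice norm of the majorant is finite. Both exponents must be finite. -/
theorem tendsto_mixE_zero {p q : ℝ≥0∞} (hp0 : p ≠ 0) (hp : p ≠ ∞) (hq0 : q ≠ 0) (hq : q ≠ ∞)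
    {F : ℕ → E → E → ℝ≥0∞} {G : E → E → ℝ≥0∞} (hF : ∀ n, Measurable (Function.uncurry (F n)))
    (hGm : Measurable (Function.uncurry G))
    (hle : ∀ n x ξ, F n x ξ ≤ G x ξ) (hG : mixE p q G ≠ ∞)
    (hlim : ∀ x ξ, Tendsto (fun n => F n x ξ) atTop (𝓝 0)) :
    Tendsto (fun n => mixE p q (F n)) atTop (𝓝 0) := by
  refine tendsto_eLpNorm_ennreal_zero hq0 hq (fun n => measurable_eLpNorm_slice (hF n) p)
    (fun n ξ => eLpNorm_ennreal_mono p fun x => hle n x ξ) hG ?_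
  have hfin : ∀ᵐ ξ : E, eLpNorm (fun x => G x ξ) p volume < ∞ := by
    have hq' : 0 < q.toReal := ENNReal.toReal_pos hq0 hq
    have h1 := hG
    unfold mixE at h1
    rw [eLpNorm_ennreal hq0 hq] at h1
    have h2 : ∫⁻ ξ, eLpNorm (fun x => G x ξ) p volume ^ q.toReal ≠ ∞ := fun h => h1 (by
      rw [h, ENNReal.top_rpow_of_pos (by positivity)])
    filter_upwards [ae_lt_top ((measurable_eLpNorm_slice hGm p).pow_const _) h2] with ξ hξ
    exact (ENNReal.rpow_lt_top_iff_of_pos hq').1 hξ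
  filter_upwards [hfin] with ξ hξ
  exact tendsto_eLpNorm_ennreal_zero hp0 hp
    (fun n => (hF n).comp (measurable_id.prodMk measurable_const)) (fun n x => hle n x ξ) hξ.ne
    (.of_forall fun x => hlim x ξ)

theorem conj_stftS_tfShift (g : 𝓢(E, ℂ)) (z z' : E × E) :
    conj (stftS g (tfShift z'.1 z'.2 g) z) = stftS g (tfShift z.1 z.2 g) z' := by
  rw [stftS_apply, stftS_apply, ← integral_conj]
  refine integral_congr_ae (.of_forall fun t => ?_)
  simp [mul_comm]

/-- The Schwartz function obtained by restricting the inversion formula to a ball. -/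
theorem exists_truncation {g : 𝓢(E, ℂ)} (hg : g ≠ 0) (f : 𝓢'(E, ℂ)) (r : ℝ) :
    ∃ φ : 𝓢(E, ℂ), ∀ z' : E × E,
      ENNReal.ofReal (energy g) * ‖stft g (f - toDistribution φ) z'.1 z'.2‖ₑ ≤
        ∫⁻ z : E × E, (Metric.closedBall 0 r)ᶜ.indicator (fun z => ‖stft g f z.1 z.2‖ₑ) z *
          ‖stftS g g (z - z')‖ₑ := by
  have he : (energy g : ℂ) ≠ 0 := by exact_mod_cast (energy_pos hg).ne'
  set B : Set (E × E) := Metric.closedBall 0 r with hB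
  have hBm : MeasurableSet B := Metric.isClosed_closedBall.measurableSet
  set v : E × E → ℂ := fun z => stft g f z.1 z.2 with hv
  have hvc : Continuous v := continuous_stft g f
  -- The inversion integral for f, restricted to a ball. The domain is compact, so continuity alone
  -- gives convergence in every seminorm, although f itself need not be a function.
  obtain ⟨u, -, hL⟩ := exists_schwartz_integral (μ := (volume : Measure (E × E)))
    (F := B.indicator v) (hvc.measurable.indicator hBm).aestronglyMeasurable (continuous_tfShift g)
    (fun k n => by
      have h1 : Continuous fun z : E × E =>
          ‖v z‖ * SchwartzMap.seminorm ℂ k n (tfShift z.1 z.2 g) :=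
        hvc.norm.mul (((schwartz_withSeminorms ℂ E ℂ).continuous_seminorm (k, n)).comp
          (continuous_tfShift g))
      have h2 := (h1.continuousOn (s := B)).integrableOn_compact (μ := volume)
        (isCompact_closedBall 0 r)
      rw [← integrable_indicator_iff hBm] at h2
      refine h2.congr (.of_forall fun z => ?_)
      by_cases hz : z ∈ B <;> simp [hz])
  have hu : ∀ z' : E × E, stftS g u z' = ∫ z, B.indicator v z * conj (stftS g (tfShift z'.1 z'.2 g) z) := by
    intro z'
    -- At a fixed z' the short-time Fourier transform is a continuous functional of w, so it may be
    -- applied under the Schwartz-valued integral that defines u.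
    have e : ∀ w : 𝓢(E, ℂ), stftS g w z' = toDistribution (conjS (tfShift z'.1 z'.2 g)) w := by
      intro w
      rw [stftS_apply]
      exact ((SchwartzMap.toTemperedDistributionCLM_apply_apply (volume : Measure E)
        (conjS (tfShift z'.1 z'.2 g)) w).trans rfl).symm
    set f' : 𝓢'(E, ℂ) := toDistribution (conjS (tfShift z'.1 z'.2 g)) with hf'
    have := hL ⟨f'.toLinearMap, f'.continuous⟩
    rw [e]
    refine this.trans (integral_congr_ae (.of_forall fun z => ?_))
    change B.indicator v z * f' (tfShift z.1 z.2 g) = _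
    rw [← e, ← conj_stftS_tfShift]
  refine ⟨(energy g : ℂ)⁻¹ • u, fun z' => ?_⟩
  set H : E × E → ℂ := fun z => conj (stftS g (tfShift z'.1 z'.2 g) z) with hH
  have hint : Integrable fun z => v z * H z := integrable_stft_mul g f _
  have hint' : Integrable fun z => B.indicator v z * H z := by
    refine (hint.indicator hBm).congr (.of_forall fun z => ?_)
    by_cases hz : z ∈ B <;> simp [hz]
  have key : (energy g : ℂ) * stft g (f - toDistribution ((energy g : ℂ)⁻¹ • u)) z'.1 z'.2 =
      ∫ z, Bᶜ.indicator v z * H z := by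
    have h1 : ∫ z, v z * H z = energy g * stft g f z'.1 z'.2 := integral_stft_mul g _ f
    rw [stft_sub, stft_toDistribution, map_smul, mul_sub, ← h1, smul_apply, smul_eq_mul,
      mul_inv_cancel_left₀ he, hu, ← integral_sub hint hint']
    refine integral_congr_ae (.of_forall fun z => ?_)
    by_cases hz : z ∈ B <;> simp [hz, hH]
  calc _ = ‖(energy g : ℂ) * stft g (f - toDistribution ((energy g : ℂ)⁻¹ • u)) z'.1 z'.2‖ₑ := by
        rw [enorm_mul, ← ofReal_norm (energy g : ℂ), Complex.norm_real,
          Real.norm_of_nonneg (energy_pos hg).le]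
    _ ≤ _ := by
        rw [key]
        refine (enorm_integral_le_lintegral_enorm _).trans (lintegral_mono fun z => le_of_eq ?_)
        rw [enorm_mul, hH, RCLike.enorm_conj, enorm_indicator_eq_indicator_enorm]
        congr 1
        rw [enorm_eq_iff_norm_eq, norm_stftS_tfShift]

/-- The Schwartz functions are dense in the modulation spaces with finite exponents. -/
theorem mem_schwartzClosure {m : E → E → ℝ} (hm : IsModerate m) {g : 𝓢(E, ℂ)} (hg : g ≠ 0)
    {p q : ℝ≥0∞} (hp : 1 ≤ p) (hq : 1 ≤ q) (hp' : p ≠ ∞) (hq' : q ≠ ∞) {f : 𝓢'(E, ℂ)}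
    (hf : modulationNorm g p q m f < ∞) : f ∈ schwartzClosure g p q m := by
  intro ε hε
  obtain ⟨C, hC⟩ := exists_mixE_weight_le hm hp le_rfl hq le_rfl (stftS g g)
  choose φ hφ using fun n : ℕ => exists_truncation hg f n
  have he : ENNReal.ofReal (energy g) ≠ 0 := by simpa using energy_pos hg
  set U : ℕ → E → E → ℝ≥0∞ := fun n x ξ => (Metric.closedBall (0 : E × E) n)ᶜ.indicator
    (fun z => ‖stft g f z.1 z.2‖ₑ) (x, ξ) with hU
  have hUm : ∀ n, Measurable (Function.uncurry (U n)) := fun n =>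
    (continuous_stft g f).enorm.measurable.indicator
      Metric.isClosed_closedBall.measurableSet.compl
  have hle : ∀ n, modulationNorm g p q m (f - toDistribution (φ n)) ≤
      (ENNReal.ofReal (energy g))⁻¹ * (C * mixE p q fun x ξ =>
        ENNReal.ofReal (m x ξ) * U n x ξ) := by
    intro n
    rw [modulationNorm_eq hm]
    have h := hC (U n) (fun x ξ => ENNReal.ofReal (energy g) *
      ‖stft g (f - toDistribution (φ n)) x ξ‖ₑ) (hUm n)
      ((measurable_enorm_stft g _).const_mul _) (fun x ξ => hφ n (x, ξ))
    simp_rw [mul_left_comm _ (ENNReal.ofReal (energy g))] at h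
    rw [mixE_const_mul _ (hm.measurable_mul (measurable_enorm_stft g _))] at h
    rwa [← ENNReal.mul_le_iff_le_inv he ENNReal.ofReal_ne_top]
  have hlim : Tendsto (fun n => mixE p q fun x ξ => ENNReal.ofReal (m x ξ) * U n x ξ) atTop
      (𝓝 0) := by
    rw [modulationNorm_eq hm] at hf
    refine tendsto_mixE_zero (one_pos.trans_le hp).ne' hp' (one_pos.trans_le hq).ne' hq'
      (fun n => hm.measurable_mul (hUm n)) (hm.measurable_mul (measurable_enorm_stft g f))
      (fun n x ξ => ?_) hf.ne (fun x ξ => ?_)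
    · gcongr
      exact Set.indicator_le_self _ _ _
    · refine tendsto_const_nhds.congr' ?_
      filter_upwards [eventually_ge_atTop ⌈‖(x, ξ)‖⌉₊] with n hn
      have : (x, ξ) ∈ Metric.closedBall (0 : E × E) n := by
        rw [mem_closedBall_zero_iff]
        exact Nat.ceil_le.1 hn
      simp [hU, this]
  have h1 : Tendsto (fun n => (ENNReal.ofReal (energy g))⁻¹ * (C * mixE p q fun x ξ =>
      ENNReal.ofReal (m x ξ) * U n x ξ)) atTop (𝓝 0) := by
    have := ENNReal.Tendsto.const_mul (ENNReal.Tendsto.const_mul hlim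
      (.inr (ENNReal.coe_ne_top (r := C)))) (.inr (ENNReal.inv_ne_top.2 he))
    simpa using this
  obtain ⟨n, hn⟩ := (h1.eventually_lt_const hε).exists
  exact ⟨φ n, (hle n).trans_lt hn⟩

/-- Two bounded extensions agree on the closure of the Schwartz functions. -/
theorem IsBoundedExtension.eq_of_mem_schwartzClosure {m : E → E → ℝ} (hm : IsModerate m)
    {g : 𝓢(E, ℂ)} (hg : g ≠ 0) {p₁ q₁ p₂ q₂ : ℝ≥0∞} (hp₂ : 1 ≤ p₂) (hq₂ : 1 ≤ q₂)
    {L : 𝓢(E, ℂ) →ₗ[ℂ] 𝓢'(E, ℂ)} {K K' : ℝ≥0∞} (hK : K ≠ ∞) (hK' : K' ≠ ∞)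
    {T T' : 𝓢'(E, ℂ) →ₗ.[ℂ] 𝓢'(E, ℂ)} (hT : IsBoundedExtension g p₁ q₁ p₂ q₂ m L K T)
    (hT' : IsBoundedExtension g p₁ q₁ p₂ q₂ m L K' T') (f : T.domain) (f' : T'.domain)
    (hff' : (f' : 𝓢'(E, ℂ)) = f) (hf : (f : 𝓢'(E, ℂ)) ∈ schwartzClosure g p₁ q₁ m) :
    T' f' = T f := by
  rw [← sub_eq_zero]
  refine eq_zero_of_modulationNorm_eq_zero hm hg hp₂ hq₂ (le_antisymm ?_ zero_le)
  have hle : ∀ ε : ℝ≥0∞, 0 < ε → modulationNorm g p₂ q₂ m (T' f' - T f) ≤ (K' + K) * ε := by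
    intro ε hε
    obtain ⟨φ, hφ⟩ := hf ε hε
    obtain ⟨h, e⟩ := hT.extends_schwartz φ
    obtain ⟨h', e'⟩ := hT'.extends_schwartz φ
    -- Both operators agree on φ, so its image may be subtracted from each; what remains is
    -- controlled by the distance from f to φ.
    have hd : T' f' - T f = T' (f' - ⟨toDistribution φ, h'⟩) - T (f - ⟨toDistribution φ, h⟩) := by
      rw [T'.map_sub, T.map_sub, e, e']
      abel
    rw [hd, add_mul]
    refine (modulationNorm_sub_le hm g hp₂ hq₂ _ _).trans (add_le_add ?_ ?_)
    · refine (hT'.norm_le _).trans ?_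
      gcongr
      rw [Submodule.coe_sub, hff']
      exact hφ.le
    · refine (hT.norm_le _).trans ?_
      gcongr
      exact hφ.le
  have hlim : Tendsto (fun n : ℕ => (K' + K) * (n : ℝ≥0∞)⁻¹) atTop (𝓝 0) := by
    have := ENNReal.Tendsto.const_mul (a := K' + K) ENNReal.tendsto_inv_nat_nhds_zero
      (.inr (ENNReal.add_ne_top.2 ⟨hK', hK⟩))
    rwa [mul_zero] at this
  exact ge_of_tendsto' hlim fun n => hle _ (by simp)

theorem IsBoundedExtension.eq_of_ne_top {m : E → E → ℝ} (hm : IsModerate m)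
    {g : 𝓢(E, ℂ)} (hg : g ≠ 0) {p₁ q₁ p₂ q₂ : ℝ≥0∞} (hp₁ : 1 ≤ p₁) (hq₁ : 1 ≤ q₁) (hp₂ : 1 ≤ p₂)
    (hq₂ : 1 ≤ q₂) (hp₁' : p₁ ≠ ∞) (hq₁' : q₁ ≠ ∞)
    {L : 𝓢(E, ℂ) →ₗ[ℂ] 𝓢'(E, ℂ)} {K K' : ℝ≥0∞} (hK : K ≠ ∞) (hK' : K' ≠ ∞)
    {T T' : 𝓢'(E, ℂ) →ₗ.[ℂ] 𝓢'(E, ℂ)} (hT : IsBoundedExtension g p₁ q₁ p₂ q₂ m L K T)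
    (hT' : IsBoundedExtension g p₁ q₁ p₂ q₂ m L K' T') : T' = T := by
  have hdom : T'.domain = T.domain := SetLike.coe_injective (hT'.domain_eq.trans hT.domain_eq.symm)
  refine LinearPMap.ext hdom fun x hx hx' => ?_
  refine hT.eq_of_mem_schwartzClosure hm hg hp₂ hq₂ hK hK' hT' ⟨x, hx'⟩ ⟨x, hx⟩ rfl ?_
  refine mem_schwartzClosure hm hg hp₁ hq₁ hp₁' hq₁' ?_
  have : x ∈ (T.domain : Set 𝓢'(E, ℂ)) := hx'
  rw [hT.domain_eq] at this
  exact this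

end WeylMod

namespace WeylMod

open Filter Topology

variable {E : Type*} [NormedAddCommGroup E] [InnerProductSpace ℝ E] [FiniteDimensional ℝ E]
  [MeasurableSpace E] [BorelSpace E]

/-! ### Time-frequency shifts of the Wigner distribution -/

theorem exp_neg_eq_fourierChar (ξ t : E) :
    cexp (-(2 * Real.pi * I * (⟪ξ, t⟫_ℝ : ℝ))) = Real.fourierChar (-⟪ξ, t⟫_ℝ) := by
  rw [← inner_neg_left, ← exp_eq_fourierChar]
  congr 1
  simp

theorem conjS_crossWigner (f h : 𝓢(E, ℂ)) : conjS (crossWigner f h) = crossWigner h f := by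
  ext X
  rw [conjS_apply, crossWigner_apply, crossWigner_apply, ← integral_conj,
    ← integral_neg_eq_self]
  refine integral_congr_ae (.of_forall fun t => ?_)
  simp only [exp_neg_eq_fourierChar]
  simp only [map_mul, conj_conj, ← Circle.coe_inv_eq_conj,
    ← AddChar.map_neg_eq_inv, inner_neg_right, neg_neg, smul_neg, ← sub_eq_add_neg, sub_neg_eq_add]
  ring

/-- The midpoint `(z + w) / 2` as a point of the Euclidean phase space. -/
def midpointPhase (z w : E × E) : Phase E := WithLp.toLp 2 ((2⁻¹ : ℝ) • (z + w))

/-- The rotated difference of two points of phase space. -/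
def rotatePhase (z w : E × E) : Phase E := WithLp.toLp 2 ((z - w).2, -(z - w).1)

/-- Translating the integration variable by z.1 - w.1 centres both factors at the midpoint of z.1
and w.1. The rest is bookkeeping of characters: the part depending on t recentres the frequency, the
part depending on X is the modulation by the rotated difference, and a constant phase remains. -/
theorem crossWigner_tfShift (g γ : 𝓢(E, ℂ)) (z w : E × E) :
    crossWigner (tfShift z.1 z.2 g) (tfShift w.1 w.2 γ) =
      (Real.fourierChar ⟪(2⁻¹ : ℝ) • (z.2 + w.2), z.1 - w.1⟫_ℝ : ℂ) •
        tfShift (midpointPhase z w) (rotatePhase z w) (crossWigner g γ) := by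
  ext X
  rw [smul_apply, smul_eq_mul, tfShift_apply, exp_eq_fourierChar, crossWigner_apply,
    crossWigner_apply, ← mul_assoc, ← integral_const_mul, ← integral_add_right_eq_self _ (z.1 - w.1)]
  refine integral_congr_ae (.of_forall fun t => ?_)
  have hfst : (X - midpointPhase z w).fst = X.fst - (2⁻¹ : ℝ) • (z.1 + w.1) := rfl
  have hsnd : (X - midpointPhase z w).snd = X.snd - (2⁻¹ : ℝ) • (z.2 + w.2) := rfl
  have hin : ⟪rotatePhase z w, X⟫_ℝ = ⟪z.2 - w.2, X.fst⟫_ℝ + ⟪-(z.1 - w.1), X.snd⟫_ℝ := by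
    rw [WithLp.prod_inner_apply]
    rfl
  have e1 : X.fst + (2⁻¹ : ℝ) • (t + (z.1 - w.1)) - z.1 =
      X.fst - (2⁻¹ : ℝ) • (z.1 + w.1) + (2⁻¹ : ℝ) • t := by module
  have e2 : X.fst - (2⁻¹ : ℝ) • (t + (z.1 - w.1)) - w.1 =
      X.fst - (2⁻¹ : ℝ) • (z.1 + w.1) - (2⁻¹ : ℝ) • t := by module
  simp only [tfShift_apply, exp_eq_fourierChar, exp_neg_eq_fourierChar, map_mul, hfst, hsnd, hin,
    e1, e2, ← Circle.coe_inv_eq_conj, ← AddChar.map_neg_eq_inv]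
  have e3 : (Real.fourierChar ⟪z.2, X.fst + (2⁻¹ : ℝ) • (t + (z.1 - w.1))⟫_ℝ : ℂ) *
      Real.fourierChar (-⟪w.2, X.fst - (2⁻¹ : ℝ) • (t + (z.1 - w.1))⟫_ℝ) *
      Real.fourierChar (-⟪X.snd, t + (z.1 - w.1)⟫_ℝ) =
      (Real.fourierChar ⟪(2⁻¹ : ℝ) • (z.2 + w.2), z.1 - w.1⟫_ℝ : ℂ) *
      Real.fourierChar (⟪z.2 - w.2, X.fst⟫_ℝ + ⟪-(z.1 - w.1), X.snd⟫_ℝ) *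
      Real.fourierChar (-⟪X.snd - (2⁻¹ : ℝ) • (z.2 + w.2), t⟫_ℝ) := by
    simp only [← Circle.coe_mul, ← AddChar.map_add_eq_mul]
    congr 2
    simp only [inner_add_right, inner_sub_right, inner_sub_left, inner_add_left, inner_smul_left,
      inner_smul_right, inner_neg_left, RCLike.conj_to_real, real_inner_comm]
    rw [real_inner_comm X.snd z.1, real_inner_comm X.snd w.1]
    ring
  linear_combination (g (X.fst - (2⁻¹ : ℝ) • (z.1 + w.1) + (2⁻¹ : ℝ) • t) *
    conj (γ (X.fst - (2⁻¹ : ℝ) • (z.1 + w.1) - (2⁻¹ : ℝ) • t))) * e3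

/-- The integral kernel of the Weyl operator with respect to time-frequency shifts. -/
def weylKernel (g : 𝓢(E, ℂ)) (σ : 𝓢'(Phase E, ℂ)) (z w : E × E) : ℂ :=
  stft g (weylOperator σ (tfShift w.1 w.2 g)) z.1 z.2

/-- By the weak definition of the Weyl operator its matrix entries pair σ with Wigner distributions
of shifted windows. Covariance makes those shifts of a single window, so the kernel depends on σ
only through one short-time Fourier transform. -/
theorem weylKernel_eq (g : 𝓢(E, ℂ)) (σ : 𝓢'(Phase E, ℂ)) (z w : E × E) :
    weylKernel g σ z w =
      conj (Real.fourierChar ⟪(2⁻¹ : ℝ) • (z.2 + w.2), z.1 - w.1⟫_ℝ : ℂ) *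
        stft (crossWigner g g) σ (midpointPhase z w) (rotatePhase z w) := by
  rw [weylKernel, stft, weylOperator_pairing, crossWigner_tfShift, conjS_smul, map_smul]
  rfl

theorem continuous_stft_comp {X : Type*} [TopologicalSpace X] (g : 𝓢(E, ℂ)) (f : 𝓢'(E, ℂ))
    {a b : X → E} (ha : Continuous a) (hb : Continuous b) :
    Continuous fun u => stft g f (a u) (b u) := by
  have h := (continuous_stft g f).comp (ha.prodMk hb)
  exact h

theorem continuous_weylKernel (g : 𝓢(E, ℂ)) (σ : 𝓢'(Phase E, ℂ)) :
    Continuous fun u : (E × E) × (E × E) => weylKernel g σ u.1 u.2 := by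
  simp_rw [weylKernel_eq]
  have h1' : Continuous fun u : (E × E) × (E × E) => (2⁻¹ : ℝ) • (u.1 + u.2) := by fun_prop
  have h2' : Continuous fun u : (E × E) × (E × E) => ((u.1 - u.2).2, -(u.1 - u.2).1) := by fun_prop
  have h1 : Continuous fun u : (E × E) × (E × E) => midpointPhase u.1 u.2 :=
    (WithLp.prod_continuous_toLp 2 E E).comp h1'
  have h2 : Continuous fun u : (E × E) × (E × E) => rotatePhase u.1 u.2 :=
    (WithLp.prod_continuous_toLp 2 E E).comp h2'
  have h3 := continuous_stft_comp (crossWigner g g) σ h1 h2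
  refine Continuous.mul ?_ h3
  refine continuous_conj.comp (continuous_subtype_val.comp (Real.continuous_fourierChar.comp ?_))
  fun_prop

theorem enorm_weylKernel (g : 𝓢(E, ℂ)) (σ : 𝓢'(Phase E, ℂ)) (z w : E × E) :
    ‖weylKernel g σ z w‖ₑ =
      ‖stft (crossWigner g g) σ (midpointPhase z w) (rotatePhase z w)‖ₑ := by
  rw [weylKernel_eq, enorm_eq_iff_norm_eq, norm_mul, RCLike.norm_conj, Circle.norm_coe, one_mul]

theorem crossWigner_eq_fourier (f₁ f₂ : 𝓢(E, ℂ)) (z : Phase E) :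
    crossWigner f₁ f₂ z = 𝓕 (slice (SchwartzMap.compCLMOfContinuousLinearEquiv ℂ
      midpointCoord (tensor (conjS f₂) f₁)) z.fst) z.snd := rfl

/-- At position t₀ the Wigner distribution is the Fourier transform of t ↦ g(t₀ + t/2) conj g(t₀ -
t/2), whose value at t = 0 is |g(t₀)|². This permits W(g, g) as a window for symbols. -/
theorem crossWigner_self_ne_zero {g : 𝓢(E, ℂ)} (hg : g ≠ 0) : crossWigner g g ≠ 0 := by
  intro h
  obtain ⟨t₀, ht₀⟩ : ∃ t, g t ≠ 0 := by
    by_contra! h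
    exact hg (SchwartzMap.ext h)
  have h1 : 𝓕 (slice (SchwartzMap.compCLMOfContinuousLinearEquiv ℂ midpointCoord
      (tensor (conjS g) g)) t₀) = 0 := by
    ext ξ
    have e := crossWigner_eq_fourier g g (WithLp.toLp 2 (t₀, ξ))
    rw [h] at e
    exact e.symm
  have h2 := congrArg (fun F => 𝓕⁻ F) h1
  simp only [FourierTransform.fourierInv_fourier_eq, FourierTransform.fourierInv_zero] at h2
  have h3 := congrArg (fun F : 𝓢(E, ℂ) => F 0) h2
  have h4 : g (t₀ + (2⁻¹ : ℝ) • (0 : E)) * conj (g (t₀ - (2⁻¹ : ℝ) • (0 : E))) = 0 := h3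
  simp [ht₀] at h4

/-- The energy of a window is recovered by two inversion formulas. -/
theorem energy_sq_mul_weylOperator (g : 𝓢(E, ℂ)) (σ : 𝓢'(Phase E, ℂ)) (φ h : 𝓢(E, ℂ)) :
    ∫ w : E × E, ∫ z : E × E, weylKernel g σ z w * stftS g φ w * conj (stftS g h z) =
      energy g ^ 2 * weylOperator σ φ (conjS h) := by
  -- The inversion formula is used in z for the distribution L_σ π(w)g and then in w for the
  -- functional φ ↦ ⟨L_σ φ, h⟩. Continuity of the latter is not visible from the definition, where φ
  -- is the conjugate linear entry; conjugate symmetry of W moves φ to the first.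
  let L : 𝓢(E, ℂ) →L[ℂ] ℂ :=
    { toFun := fun φ => weylOperator σ φ (conjS h)
      map_add' := fun φ ψ => by rw [map_add]; rfl
      map_smul' := fun c φ => by rw [map_smul]; rfl
      cont := by
        have e : (fun φ => weylOperator σ φ (conjS h)) = fun φ => σ (crossWigner φ h) := by
          ext φ
          rw [weylOperator_pairing, conjS_crossWigner]
        change Continuous fun φ => weylOperator σ φ (conjS h)
        rw [e]
        exact σ.continuous.comp (crossWignerCLM h).continuous }
  have h1 := integral_stftS_mul g φ L
  have h2 : ∀ w : E × E, ∫ z : E × E, weylKernel g σ z w * stftS g φ w * conj (stftS g h z) =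
      energy g * (stftS g φ w * L (tfShift w.1 w.2 g)) := by
    intro w
    have := integral_stft_mul g h (weylOperator σ (tfShift w.1 w.2 g))
    rw [mul_left_comm]
    change _ = stftS g φ w * (energy g * weylOperator σ (tfShift w.1 w.2 g) (conjS h))
    rw [← this, ← integral_const_mul]
    refine integral_congr_ae (.of_forall fun z => ?_)
    simp only [weylKernel]
    ring
  simp_rw [h2]
  rw [integral_const_mul, h1]
  change _ = energy g ^ 2 * L φ
  ring

end WeylMod

namespace WeylMod

open Filter Topology

variable {E : Type*} [NormedAddCommGroup E] [InnerProductSpace ℝ E] [FiniteDimensional ℝ E]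
  [MeasurableSpace E] [BorelSpace E]

/-! ### Boundedness of Weyl operators -/

theorem inv_anti_of_add_eq_one {a b c d : ℝ≥0∞} (h : a + b = 1) (h' : c + d = 1) (hac : a ≤ c) :
    d ≤ b := by
  have hc : c ≠ ∞ := ne_top_of_le_ne_top ENNReal.one_ne_top (h' ▸ le_self_add)
  refine (ENNReal.add_le_add_iff_left hc).1 ?_
  rw [h', ← h]
  gcongr

/-- The conjugate exponent is antitone. -/
theorem conj_le_of_le {a b c d : ℝ≥0∞} [a.HolderConjugate b] [c.HolderConjugate d] (h : a ≤ c) :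
    d ≤ b := by
  rw [← ENNReal.inv_le_inv]
  refine inv_anti_of_add_eq_one (ENNReal.HolderConjugate.inv_add_inv_eq_one c d)
    (ENNReal.HolderConjugate.inv_add_inv_eq_one a b) ?_
  exact ENNReal.inv_le_inv.2 h

/-- If p₁ ≤ P, the pair (P, Q) works. Otherwise keep a = p₁ and let b take what is left of 1/P +
1/Q: then b ≥ P because p₁ ≤ Q, and b ≥ r is the hypothesis on sums. -/
theorem exists_intermediate_exponents {p₁ r P Q : ℝ≥0∞} (hPQ : P ≤ Q) (hP : 1 ≤ P)
    (h₁ : p₁ ≤ Q) (h₂ : r ≤ Q) (h : P⁻¹ + Q⁻¹ ≤ p₁⁻¹ + r⁻¹) :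
    ∃ a b : ℝ≥0∞, P ≤ a ∧ P ≤ b ∧ b⁻¹ + a⁻¹ = P⁻¹ + Q⁻¹ ∧ p₁ ≤ a ∧ r ≤ b := by
  have hP' : P⁻¹ ≤ 1 := ENNReal.inv_le_one.2 hP
  have hPt : P⁻¹ ≠ ∞ := ne_top_of_le_ne_top ENNReal.one_ne_top hP'
  have hQP : Q⁻¹ ≤ P⁻¹ := ENNReal.inv_le_inv.2 hPQ
  have hX : Q⁻¹ ≤ p₁⁻¹ := ENNReal.inv_le_inv.2 h₁
  have hY : Q⁻¹ ≤ r⁻¹ := ENNReal.inv_le_inv.2 h₂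
  rcases le_total P⁻¹ p₁⁻¹ with hc | hc
  · refine ⟨P, Q, le_rfl, hPQ, add_comm _ _, ENNReal.inv_le_inv.1 hc, h₂⟩
  · have hXt : p₁⁻¹ ≠ ∞ := ne_top_of_le_ne_top hPt hc
    have hsub : P⁻¹ + Q⁻¹ - p₁⁻¹ + p₁⁻¹ = P⁻¹ + Q⁻¹ :=
      tsub_add_cancel_of_le (hc.trans le_self_add)
    refine ⟨p₁, (P⁻¹ + Q⁻¹ - p₁⁻¹)⁻¹, ENNReal.inv_le_inv.1 hc, ?_, by rw [inv_inv, hsub], le_rfl, ?_⟩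
    · rw [← ENNReal.inv_le_inv, inv_inv]
      exact tsub_le_iff_right.2 (by gcongr)
    · rw [← ENNReal.inv_le_inv, inv_inv]
      exact tsub_le_iff_right.2 (by rwa [add_comm r⁻¹])

theorem measurable_comp_toLp {U : Phase E → Phase E → ℝ≥0∞}
    (hU : Measurable (Function.uncurry U)) : Measurable (Function.uncurry
      fun u v : E × E => U (WithLp.toLp 2 u) (WithLp.toLp 2 v)) := by
  have ht : Measurable (WithLp.toLp 2 : E × E → Phase E) :=
    (WithLp.volume_preserving_toLp E E).measurable
  have h1 : Measurable fun u : (E × E) × (E × E) =>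
      ((WithLp.toLp 2 u.1 : Phase E), (WithLp.toLp 2 u.2 : Phase E)) :=
    (ht.comp measurable_fst).prodMk (ht.comp measurable_snd)
  have h2 := hU.comp h1
  exact h2

/-- Phase space carries the Euclidean norm and the product E × E the maximum norm; the
identification preserves volume, so the mixed norms do not see the difference. -/
theorem mixE_comp_toLp {p q : ℝ≥0∞} {U : Phase E → Phase E → ℝ≥0∞}
    (hU : Measurable (Function.uncurry U)) :
    mixE p q (fun u v : E × E => U (WithLp.toLp 2 u) (WithLp.toLp 2 v)) = mixE p q U := by
  unfold mixE
  have h1 : ∀ v : E × E, eLpNorm (fun u : E × E => U (WithLp.toLp 2 u) (WithLp.toLp 2 v)) p volume =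
      eLpNorm (fun u => U u (WithLp.toLp 2 v)) p volume := fun v =>
    eLpNorm_comp_measurePreserving (g := fun u => U u (WithLp.toLp 2 v))
      (hU.comp (measurable_id.prodMk measurable_const)).aestronglyMeasurable
      (WithLp.volume_preserving_toLp E E)
  simp_rw [h1]
  exact eLpNorm_comp_measurePreserving (g := fun v => eLpNorm (fun u => U u v) p volume)
    (measurable_eLpNorm_slice hU p).aestronglyMeasurable (WithLp.volume_preserving_toLp E E)

theorem norm_rotatePhase (z w : E × E) :
    ‖rotatePhase z w‖ = ‖(WithLp.toLp 2 (z.1, z.2) - WithLp.toLp 2 (w.1, w.2) : Phase E)‖ := by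
  rw [WithLp.prod_norm_eq_of_L2, WithLp.prod_norm_eq_of_L2]
  change √(‖(z - w).2‖ ^ 2 + ‖-(z - w).1‖ ^ 2) = √(‖z.1 - w.1‖ ^ 2 + ‖z.2 - w.2‖ ^ 2)
  rw [norm_neg, add_comm]
  rfl

/-- Peetre's inequality, together with the fact that the rotated difference has the same Euclidean
norm as z - w. This is why the symbol needs a weight in its frequency variable only. -/
theorem vWeight_le_mul {s : ℝ} (hs : 0 ≤ s) (z w : E × E) :
    vWeight s z.1 z.2 ≤ 2 ^ (s / 2) * symbolWeight s (midpointPhase z w) (rotatePhase z w) *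
      vWeight s w.1 w.2 := by
  have h : symbolWeight s (midpointPhase z w) (rotatePhase z w) =
      bracket s (WithLp.toLp 2 (z.1, z.2) - WithLp.toLp 2 (w.1, w.2) : Phase E) := by
    rw [symbolWeight, bracket, norm_rotatePhase, bracket]
  rw [h]
  exact bracket_le_mul hs _ _

theorem one_le_vWeight {s : ℝ} (hs : 0 ≤ s) (x ξ : E) : 1 ≤ vWeight s x ξ :=
  Real.one_le_rpow (by nlinarith [sq_nonneg ‖(WithLp.toLp 2 (x, ξ) : Phase E)‖]) (by positivity)

section Estimate

variable {s : ℝ} {g : 𝓢(E, ℂ)} {p q P Q a₁ a₂ b₁ b₂ : ℝ≥0∞}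

theorem measurable_lintegral_weylKernel (g : 𝓢(E, ℂ)) (σ : 𝓢'(Phase E, ℂ)) (f : 𝓢'(E, ℂ)) :
    Measurable fun z : E × E => ∫⁻ w : E × E, ‖weylKernel g σ z w‖ₑ * ‖stft g f w.1 w.2‖ₑ := by
  have h1 := (continuous_weylKernel g σ).enorm.measurable
  have h2 : Measurable fun w : E × E => ‖stft g f w.1 w.2‖ₑ := measurable_enorm_stft g f
  exact Measurable.lintegral_prod_right' (h1.mul (h2.comp measurable_snd))

/-- The weights are distributed over symbol and argument pointwise, and the midpoint form estimate
is then applied to the weighted short-time Fourier transforms. Stated against an arbitrary A, it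
serves both for the norm bound by duality and for integrability. -/
theorem lintegral_weylKernel_le [p.HolderConjugate P] [q.HolderConjugate Q] (hs : 0 ≤ s)
    (hPQ : P ≤ Q) (ha₁ : P ≤ a₁) (ha₂ : P ≤ a₂) (hb₁ : P ≤ b₁) (hb₂ : P ≤ b₂)
    (h₁ : b₁⁻¹ + a₁⁻¹ = P⁻¹ + Q⁻¹) (h₂ : b₂⁻¹ + a₂⁻¹ = P⁻¹ + Q⁻¹) (σ : 𝓢'(Phase E, ℂ))
    (f : 𝓢'(E, ℂ)) {A : E × E → ℝ≥0∞} (hA : Measurable A) :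
    ∫⁻ z : E × E, ENNReal.ofReal (vWeight s z.1 z.2) *
        (∫⁻ w : E × E, ‖weylKernel g σ z w‖ₑ * ‖stft g f w.1 w.2‖ₑ) * A z ≤
      ENNReal.ofReal (2 ^ (s / 2)) *
        modulationNorm (crossWigner g g) p q (symbolWeight s) σ *
        modulationNorm g a₁ a₂ (vWeight s) f * mixE b₁ b₂ (fun x ξ => A (x, ξ)) := by
  have hmv := isModerate_vWeight (E := E) hs
  have hms := isModerate_symbolWeight (E := E) hs
  set U : Phase E → Phase E → ℝ≥0∞ := fun u v =>
    ENNReal.ofReal (symbolWeight s u v) * ‖stft (crossWigner g g) σ u v‖ₑ with hU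
  have hUm : Measurable (Function.uncurry U) := hms.measurable_mul (measurable_enorm_stft _ σ)
  set B : E × E → ℝ≥0∞ := fun w => ENNReal.ofReal (vWeight s w.1 w.2) * ‖stft g f w.1 w.2‖ₑ with hB
  have hBm : Measurable B := hmv.measurable_mul (measurable_enorm_stft g f)
  set S : E × E → E × E → ℝ≥0∞ := fun u v => U (WithLp.toLp 2 u) (WithLp.toLp 2 v) with hS
  have hSm : Measurable (Function.uncurry S) := measurable_comp_toLp hUm
  have key := lintegral_midpoint_form_le (p := p) (q := q) hPQ ha₁ ha₂ hb₁ hb₂ h₁ h₂ hA hBm hSm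
  rw [hS, mixE_comp_toLp hUm, ← modulationNorm_eq hms,
    show mixE a₁ a₂ (fun x ξ => B (x, ξ)) = modulationNorm g a₁ a₂ (vWeight s) f from
      (modulationNorm_eq hmv g a₁ a₂ f).symm] at key
  have hK : ∀ z : E × E, Measurable fun w : E × E => ‖weylKernel g σ z w‖ₑ := fun z =>
    ((continuous_weylKernel g σ).comp (Continuous.prodMk_right z)).enorm.measurable
  have hV : Measurable fun w : E × E => ‖stft g f w.1 w.2‖ₑ := measurable_enorm_stft g f
  have hpt : ∀ z : E × E, ENNReal.ofReal (vWeight s z.1 z.2) *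
        (∫⁻ w : E × E, ‖weylKernel g σ z w‖ₑ * ‖stft g f w.1 w.2‖ₑ) * A z ≤
      ENNReal.ofReal (2 ^ (s / 2)) * ∫⁻ w : E × E,
        S ((2⁻¹ : ℝ) • (z + w)) ((z - w).2, -(z - w).1) * A z * B w := by
    intro z
    have hm1 : Measurable fun w : E × E => ‖weylKernel g σ z w‖ₑ * ‖stft g f w.1 w.2‖ₑ :=
      (hK z).mul hV
    have hm2 : Measurable fun w : E × E => ENNReal.ofReal (vWeight s z.1 z.2) *
        (‖weylKernel g σ z w‖ₑ * ‖stft g f w.1 w.2‖ₑ) := hm1.const_mul _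
    rw [← lintegral_const_mul _ hm1, ← lintegral_mul_const _ hm2,
      ← lintegral_const_mul' _ _ ENNReal.ofReal_ne_top]
    refine lintegral_mono fun w => ?_
    have hw : ENNReal.ofReal (vWeight s z.1 z.2) ≤ ENNReal.ofReal (2 ^ (s / 2)) *
        ENNReal.ofReal (symbolWeight s (midpointPhase z w) (rotatePhase z w)) *
        ENNReal.ofReal (vWeight s w.1 w.2) := by
      rw [← ENNReal.ofReal_mul (by positivity),
        ← ENNReal.ofReal_mul (mul_nonneg (by positivity) (hms.pos (midpointPhase z w) _).le)]
      exact ENNReal.ofReal_le_ofReal (vWeight_le_mul hs z w)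
    rw [enorm_weylKernel]
    calc _ ≤ ENNReal.ofReal (2 ^ (s / 2)) *
          ENNReal.ofReal (symbolWeight s (midpointPhase z w) (rotatePhase z w)) *
          ENNReal.ofReal (vWeight s w.1 w.2) *
          (‖stft (crossWigner g g) σ (midpointPhase z w) (rotatePhase z w)‖ₑ *
            ‖stft g f w.1 w.2‖ₑ) * A z := by gcongr
      _ = ENNReal.ofReal (2 ^ (s / 2)) *
          (ENNReal.ofReal (symbolWeight s (midpointPhase z w) (rotatePhase z w)) *
          ‖stft (crossWigner g g) σ (midpointPhase z w) (rotatePhase z w)‖ₑ * A z *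
          (ENNReal.ofReal (vWeight s w.1 w.2) * ‖stft g f w.1 w.2‖ₑ)) := by ring
      _ = _ := rfl
  refine (lintegral_mono hpt).trans ?_
  rw [lintegral_const_mul' _ _ ENNReal.ofReal_ne_top, mul_assoc, mul_assoc]
  gcongr
  refine key.trans_eq ?_
  ring

theorem mixE_weylKernel_le [p.HolderConjugate P] [q.HolderConjugate Q] (hs : 0 ≤ s)
    (hPQ : P ≤ Q) (ha₁ : P ≤ a₁) (ha₂ : P ≤ a₂) (hb₁ : P ≤ b₁) (hb₂ : P ≤ b₂)
    (h₁ : b₁⁻¹ + a₁⁻¹ = P⁻¹ + Q⁻¹) (h₂ : b₂⁻¹ + a₂⁻¹ = P⁻¹ + Q⁻¹) (σ : 𝓢'(Phase E, ℂ))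
    (f : 𝓢'(E, ℂ)) {b₁' b₂' : ℝ≥0∞} [b₁'.HolderConjugate b₁] [b₂'.HolderConjugate b₂] :
    mixE b₁' b₂' (fun x ξ => ENNReal.ofReal (vWeight s x ξ) *
        ∫⁻ w : E × E, ‖weylKernel g σ (x, ξ) w‖ₑ * ‖stft g f w.1 w.2‖ₑ) ≤
      ENNReal.ofReal (2 ^ (s / 2)) *
        modulationNorm (crossWigner g g) p q (symbolWeight s) σ *
        modulationNorm g a₁ a₂ (vWeight s) f := by
  have hmv := isModerate_vWeight (E := E) hs
  have hm : Measurable (Function.uncurry fun x ξ : E => ENNReal.ofReal (vWeight s x ξ) *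
        ∫⁻ w : E × E, ‖weylKernel g σ (x, ξ) w‖ₑ * ‖stft g f w.1 w.2‖ₑ) :=
    hmv.measurable_mul (measurable_lintegral_weylKernel g σ f)
  refine mixE_le_of_dual (p' := b₁) (q' := b₂) hm fun G hG => ?_
  have hm' : Measurable fun z : E × E => ENNReal.ofReal (vWeight s z.1 z.2) *
      (∫⁻ w : E × E, ‖weylKernel g σ z w‖ₑ * ‖stft g f w.1 w.2‖ₑ) * G z.1 z.2 := hm.mul hG
  have key := lintegral_weylKernel_le (g := g) (p := p) (q := q) hs hPQ ha₁ ha₂ hb₁ hb₂ h₁ h₂ σ f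
    (A := fun z => G z.1 z.2) hG
  exact (lintegral_prod_symm _ hm'.aemeasurable).symm.trans_le key

/-- The bilinear estimate with A a negative power of 1 + ‖z‖; the weight, being at least 1, is
dropped. Integrability holds jointly in z and w with polynomial damping in z alone, which suffices
to define a tempered distribution. -/
theorem integrable_weylKernel [p.HolderConjugate P] [q.HolderConjugate Q] (hs : 0 ≤ s)
    (hPQ : P ≤ Q) (hP : 1 ≤ P) (ha₁ : P ≤ a₁) (ha₂ : P ≤ a₂) (hb₁ : P ≤ b₁) (hb₂ : P ≤ b₂)
    (h₁ : b₁⁻¹ + a₁⁻¹ = P⁻¹ + Q⁻¹) (h₂ : b₂⁻¹ + a₂⁻¹ = P⁻¹ + Q⁻¹) (σ : 𝓢'(Phase E, ℂ))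
    (f : 𝓢'(E, ℂ)) (hσ : modulationNorm (crossWigner g g) p q (symbolWeight s) σ < ∞)
    (hf : modulationNorm g a₁ a₂ (vWeight s) f < ∞) :
    Integrable fun u : (E × E) × (E × E) => ‖weylKernel g σ u.1 u.2 * stft g f u.2.1 u.2.2‖ *
      ((1 + ‖u.1‖) ^ (2 * (Module.finrank ℝ E + 1)))⁻¹ := by
  set M := 2 * (Module.finrank ℝ E + 1) with hM
  have hc : Continuous fun u : (E × E) × (E × E) =>
      weylKernel g σ u.1 u.2 * stft g f u.2.1 u.2.2 :=
    (continuous_weylKernel g σ).mul ((continuous_stft g f).comp continuous_snd)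
  have hw : Continuous fun z : E × E => ((1 + ‖z‖) ^ M)⁻¹ :=
    Continuous.inv₀ (by fun_prop) fun z => by positivity
  have hc2 := hc.norm.mul (hw.comp (continuous_fst (X := E × E) (Y := E × E)))
  refine ⟨hc2.aestronglyMeasurable, ?_⟩
  have hm : Measurable fun u : (E × E) × (E × E) =>
      ‖weylKernel g σ u.1 u.2‖ₑ * ‖stft g f u.2.1 u.2.2‖ₑ *
        ENNReal.ofReal (((1 + ‖u.1‖) ^ M)⁻¹) :=
    ((continuous_weylKernel g σ).enorm.measurable.mul
      ((continuous_stft g f).enorm.measurable.comp measurable_snd)).mul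
      (ENNReal.measurable_ofReal.comp (hw.measurable.comp measurable_fst))
  have e : ∀ u : (E × E) × (E × E), ‖‖weylKernel g σ u.1 u.2 * stft g f u.2.1 u.2.2‖ *
      ((1 + ‖u.1‖) ^ M)⁻¹‖ₑ = ‖weylKernel g σ u.1 u.2‖ₑ * ‖stft g f u.2.1 u.2.2‖ₑ *
        ENNReal.ofReal (((1 + ‖u.1‖) ^ M)⁻¹) := by
    intro u
    rw [enorm_mul, enorm_norm, enorm_mul, Real.enorm_of_nonneg (by positivity)]
  unfold HasFiniteIntegral
  simp_rw [e]
  rw [Measure.volume_eq_prod, lintegral_prod _ hm.aemeasurable]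
  have key := lintegral_weylKernel_le (g := g) (p := p) (q := q) hs hPQ ha₁ ha₂ hb₁ hb₂ h₁ h₂ σ f
    (A := fun z => ENNReal.ofReal (((1 + ‖z‖) ^ M)⁻¹))
    (ENNReal.measurable_ofReal.comp hw.measurable)
  refine lt_of_le_of_lt ?_ (key.trans_lt ?_)
  · refine lintegral_mono fun z => ?_
    dsimp only
    rw [lintegral_mul_const' _ _ ENNReal.ofReal_ne_top]
    gcongr
    refine le_mul_of_one_le_left zero_le ?_
    rw [← ENNReal.ofReal_one]
    exact ENNReal.ofReal_le_ofReal (one_le_vWeight hs _ _)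
  · exact ENNReal.mul_lt_top (ENNReal.mul_lt_top (ENNReal.mul_lt_top ENNReal.ofReal_lt_top hσ) hf)
      (mixE_one_add_norm_lt_top (hP.trans hb₁) (hP.trans hb₂))

end Estimate

end WeylMod

namespace WeylMod

open Filter Topology

variable {E : Type*} [NormedAddCommGroup E] [InnerProductSpace ℝ E] [FiniteDimensional ℝ E]
  [MeasurableSpace E] [BorelSpace E]

/-! ### The extension of a Weyl operator to modulation spaces -/

section Superposition

variable {M : ℕ} {H : (E × E) × (E × E) → ℂ}

theorem norm_mul_schwartz_le (F : 𝓢(E × E, ℂ)) (M : ℕ) (u : (E × E) × (E × E)) :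
    ‖H u * F u.1‖ ≤ 2 ^ M * (Finset.Iic (M, 0)).sup (schwartzSeminormFamily ℂ (E × E) ℂ) F *
      (‖H u‖ * ((1 + ‖u.1‖) ^ M)⁻¹) := by
  have h := one_add_pow_mul_le F M 0 u.1
  rw [norm_iteratedFDeriv_zero] at h
  have hpos : 0 < (1 + ‖u.1‖) ^ M := by positivity
  rw [norm_mul]
  calc ‖H u‖ * ‖F u.1‖ = ((1 + ‖u.1‖) ^ M * ‖F u.1‖) * (‖H u‖ * ((1 + ‖u.1‖) ^ M)⁻¹) := by
        field_simp
    _ ≤ _ := by gcongr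

theorem integrable_mul_schwartz (hH : AEStronglyMeasurable H)
    (hint : Integrable fun u => ‖H u‖ * ((1 + ‖u.1‖) ^ M)⁻¹) (F : 𝓢(E × E, ℂ)) :
    Integrable fun u => H u * F u.1 :=
  (hint.const_mul (2 ^ M * (Finset.Iic (M, 0)).sup (schwartzSeminormFamily ℂ (E × E) ℂ) F)).mono'
    (hH.mul (F.continuous.comp continuous_fst).aestronglyMeasurable)
    (.of_forall fun u => norm_mul_schwartz_le F M u)

/-- Superpositions of time-frequency shifts with polynomially bounded coefficients are tempered
distributions. -/
theorem exists_superposition (g : 𝓢(E, ℂ)) (hH : AEStronglyMeasurable H)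
    (hint : Integrable fun u => ‖H u‖ * ((1 + ‖u.1‖) ^ M)⁻¹) :
    ∃ f : 𝓢'(E, ℂ), ∀ φ, f φ = ∫ u, H u * conj (stftS g (conjS φ) u.1) := by
  have hH' : AEStronglyMeasurable fun u => conj (H u) :=
    continuous_conj.comp_aestronglyMeasurable hH
  have hint' : Integrable fun u => ‖conj (H u)‖ * ((1 + ‖u.1‖) ^ M)⁻¹ := by simpa using hint
  let L : 𝓢(E × E, ℂ) →L[ℂ] ℂ := SchwartzMap.mkCLMtoNormedSpace (σ := RingHom.id ℂ)
    (fun F => ∫ u, conj (H u) * F u.1)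
    (fun F G => by
      rw [← integral_add (integrable_mul_schwartz hH' hint' F) (integrable_mul_schwartz hH' hint' G)]
      simp only [add_apply, mul_add])
    (fun c F => by
      rw [RingHom.id_apply, smul_eq_mul, ← integral_const_mul]
      refine integral_congr_ae (.of_forall fun u => ?_)
      simp only [smul_apply, smul_eq_mul]
      ring)
    ⟨Finset.Iic (M, 0), 2 ^ M * ∫ u, ‖conj (H u)‖ * ((1 + ‖u.1‖) ^ M)⁻¹,
      mul_nonneg (by positivity) (integral_nonneg fun u => by positivity), fun F => by
      refine (norm_integral_le_of_norm_le (hint'.const_mul _)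
        (.of_forall fun u => norm_mul_schwartz_le (H := fun u => conj (H u)) F M u)).trans_eq ?_
      rw [integral_const_mul]
      ring⟩
  have key : ∀ φ, ∫ u, H u * conj (stftS g (conjS φ) u.1) = conj (L (stftS g (conjS φ))) := by
    intro φ
    change _ = conj (∫ u, conj (H u) * stftS g (conjS φ) u.1)
    rw [← integral_conj]
    simp
  refine ⟨ContinuousLinearMap.toPointwiseConvergenceCLM _ _ _ _
    { toFun := fun φ => conj (L (stftS g (conjS φ)))
      map_add' := fun φ ψ => by simp
      map_smul' := fun c φ => by simp [conjS_smul]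
      cont := continuous_conj.comp (L.continuous.comp
        ((stftS g).continuous.comp conjS.continuous)) }, fun φ => (key φ).symm⟩

end Superposition

/-- The operator is given by the double inversion formula instead of by density, so it is defined
for infinite exponents too. On Schwartz functions it is L_σ by `energy_sq_mul_weylOperator`. Passing
from p₁, q₁ up to a₁, a₂ uses the inclusion of modulation spaces; passing from b₁', b₂' up to p₂, q₂
uses the convolution with V_g g that the superposition of shifts produces. -/
theorem exists_weylExtension {s : ℝ} (hs : 0 ≤ s) {g : 𝓢(E, ℂ)} (hg : g ≠ 0)
    {p q P Q a₁ a₂ b₁ b₂ b₁' b₂' p₁ q₁ p₂ q₂ : ℝ≥0∞} [p.HolderConjugate P] [q.HolderConjugate Q]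
    [b₁'.HolderConjugate b₁] [b₂'.HolderConjugate b₂]
    (hPQ : P ≤ Q) (ha₁ : P ≤ a₁) (ha₂ : P ≤ a₂) (hb₁ : P ≤ b₁) (hb₂ : P ≤ b₂)
    (h₁ : b₁⁻¹ + a₁⁻¹ = P⁻¹ + Q⁻¹) (h₂ : b₂⁻¹ + a₂⁻¹ = P⁻¹ + Q⁻¹)
    (hp₁ : 1 ≤ p₁) (hq₁ : 1 ≤ q₁) (hpa : p₁ ≤ a₁) (hqa : q₁ ≤ a₂) (hpb : b₁' ≤ p₂)
    (hqb : b₂' ≤ q₂) :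
    ∃ C : ℝ≥0, ∀ σ : 𝓢'(Phase E, ℂ),
      modulationNorm (crossWigner g g) p q (symbolWeight s) σ < ∞ →
      ∃ T, IsBoundedExtension g p₁ q₁ p₂ q₂ (vWeight s) (weylOperator σ)
        (C * modulationNorm (crossWigner g g) p q (symbolWeight s) σ) T := by
  have hm := isModerate_vWeight (E := E) hs
  have hP : 1 ≤ P := ENNReal.HolderConjugate.one_le P p
  obtain ⟨C₁, hC₁⟩ := exists_modulationNorm_le hm hg g hp₁ hpa hq₁ hqa
  obtain ⟨C₂, hC₂⟩ := exists_mixE_weight_le hm (ENNReal.HolderConjugate.one_le b₁' b₁) hpb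
    (ENNReal.HolderConjugate.one_le b₂' b₂) hqb (stftS g g)
  have he : (energy g : ℂ) ^ 2 ≠ 0 := by
    have : (energy g : ℂ) ≠ 0 := by exact_mod_cast (energy_pos hg).ne'
    exact pow_ne_zero 2 this
  set c : ℂ := ((energy g : ℂ) ^ 2)⁻¹ with hc
  refine ⟨‖c‖₊ * C₂ * (2 ^ (s / 2) : ℝ).toNNReal * C₁, fun σ hσ => ?_⟩
  set N := modulationNorm (crossWigner g g) p q (symbolWeight s) σ with hN
  set M := 2 * (Module.finrank ℝ E + 1) with hM
  set D := modulationSubmodule g hp₁ hq₁ hm with hD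
  have hfin : ∀ f : D, modulationNorm g a₁ a₂ (vWeight s) f < ∞ := fun f =>
    (hC₁ f).trans_lt (ENNReal.mul_lt_top ENNReal.coe_lt_top f.2)
  set H : 𝓢'(E, ℂ) → (E × E) × (E × E) → ℂ := fun f u =>
    weylKernel g σ u.1 u.2 * stft g f u.2.1 u.2.2 with hH
  have hHm : ∀ f, AEStronglyMeasurable (H f) := fun f =>
    ((continuous_weylKernel g σ).mul
      ((continuous_stft g f).comp continuous_snd)).aestronglyMeasurable
  have hHi : ∀ f : D, Integrable fun u => ‖H f u‖ * ((1 + ‖u.1‖) ^ M)⁻¹ := fun f =>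
    integrable_weylKernel hs hPQ hP ha₁ ha₂ hb₁ hb₂ h₁ h₂ σ f hσ (hfin f)
  have hHF : ∀ (f : D) (F : 𝓢(E × E, ℂ)), Integrable fun u => H f u * conj (F u.1) :=
    fun f F => integrable_mul_schwartz (hHm f) (hHi f) (conjS F)
  choose T hT using fun f : D => exists_superposition g (hHm f) (hHi f)
  let T₀ : 𝓢'(E, ℂ) →ₗ.[ℂ] 𝓢'(E, ℂ) :=
    { domain := D
      toFun :=
        { toFun := fun f => c • T f
          map_add' := fun f h => by
            ext φ
            change c * T (f + h) φ = c * T f φ + c * T h φ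
            rw [hT, hT, hT, ← mul_add, ← integral_add (hHF f _) (hHF h _)]
            congr 1
            refine integral_congr_ae (.of_forall fun u => ?_)
            simp only [hH, Submodule.coe_add, stft_add]
            ring
          map_smul' := fun a f => by
            ext φ
            change c * T (a • f) φ = a * (c * T f φ)
            rw [hT, hT, mul_left_comm a, ← integral_const_mul a]
            congr 1
            refine integral_congr_ae (.of_forall fun u => ?_)
            simp only [hH, Submodule.coe_smul, stft_smul]
            ring } }
  have hT₀ : ∀ f : D, T₀ f = c • T f := fun f => rfl
  have hbound : ∀ f : D, modulationNorm g p₂ q₂ (vWeight s) (c • T f) ≤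
      ↑(‖c‖₊ * C₂ * (2 ^ (s / 2) : ℝ).toNNReal * C₁) * N * modulationNorm g p₁ q₁ (vWeight s) f := by
    intro f
    rw [modulationNorm_smul hm]
    -- T f is a superposition of shifts π(z)g, so its transform is at most the convolution of its
    -- coefficients with |V_g g|.
    have h3 : ∀ x ξ : E, ‖stft g (T f) x ξ‖ₑ ≤ ∫⁻ z : E × E,
        (∫⁻ w : E × E, ‖weylKernel g σ (z.1, z.2) w‖ₑ * ‖stft g f w.1 w.2‖ₑ) *
          ‖stftS g g (z - (x, ξ))‖ₑ := by
      intro x ξ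
      rw [stft, hT, conjS_conjS]
      refine (enorm_integral_le_lintegral_enorm _).trans ?_
      have hmeas : Measurable fun u : (E × E) × (E × E) =>
          ‖H f u * conj (stftS g (tfShift x ξ g) u.1)‖ₑ := by
        have h4 : Continuous fun u : (E × E) × (E × E) =>
            H f u * conj (stftS g (tfShift x ξ g) u.1) :=
          ((continuous_weylKernel g σ).mul ((continuous_stft g f).comp continuous_snd)).mul
            (continuous_conj.comp ((stftS g (tfShift x ξ g)).continuous.comp continuous_fst))
        exact h4.enorm.measurable
      rw [Measure.volume_eq_prod, lintegral_prod _ hmeas.aemeasurable]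
      refine lintegral_mono fun z => ?_
      rw [← lintegral_mul_const' _ _ enorm_ne_top]
      refine lintegral_mono fun w => le_of_eq ?_
      rw [enorm_mul, RCLike.enorm_conj, hH, enorm_mul]
      congr 1
      rw [enorm_eq_iff_norm_eq]
      exact norm_stftS_tfShift g g (x, ξ) z
    have h5 := hC₂ (fun x ξ => ∫⁻ w : E × E, ‖weylKernel g σ (x, ξ) w‖ₑ * ‖stft g f w.1 w.2‖ₑ)
      (fun x ξ => ‖stft g (T f) x ξ‖ₑ) (measurable_lintegral_weylKernel g σ f)
      (measurable_enorm_stft g (T f)) h3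
    rw [← modulationNorm_eq hm] at h5
    have h6 := mixE_weylKernel_le (g := g) (p := p) (q := q) (b₁' := b₁') (b₂' := b₂') hs hPQ ha₁
      ha₂ hb₁ hb₂ h₁ h₂ σ f
    calc _ ≤ ‖c‖ₑ * (C₂ * (ENNReal.ofReal (2 ^ (s / 2)) * N *
          (C₁ * modulationNorm g p₁ q₁ (vWeight s) f))) := by
          gcongr
          refine h5.trans ?_
          gcongr
          refine h6.trans ?_
          gcongr
          exact hC₁ f
      _ = _ := by
          rw [ENNReal.coe_mul, ENNReal.coe_mul, ENNReal.coe_mul, ENNReal.ofReal,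
            ← enorm_eq_nnnorm]
          ring
  refine ⟨T₀, ⟨rfl, fun φ => ?_, fun f => ?_, hbound⟩⟩
  · have hφ : toDistribution φ ∈ D := modulationNorm_toDistribution_lt_top hm g φ hp₁ hq₁
    refine ⟨hφ, ?_⟩
    ext ψ
    change c * T ⟨toDistribution φ, hφ⟩ ψ = weylOperator σ φ ψ
    rw [hT]
    have hi := hHF ⟨toDistribution φ, hφ⟩ (stftS g (conjS ψ))
    have h7 := integral_prod_symm _ hi
    have h8 := energy_sq_mul_weylOperator g σ φ (conjS ψ)
    rw [conjS_conjS] at h8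
    have h9 : ∫ u, H (toDistribution φ) u * conj (stftS g (conjS ψ) u.1) =
        (energy g : ℂ) ^ 2 * weylOperator σ φ ψ := by
      rw [← h8]
      refine h7.trans ?_
      refine integral_congr_ae (.of_forall fun w => integral_congr_ae (.of_forall fun z => ?_))
      simp only [hH, stft_toDistribution]
    rw [h9, hc, inv_mul_cancel_left₀ he]
  · refine (hbound f).trans_lt (ENNReal.mul_lt_top (ENNReal.mul_lt_top ENNReal.coe_lt_top hσ) f.2)

/-- Weyl operators with symbols in modulation spaces are bounded on modulation spaces. -/
theorem exists_isBoundedExtension {s : ℝ} (hs : 0 ≤ s) {g : 𝓢(E, ℂ)} (hg : g ≠ 0)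
    {Φ : 𝓢(Phase E, ℂ)} (hΦ : Φ ≠ 0) {p₁ q₁ p₂ q₂ p q : ℝ≥0∞} (hp₁ : 1 ≤ p₁) (hq₁ : 1 ≤ q₁)
    (hp₂ : 1 ≤ p₂) (hq₂ : 1 ≤ q₂) (hp : 1 ≤ p) (hq : 1 ≤ q)
    (h : AdmissibleExponents p₁ q₁ p₂ q₂ p q) :
    ∃ C : ℝ≥0, ∀ σ ∈ modulationSpace Φ p q (symbolWeight s),
      ∃ T, IsBoundedExtension g p₁ q₁ p₂ q₂ (vWeight s) (weylOperator σ)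
        (C * modulationNorm Φ p q (symbolWeight s) σ) T := by
  have i₁ : p₁.HolderConjugate p₁.conjExponent := .conjExponent hp₁
  have i₂ : q₁.HolderConjugate q₁.conjExponent := .conjExponent hq₁
  have i₃ : p₂.HolderConjugate p₂.conjExponent := .conjExponent hp₂
  have i₄ : q₂.HolderConjugate q₂.conjExponent := .conjExponent hq₂
  have i₅ : p.HolderConjugate p.conjExponent := .conjExponent hp
  have i₆ : q.HolderConjugate q.conjExponent := .conjExponent hq
  have i₇ : (max p q).HolderConjugate (max p q).conjExponent := .conjExponent (hp.trans (le_max_left _ _))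
  have i₇' := i₇.symm
  have i₁' := i₁.symm
  have i₂' := i₂.symm
  obtain ⟨hsum, hmin⟩ := h
  simp only [le_min_iff] at hsum hmin
  obtain ⟨⟨m₁, m₂⟩, m₃, m₄⟩ := hmin
  set Q := q.conjExponent
  -- The bilinear estimate needs P ≤ Q. Enlarging p to max p q secures this and only enlarges the
  -- symbol class. If p ≤ q, then P = Q and the condition on sums follows from the bounds on q;
  -- otherwise P = p' and it is the given one.
  set P := (max p q).conjExponent
  have hPQ : P ≤ Q := conj_le_of_le (le_max_right p q)
  have hP : 1 ≤ P := ENNReal.HolderConjugate.one_le P (max p q)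
  have k₁ : p₁ ≤ Q := conj_le_of_le m₁
  have k₂ : q₁ ≤ Q := conj_le_of_le m₂
  have k₃ : p₂.conjExponent ≤ Q := conj_le_of_le m₃
  have k₄ : q₂.conjExponent ≤ Q := conj_le_of_le m₄
  have hPQ' : ∀ a b : ℝ≥0∞, a ≤ Q → b ≤ Q → p.conjExponent⁻¹ + Q⁻¹ ≤ a⁻¹ + b⁻¹ →
      P⁻¹ + Q⁻¹ ≤ a⁻¹ + b⁻¹ := by
    intro a b ha hb hab
    rcases le_total p q with hpq | hpq
    · have : P = Q := by simp only [P, Q, max_eq_right hpq]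
      rw [this]
      exact add_le_add (ENNReal.inv_le_inv.2 ha) (ENNReal.inv_le_inv.2 hb)
    · have : P = p.conjExponent := by simp only [P, max_eq_left hpq]
      rwa [this]
  obtain ⟨a₁, b₁, ha₁, hb₁, e₁, hpa, hrb⟩ := exists_intermediate_exponents hPQ hP k₁ k₃
    (hPQ' _ _ k₁ k₃ hsum.1)
  obtain ⟨a₂, b₂, ha₂, hb₂, e₂, hqa, hsb⟩ := exists_intermediate_exponents hPQ hP k₂ k₄
    (hPQ' _ _ k₂ k₄ hsum.2)
  have j₁ : b₁.HolderConjugate b₁.conjExponent := .conjExponent (hP.trans hb₁)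
  have j₂ : b₂.HolderConjugate b₂.conjExponent := .conjExponent (hP.trans hb₂)
  have i₃' := i₃.symm
  have i₄' := i₄.symm
  have hpb : b₁.conjExponent ≤ p₂ := conj_le_of_le hrb
  have hqb : b₂.conjExponent ≤ q₂ := conj_le_of_le hsb
  have j₁' := j₁.symm
  have j₂' := j₂.symm
  obtain ⟨C₁, hC₁⟩ := exists_weylExtension (p := max p q) (q := q) hs hg hPQ ha₁ ha₂ hb₁ hb₂ e₁ e₂
    hp₁ hq₁ hpa hqa hpb hqb
  obtain ⟨C₂, hC₂⟩ := exists_modulationNorm_le (isModerate_symbolWeight (E := E) hs) hΦ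
    (crossWigner g g) hp (le_max_left p q) hq le_rfl
  refine ⟨C₁ * C₂, fun σ hσ => ?_⟩
  obtain ⟨T, hT⟩ := hC₁ σ ((hC₂ σ).trans_lt (ENNReal.mul_lt_top ENNReal.coe_lt_top hσ))
  refine ⟨T, hT.domain_eq, hT.extends_schwartz, hT.mem_codomain, fun f => (hT.norm_le f).trans ?_⟩
  rw [ENNReal.coe_mul, mul_assoc (C₁ : ℝ≥0∞) (C₂ : ℝ≥0∞)]
  exact mul_le_mul_left (mul_le_mul_right (hC₂ σ) _) _

end WeylMod

namespace WeylMod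

open Filter Topology

variable {E : Type*} [NormedAddCommGroup E] [InnerProductSpace ℝ E] [FiniteDimensional ℝ E]
  [MeasurableSpace E] [BorelSpace E]

/-! ### Gaussians -/

theorem exists_pow_mul_exp_neg_le {c : ℝ} (hc : 0 < c) (m : ℕ) :
    ∃ B : ℝ, ∀ r : ℝ, 0 ≤ r → (1 + r) ^ m * Real.exp (-(c * r ^ 2)) ≤ B := by
  refine ⟨m.factorial * Real.exp (1 + 1 / (4 * c)), fun r hr => ?_⟩
  have h1 : (1 + r) ^ m ≤ m.factorial * Real.exp (1 + r) := by
    have := Real.pow_div_factorial_le_exp (1 + r) (by positivity) m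
    rwa [div_le_iff₀ (by positivity), mul_comm] at this
  have h2 : 1 + r + -(c * r ^ 2) ≤ 1 + 1 / (4 * c) := by
    have h3 : 1 / (4 * c) - r + c * r ^ 2 = c * (r - 1 / (2 * c)) ^ 2 := by field_simp; ring
    have h4 : 0 ≤ c * (r - 1 / (2 * c)) ^ 2 := by positivity
    linarith
  calc _ ≤ m.factorial * Real.exp (1 + r) * Real.exp (-(c * r ^ 2)) := by gcongr
    _ = m.factorial * Real.exp (1 + r + -(c * r ^ 2)) := by rw [mul_assoc, ← Real.exp_add]
    _ ≤ _ := by gcongr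

/-- The Gaussian `t ↦ exp (-π c |t|²)` as a Schwartz function. -/
def gaussian {c : ℝ} (hc : 0 < c) : 𝓢(E, ℂ) where
  toFun t := (Real.exp (-(Real.pi * c * ‖t‖ ^ 2)) : ℝ)
  smooth' := by
    have h : ContDiff ℝ (⊤ : ℕ∞) fun t : E => Real.exp (-(Real.pi * c * ‖t‖ ^ 2)) :=
      ((contDiff_const.mul (contDiff_norm_sq ℝ)).neg).exp
    exact Complex.ofRealCLM.contDiff.comp h
  decay' k n := by
    have ht : (fun t : E => Real.pi * c * ‖t‖ ^ 2).HasTemperateGrowth :=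
      (Function.HasTemperateGrowth.const (Real.pi * c)).mul
        (Function.hasTemperateGrowth_norm_sq E)
    obtain ⟨K, C, hC, hb⟩ := ht.norm_iteratedFDeriv_le_uniform n
    obtain ⟨B, hB⟩ := exists_pow_mul_exp_neg_le (c := Real.pi * c) (by positivity) (k + K * n)
    refine ⟨n.factorial * (1 + C) ^ n * B, fun x => ?_⟩
    have hexp : ContDiff ℝ n fun s : ℝ => Real.exp (-1 * s) := by fun_prop
    -- Derivatives of a composition: those of s ↦ e^{-s} are bounded by the Gaussian itself, those
    -- of the quadratic exponent grow polynomially. The bound D is made at least 1 so that D ≤ D ^ i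
    -- for i ≥ 1.
    have h1 := norm_iteratedFDeriv_comp_le (𝕜 := ℝ) hexp
      (ht.1.of_le (by exact_mod_cast le_top)) le_rfl x (C := Real.exp (-(Real.pi * c * ‖x‖ ^ 2)))
      (D := (1 + C) * (1 + ‖x‖) ^ K)
      (fun i _ => by
        rw [norm_iteratedFDeriv_eq_norm_iteratedDeriv, iteratedDeriv_exp_const_mul]
        simp)
      (fun i hi hin => by
        have hx : 1 ≤ (1 + ‖x‖) ^ K := one_le_pow₀ (by linarith [norm_nonneg x])
        have h2 : 1 ≤ (1 + C) * (1 + ‖x‖) ^ K := by nlinarith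
        refine (hb i hin x).trans (le_trans ?_ (le_self_pow₀ h2 (by omega)))
        gcongr
        linarith)
    have h2 : ‖iteratedFDeriv ℝ n (fun t : E =>
        ((Real.exp (-(Real.pi * c * ‖t‖ ^ 2)) : ℝ) : ℂ)) x‖ =
        ‖iteratedFDeriv ℝ n ((fun s : ℝ => Real.exp (-1 * s)) ∘
          fun t : E => Real.pi * c * ‖t‖ ^ 2) x‖ := by
      have e : (fun t : E => ((Real.exp (-(Real.pi * c * ‖t‖ ^ 2)) : ℝ) : ℂ)) =
          Complex.ofRealLI ∘ ((fun s : ℝ => Real.exp (-1 * s)) ∘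
            fun t : E => Real.pi * c * ‖t‖ ^ 2) := by
        ext t; simp
      rw [e]
      exact Complex.ofRealLI.norm_iteratedFDeriv_comp_left
        (hexp.comp (ht.1.of_le (by exact_mod_cast le_top))).contDiffAt le_rfl
    rw [h2]
    calc _ ≤ ‖x‖ ^ k * (n.factorial * Real.exp (-(Real.pi * c * ‖x‖ ^ 2)) *
          ((1 + C) * (1 + ‖x‖) ^ K) ^ n) := by gcongr
      _ ≤ (1 + ‖x‖) ^ k * (n.factorial * Real.exp (-(Real.pi * c * ‖x‖ ^ 2)) *
          ((1 + C) * (1 + ‖x‖) ^ K) ^ n) := by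
          gcongr
          linarith
      _ = n.factorial * (1 + C) ^ n *
          ((1 + ‖x‖) ^ (k + K * n) * Real.exp (-(Real.pi * c * ‖x‖ ^ 2))) := by
          rw [mul_pow, pow_add, pow_mul]; ring
      _ ≤ _ := by
          gcongr
          exact hB ‖x‖ (norm_nonneg x)

@[simp] theorem gaussian_apply {c : ℝ} (hc : 0 < c) (t : E) :
    gaussian hc t = (Real.exp (-(Real.pi * c * ‖t‖ ^ 2)) : ℝ) := rfl

theorem gaussian_ne_zero {c : ℝ} (hc : 0 < c) : (gaussian hc : 𝓢(E, ℂ)) ≠ 0 := by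
  intro h
  have := congrArg (fun f : 𝓢(E, ℂ) => f 0) h
  simp at this

/-- Half the dimension. -/
def halfDim (E : Type*) [NormedAddCommGroup E] [InnerProductSpace ℝ E] : ℝ :=
  (Module.finrank ℝ E : ℝ) / 2

theorem integral_gaussian {c : ℝ} (hc : 0 < c) :
    ∫ t : E, Real.exp (-(Real.pi * c * ‖t‖ ^ 2)) = c ^ (-halfDim E) := by
  have h := GaussianFourier.integral_rexp_neg_mul_sq_norm (V := E) (b := Real.pi * c) (by positivity)
  have e : Real.pi / (Real.pi * c) = c⁻¹ := by field_simp
  rw [e, Real.inv_rpow hc.le, ← Real.rpow_neg hc.le] at h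
  rw [halfDim, ← h]
  simp

theorem energy_gaussian {c : ℝ} (hc : 0 < c) :
    energy (gaussian hc : 𝓢(E, ℂ)) = (2 * c) ^ (-halfDim E) := by
  rw [energy, ← integral_gaussian (by positivity)]
  refine integral_congr_ae (.of_forall fun t => ?_)
  simp only [gaussian_apply, Complex.norm_real, Real.norm_eq_abs, Real.abs_exp]
  rw [← Real.exp_nat_mul]
  congr 1
  push_cast
  ring

theorem norm_sq_completion {c : ℝ} (hc : 0 < c) (x t : E) :
    c * ‖t + (1 + c)⁻¹ • x‖ ^ 2 + 1 * ‖t + (1 + c)⁻¹ • x - x‖ ^ 2 =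
      (1 + c) * ‖t‖ ^ 2 + c / (1 + c) * ‖x‖ ^ 2 := by
  have h : 1 + c ≠ 0 := by positivity
  have e : t + (1 + c)⁻¹ • x - x = t - (c / (1 + c)) • x := by
    have : (1 : ℝ) - (1 + c)⁻¹ = c / (1 + c) := by field_simp; ring
    rw [← this]
    module
  rw [e, norm_add_sq_real, norm_sub_sq_real, inner_smul_right, inner_smul_right, norm_smul,
    norm_smul, mul_pow, mul_pow, Real.norm_eq_abs, Real.norm_eq_abs, sq_abs, sq_abs]
  field_simp
  ring

/-- The short-time Fourier transform of a Gaussian with respect to the standard Gaussian. -/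
theorem norm_stftS_gaussian {c : ℝ} (hc : 0 < c) (z : E × E) :
    ‖stftS (gaussian one_pos) (gaussian hc : 𝓢(E, ℂ)) z‖ = (1 + c) ^ (-halfDim E) *
      (Real.exp (-(Real.pi * (c / (1 + c)) * ‖z.1‖ ^ 2)) *
        Real.exp (-(Real.pi * (1 + c)⁻¹ * ‖z.2‖ ^ 2))) := by
  have h1c : 0 < 1 + c := by positivity
  -- The centre of the product of the two Gaussians. Shifting t by y completes the square and leaves
  -- the Fourier transform of a centred Gaussian.
  set y : E := (1 + c)⁻¹ • z.1 with hy
  have h : stftS (gaussian one_pos) (gaussian hc : 𝓢(E, ℂ)) z =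
      (Real.fourierChar (-⟪z.2, y⟫_ℝ) : ℂ) *
        (Real.exp (-(Real.pi * (c / (1 + c)) * ‖z.1‖ ^ 2)) : ℝ) *
        𝓕 (fun t : E => cexp (-(((Real.pi * (1 + c) : ℝ)) : ℂ) * ‖t‖ ^ 2)) z.2 := by
    rw [stftS_apply, Real.fourier_eq, ← integral_const_mul, ← integral_add_right_eq_self _ y]
    refine integral_congr_ae (.of_forall fun t => ?_)
    simp only [tfShift_apply, exp_eq_fourierChar, gaussian_apply, map_mul, conj_ofReal,
      ← Circle.coe_inv_eq_conj, ← AddChar.map_neg_eq_inv, Circle.smul_def, smul_eq_mul]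
    have e1 : (Real.fourierChar (-⟪z.2, t + y⟫_ℝ) : ℂ) =
        Real.fourierChar (-⟪z.2, y⟫_ℝ) * Real.fourierChar (-⟪t, z.2⟫_ℝ) := by
      rw [← Circle.coe_mul, ← AddChar.map_add_eq_mul]
      congr 2
      rw [inner_add_right, real_inner_comm t]
      ring
    have e2 : ((Real.exp (-(Real.pi * c * ‖t + y‖ ^ 2)) : ℝ) : ℂ) *
        ((Real.exp (-(Real.pi * 1 * ‖t + y - z.1‖ ^ 2)) : ℝ) : ℂ) =
        ((Real.exp (-(Real.pi * (c / (1 + c)) * ‖z.1‖ ^ 2)) : ℝ) : ℂ) *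
        cexp (-(((Real.pi * (1 + c) : ℝ)) : ℂ) * ‖t‖ ^ 2) := by
      have e3 : cexp (-(((Real.pi * (1 + c) : ℝ)) : ℂ) * ‖t‖ ^ 2) =
          ((Real.exp (-(Real.pi * (1 + c) * ‖t‖ ^ 2)) : ℝ) : ℂ) := by
        push_cast; congr 1; ring
      rw [e3, ← ofReal_mul, ← ofReal_mul, ← Real.exp_add, ← Real.exp_add]
      congr 2
      linear_combination (-Real.pi) * norm_sq_completion hc z.1 t
    rw [e1]
    linear_combination ((Real.fourierChar (-⟪z.2, y⟫_ℝ) : ℂ) *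
      Real.fourierChar (-⟪t, z.2⟫_ℝ)) * e2
  have hb : 0 < ((Real.pi * (1 + c) : ℝ) : ℂ).re := by
    rw [ofReal_re]; positivity
  rw [h, fourier_gaussian_innerProductSpace hb, norm_mul, norm_mul, norm_mul, Circle.norm_coe,
    one_mul, Complex.norm_real, Real.norm_eq_abs, Real.abs_exp]
  have e4 : ((Real.pi : ℂ) / ((Real.pi * (1 + c) : ℝ) : ℂ)) = (((1 + c)⁻¹ : ℝ) : ℂ) := by
    rw [← ofReal_div]
    congr 1
    field_simp
  have e5 : ‖((Real.pi : ℂ) / ((Real.pi * (1 + c) : ℝ) : ℂ)) ^ ((Module.finrank ℝ E : ℂ) / 2)‖ =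
      (1 + c) ^ (-halfDim E) := by
    rw [e4, norm_cpow_eq_rpow_re_of_pos (by positivity), Real.inv_rpow h1c.le,
      Real.rpow_neg h1c.le, halfDim]
    congr 2
    simp
  have e6 : ‖cexp (-(Real.pi : ℂ) ^ 2 * ‖z.2‖ ^ 2 / ((Real.pi * (1 + c) : ℝ) : ℂ))‖ =
      Real.exp (-(Real.pi * (1 + c)⁻¹ * ‖z.2‖ ^ 2)) := by
    have : (-(Real.pi : ℂ) ^ 2 * ‖z.2‖ ^ 2 / ((Real.pi * (1 + c) : ℝ) : ℂ)) =
        ((-(Real.pi * (1 + c)⁻¹ * ‖z.2‖ ^ 2) : ℝ) : ℂ) := by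
      have h3 : (Real.pi : ℂ) ≠ 0 := by exact_mod_cast Real.pi_ne_zero
      have h4 : (1 + c : ℂ) ≠ 0 := by exact_mod_cast h1c.ne'
      push_cast
      field_simp
    rw [this, Complex.norm_exp_ofReal]
  rw [e5, e6]
  ring

/-- The reciprocal of an exponent as a real number. -/
def recip (p : ℝ≥0∞) : ℝ := (p⁻¹).toReal

/-- Scaling gives the power of a. The constant must not depend on a, since a will degenerate; at p =
∞ the reciprocal is 0 and the bound is 1. -/
theorem exists_eLpNorm_gaussian_le {p : ℝ≥0∞} (hp : 1 ≤ p) :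
    ∃ C : ℝ, 0 < C ∧ ∀ a : ℝ, 0 < a →
      eLpNorm (fun x : E => ENNReal.ofReal (Real.exp (-(Real.pi * a * ‖x‖ ^ 2)))) p volume ≤
        ENNReal.ofReal (C * a ^ (-(halfDim E * recip p))) := by
  rcases eq_or_ne p ∞ with rfl | hp'
  · refine ⟨1, one_pos, fun a ha => ?_⟩
    rw [eLpNorm_ennreal_top]
    refine essSup_le_of_ae_le _ (.of_forall fun x => ?_)
    simp only [recip, ENNReal.inv_top, ENNReal.toReal_zero, mul_zero, neg_zero, Real.rpow_zero,
      mul_one]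
    refine ENNReal.ofReal_le_ofReal ?_
    rw [Real.exp_le_one_iff]
    have : 0 ≤ Real.pi * a * ‖x‖ ^ 2 := by positivity
    linarith
  · have h0 : p ≠ 0 := (one_pos.trans_le hp).ne'
    have hpr : 0 < p.toReal := ENNReal.toReal_pos h0 hp'
    refine ⟨p.toReal ^ (-(halfDim E * recip p)), by positivity, fun a ha => le_of_eq ?_⟩
    rw [eLpNorm_ennreal h0 hp']
    have e1 : ∀ x : E, ENNReal.ofReal (Real.exp (-(Real.pi * a * ‖x‖ ^ 2))) ^ p.toReal =
        ENNReal.ofReal (Real.exp (-(Real.pi * (p.toReal * a) * ‖x‖ ^ 2))) := by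
      intro x
      rw [ENNReal.ofReal_rpow_of_nonneg (Real.exp_pos _).le hpr.le, ← Real.exp_mul]
      congr 2
      ring
    have hi := integral_gaussian (E := E) (c := p.toReal * a) (by positivity)
    have hint : Integrable fun x : E => Real.exp (-(Real.pi * (p.toReal * a) * ‖x‖ ^ 2)) := by
      by_contra hcon
      rw [integral_undef hcon] at hi
      exact (Real.rpow_pos_of_pos (by positivity : 0 < p.toReal * a) _).ne hi
    simp_rw [e1]
    rw [← ofReal_integral_eq_lintegral_ofReal hint (.of_forall fun x => (Real.exp_pos _).le), hi,
      ENNReal.ofReal_rpow_of_nonneg (by positivity) (by positivity), ← Real.rpow_mul (by positivity),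
      Real.mul_rpow hpr.le ha.le]
    congr 3 <;> rw [recip, ENNReal.toReal_inv] <;> ring

end WeylMod

namespace WeylMod

open Filter Topology

variable {E : Type*} [NormedAddCommGroup E] [InnerProductSpace ℝ E] [FiniteDimensional ℝ E]
  [MeasurableSpace E] [BorelSpace E]

/-! ### Moyal's identity -/

theorem integrable_mul_conj {V : Type*} [NormedAddCommGroup V] [NormedSpace ℝ V]
    [MeasurableSpace V] [BorelSpace V] [SecondCountableTopology V] (μ : Measure V)
    [μ.HasTemperateGrowth] (F G : 𝓢(V, ℂ)) : Integrable (fun z => F z * conj (G z)) μ := by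
  refine F.integrable.mul_bdd (c := SchwartzMap.seminorm ℂ 0 0 G)
    (continuous_conj.comp G.continuous).aestronglyMeasurable (.of_forall fun z => ?_)
  rw [RCLike.norm_conj]
  exact G.norm_le_seminorm ℂ z

/-- Moyal's identity. -/
theorem integral_crossWigner_mul_conj (f₁ f₂ h₁ h₂ : 𝓢(E, ℂ)) :
    ∫ X : Phase E, crossWigner f₁ f₂ X * conj (crossWigner h₁ h₂ X) =
      (∫ t, f₁ t * conj (h₁ t)) * conj (∫ t, f₂ t * conj (h₂ t)) := by
  set F := SchwartzMap.compCLMOfContinuousLinearEquiv ℂ midpointCoord (tensor (conjS f₂) f₁) with hF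
  set G := SchwartzMap.compCLMOfContinuousLinearEquiv ℂ midpointCoord (tensor (conjS h₂) h₁) with hG
  have e1 : ∫ X : Phase E, crossWigner f₁ f₂ X * conj (crossWigner h₁ h₂ X) =
      ∫ z : E × E, partialFourier F z * conj (partialFourier G z) := by
    have := (WithLp.volume_preserving_toLp E E).integral_comp
      (MeasurableEquiv.toLp 2 (E × E)).measurableEmbedding
      (fun X : Phase E => crossWigner f₁ f₂ X * conj (crossWigner h₁ h₂ X))
    rw [← this]
    rfl
  have e2 : ∫ z : E × E, partialFourier F z * conj (partialFourier G z) =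
      ∫ x : E, ∫ ξ : E, 𝓕 (slice F x) ξ * conj (𝓕 (slice G x) ξ) :=
    integral_prod _ (integrable_mul_conj volume (partialFourier F) (partialFourier G))
  -- Parseval in the frequency variable: for fixed x both Wigner distributions are Fourier
  -- transforms of slices.
  have e3 : ∀ x : E, ∫ ξ : E, 𝓕 (slice F x) ξ * conj (𝓕 (slice G x) ξ) =
      ∫ t : E, F (x, t) * conj (G (x, t)) := by
    intro x
    have := SchwartzMap.integral_inner_fourier_fourier (slice G x) (slice F x)
    simp only [RCLike.inner_apply] at this
    exact this
  have e4 : ∫ x : E, ∫ t : E, F (x, t) * conj (G (x, t)) =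
      ∫ t : E, ∫ x : E, F (x, t) * conj (G (x, t)) :=
    integral_integral_swap (integrable_mul_conj volume F G)
  set A : E → ℂ := fun t => f₁ t * conj (h₁ t) with hA
  set B : E → ℂ := fun t => conj (f₂ (-t) * conj (h₂ (-t))) with hB
  have hAi : Integrable A := integrable_mul_conj volume f₁ h₁
  have hBi : Integrable B :=
    (Complex.conjCLE.toContinuousLinearMap.integrable_comp (integrable_mul_conj volume f₂ h₂)).comp_neg
  -- In the variables x ± t/2 the integral over midpoints is a convolution evaluated at t, and the
  -- integral of a convolution is the product of the integrals.
  have e5 : ∀ t : E, ∫ x : E, F (x, t) * conj (G (x, t)) =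
      MeasureTheory.convolution A B (ContinuousLinearMap.mul ℝ ℂ) volume t := by
    intro t
    rw [convolution_def, ← integral_add_right_eq_self
      (fun s => (ContinuousLinearMap.mul ℝ ℂ) (A s) (B (t - s))) ((2⁻¹ : ℝ) • t)]
    refine integral_congr_ae (.of_forall fun x => ?_)
    have e6 : F (x, t) = f₁ (x + (2⁻¹ : ℝ) • t) * conj (f₂ (x - (2⁻¹ : ℝ) • t)) := rfl
    have e7 : G (x, t) = h₁ (x + (2⁻¹ : ℝ) • t) * conj (h₂ (x - (2⁻¹ : ℝ) • t)) := rfl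
    have e8 : -(t - (x + (2⁻¹ : ℝ) • t)) = x - (2⁻¹ : ℝ) • t := by module
    simp only [e6, e7, hA, hB, e8, map_mul, conj_conj, ContinuousLinearMap.mul_apply']
    ring
  rw [e1, e2]
  simp_rw [e3]
  rw [e4]
  simp_rw [e5]
  rw [integral_convolution _ hAi hBi, ContinuousLinearMap.mul_apply', hB,
    integral_neg_eq_self fun t => conj (f₂ t * conj (h₂ t)), integral_conj]

/-- The short-time Fourier transform of a cross-Wigner distribution. -/
theorem enorm_stft_crossWigner (γ f h : 𝓢(E, ℂ)) (z w : E × E) :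
    ‖stft (crossWigner γ γ) (toDistribution (crossWigner h f)) (midpointPhase z w)
      (rotatePhase z w)‖ₑ = ‖stftS γ h z‖ₑ * ‖stftS γ f w‖ₑ := by
  -- By covariance the transform of W(h, f) is, up to a phase, its inner product with W(π(z)γ,
  -- π(w)γ), which Moyal's identity factors.
  have h1 : (∫ X : Phase E, crossWigner h f X *
      conj (crossWigner (tfShift z.1 z.2 γ) (tfShift w.1 w.2 γ) X)) =
      conj (Real.fourierChar ⟪(2⁻¹ : ℝ) • (z.2 + w.2), z.1 - w.1⟫_ℝ : ℂ) *
        stft (crossWigner γ γ) (toDistribution (crossWigner h f)) (midpointPhase z w)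
          (rotatePhase z w) := by
    rw [stft_toDistribution, stftS_apply, ← integral_const_mul, crossWigner_tfShift]
    refine integral_congr_ae (.of_forall fun X => ?_)
    simp only [smul_apply, smul_eq_mul, map_mul]
    ring
  rw [integral_crossWigner_mul_conj, ← stftS_apply, ← stftS_apply] at h1
  have h2 := congrArg (fun c : ℂ => ‖c‖ₑ) h1
  simp only [enorm_mul, RCLike.enorm_conj] at h2
  have h3 : ‖(Real.fourierChar ⟪(2⁻¹ : ℝ) • (z.2 + w.2), z.1 - w.1⟫_ℝ : ℂ)‖ₑ = 1 := by
    rw [← ofReal_norm, Circle.norm_coe, ENNReal.ofReal_one]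
  rw [h2, h3, one_mul]

theorem energy_eq_integral (f : 𝓢(E, ℂ)) : (energy f : ℂ) = ∫ t, f t * conj (f t) := by
  rw [energy, ← integral_complex_ofReal]
  refine integral_congr_ae (.of_forall fun x => ?_)
  simp only [Complex.mul_conj, Complex.normSq_eq_norm_sq]

/-- The symbol W(h, f) gives the rank-one operator u ↦ ⟨u, f⟩h, tested here at u = f against h. It
keeps all norms computable. -/
theorem weylOperator_crossWigner (f h : 𝓢(E, ℂ)) :
    weylOperator (toDistribution (crossWigner h f)) f (conjS h) = energy h * energy f := by
  rw [weylOperator_pairing]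
  refine (SchwartzMap.toTemperedDistributionCLM_apply_apply volume _ _).trans ?_
  have h1 := integral_crossWigner_mul_conj h f h f
  have h2 : conj (∫ t, f t * conj (f t)) = (energy f : ℂ) := by
    rw [← energy_eq_integral, conj_ofReal]
  rw [h2, ← energy_eq_integral h] at h1
  rw [← h1]
  refine integral_congr_ae (.of_forall fun x => ?_)
  simp [mul_comm]

end WeylMod

namespace WeylMod

open Filter Topology

variable {E : Type*} [NormedAddCommGroup E] [InnerProductSpace ℝ E] [FiniteDimensional ℝ E]
  [MeasurableSpace E] [BorelSpace E]

/-! ### Modulation norms of Gaussians and their cross-Wigner distributions -/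

theorem mixE_mul {X Y : Type*} [MeasureSpace X] [MeasureSpace Y] {A : X → ℝ≥0∞} {B : Y → ℝ≥0∞}
    (p q : ℝ≥0∞) (hA : Measurable A) (hB : Measurable B) :
    mixE p q (fun x y => A x * B y) = eLpNorm A p volume * eLpNorm B q volume := by
  unfold mixE
  have h : ∀ y, eLpNorm (fun x => A x * B y) p volume = eLpNorm A p volume * B y := fun y => by
    simp_rw [mul_comm _ (B y)]
    rw [eLpNorm_ennreal_const_mul _ _ _ hA, mul_comm]
  simp_rw [h]
  exact eLpNorm_ennreal_const_mul _ _ _ hB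

theorem measurable_mul_prod {X Y : Type*} [MeasurableSpace X] [MeasurableSpace Y] {A : X → ℝ≥0∞}
    {B : Y → ℝ≥0∞} (hA : Measurable A) (hB : Measurable B) :
    Measurable fun u : X × Y => A u.1 * B u.2 :=
  (hA.comp measurable_fst).mul (hB.comp measurable_snd)

theorem eLpNorm_mul_prod {X Y : Type*} [MeasureSpace X] [MeasureSpace Y]
    [SFinite (volume : Measure X)] [SFinite (volume : Measure Y)] {A : X → ℝ≥0∞} {B : Y → ℝ≥0∞}
    (p : ℝ≥0∞) (hA : Measurable A) (hB : Measurable B) :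
    eLpNorm (fun u : X × Y => A u.1 * B u.2) p volume =
      eLpNorm A p volume * eLpNorm B p volume := by
  rw [eLpNorm_prod_eq_mixE (measurable_mul_prod hA hB)]
  exact mixE_mul p p hA hB

/-- The Gaussian `x ↦ exp (-π a |x|²)` with values in `[0, ∞]`. -/
def gaussE (a : ℝ) (x : E) : ℝ≥0∞ := ENNReal.ofReal (Real.exp (-(Real.pi * a * ‖x‖ ^ 2)))

theorem measurable_gaussE (a : ℝ) : Measurable (gaussE a : E → ℝ≥0∞) := by
  unfold gaussE
  fun_prop

theorem gaussE_neg (a : ℝ) (x : E) : gaussE a (-x) = gaussE a x := by rw [gaussE, norm_neg, gaussE]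

/-- Completing the square in x: the product of the shifted Gaussians is a translate of a Gaussian in
x, with the parameters added, times a Gaussian in y with half their harmonic mean. Hence the inner
norm of the symbol is again Gaussian. -/
theorem gaussE_mul_gaussE {a a' : ℝ} (h : a + a' ≠ 0) (x y : E) :
    gaussE a' (x - (2⁻¹ : ℝ) • y) * gaussE a (x + (2⁻¹ : ℝ) • y) =
      gaussE (a * a' / (a + a')) y * gaussE (a + a') (x + ((a - a') / (2 * (a + a'))) • y) := by
  simp only [gaussE]
  rw [← ENNReal.ofReal_mul (Real.exp_pos _).le, ← ENNReal.ofReal_mul (Real.exp_pos _).le,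
    ← Real.exp_add, ← Real.exp_add]
  congr 2
  rw [norm_add_sq_real, norm_sub_sq_real, norm_add_sq_real, inner_smul_right, inner_smul_right,
    norm_smul, norm_smul, mul_pow, mul_pow, Real.norm_eq_abs, Real.norm_eq_abs, sq_abs, sq_abs]
  field_simp
  ring

theorem eLpNorm_gaussE_mul_gaussE {a a' : ℝ} (h : a + a' ≠ 0) (p : ℝ≥0∞) (y : E) :
    eLpNorm (fun x : E => gaussE a' (x - (2⁻¹ : ℝ) • y) * gaussE a (x + (2⁻¹ : ℝ) • y)) p volume =
      gaussE (a * a' / (a + a')) y * eLpNorm (gaussE (a + a') : E → ℝ≥0∞) p volume := by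
  simp_rw [gaussE_mul_gaussE h]
  have hm : Measurable fun x : E => gaussE (a + a') (x + ((a - a') / (2 * (a + a'))) • y) :=
    (measurable_gaussE _).comp (measurable_add_const _)
  rw [eLpNorm_ennreal_const_mul _ _ _ hm]
  congr 1
  exact eLpNorm_comp_measurePreserving (measurable_gaussE _).aestronglyMeasurable
    (measurePreserving_add_right volume _)

@[simp] theorem vWeight_zero (x ξ : E) : vWeight 0 x ξ = 1 := by simp [vWeight, bracket]

@[simp] theorem symbolWeight_zero (z ζ : Phase E) : symbolWeight 0 z ζ = 1 := by
  simp [symbolWeight, bracket]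

theorem enorm_stftS_gaussian {c : ℝ} (hc : 0 < c) (z : E × E) :
    ‖stftS (gaussian one_pos) (gaussian hc : 𝓢(E, ℂ)) z‖ₑ =
      ENNReal.ofReal ((1 + c) ^ (-halfDim E)) *
        (gaussE (c / (1 + c)) z.1 * gaussE (1 + c)⁻¹ z.2) := by
  rw [← ofReal_norm, norm_stftS_gaussian, ENNReal.ofReal_mul (by positivity),
    ENNReal.ofReal_mul (Real.exp_pos _).le, gaussE, gaussE]

theorem modulationNorm_gaussian {c : ℝ} (hc : 0 < c) (p q : ℝ≥0∞) :
    modulationNorm (gaussian one_pos) p q (vWeight 0) (toDistribution (gaussian hc : 𝓢(E, ℂ))) =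
      ENNReal.ofReal ((1 + c) ^ (-halfDim E)) *
        (eLpNorm (gaussE (c / (1 + c)) : E → ℝ≥0∞) p volume *
          eLpNorm (gaussE (1 + c)⁻¹ : E → ℝ≥0∞) q volume) := by
  rw [modulationNorm_eq (isModerate_vWeight le_rfl), ← mixE_mul p q (measurable_gaussE _)
    (measurable_gaussE _), ← mixE_const_mul _ (measurable_mul_prod (measurable_gaussE _)
      (measurable_gaussE _))]
  congr 1
  ext x ξ
  rw [vWeight_zero, ENNReal.ofReal_one, one_mul, stft_toDistribution, enorm_stftS_gaussian]

theorem enorm_stft_crossWigner_gaussian {c c' : ℝ} (hc : 0 < c) (hc' : 0 < c') (u v : E × E) :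
    ‖stft (crossWigner (gaussian one_pos) (gaussian one_pos))
      (toDistribution (crossWigner (gaussian hc') (gaussian hc : 𝓢(E, ℂ))))
        (WithLp.toLp 2 u) (WithLp.toLp 2 v)‖ₑ =
      ENNReal.ofReal ((1 + c') ^ (-halfDim E)) * ENNReal.ofReal ((1 + c) ^ (-halfDim E)) *
        ((gaussE (c' / (1 + c')) (u.1 - (2⁻¹ : ℝ) • v.2) *
          gaussE (c / (1 + c)) (u.1 + (2⁻¹ : ℝ) • v.2)) *
        (gaussE (1 + c')⁻¹ (u.2 - (2⁻¹ : ℝ) • -v.1) *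
          gaussE (1 + c)⁻¹ (u.2 + (2⁻¹ : ℝ) • -v.1))) := by
  -- The points z and w with midpoint u and rotated difference v, that is, z - w = (-v.2, v.1).
  set z : E × E := (u.1 - (2⁻¹ : ℝ) • v.2, u.2 - (2⁻¹ : ℝ) • -v.1) with hz
  set w : E × E := (u.1 + (2⁻¹ : ℝ) • v.2, u.2 + (2⁻¹ : ℝ) • -v.1) with hw
  have hu : (WithLp.toLp 2 u : Phase E) = midpointPhase z w := by
    rw [midpointPhase]
    congr 1
    refine Prod.ext ?_ ?_
    · change u.1 = (2⁻¹ : ℝ) • (u.1 - (2⁻¹ : ℝ) • v.2 + (u.1 + (2⁻¹ : ℝ) • v.2))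
      module
    · change u.2 = (2⁻¹ : ℝ) • (u.2 - (2⁻¹ : ℝ) • -v.1 + (u.2 + (2⁻¹ : ℝ) • -v.1))
      module
  have hv : (WithLp.toLp 2 v : Phase E) = rotatePhase z w := by
    rw [rotatePhase]
    congr 1
    refine Prod.ext ?_ ?_
    · change v.1 = u.2 - (2⁻¹ : ℝ) • -v.1 - (u.2 + (2⁻¹ : ℝ) • -v.1)
      module
    · change v.2 = -(u.1 - (2⁻¹ : ℝ) • v.2 - (u.1 + (2⁻¹ : ℝ) • v.2))
      module
  rw [hu, hv, enorm_stft_crossWigner, enorm_stftS_gaussian, enorm_stftS_gaussian]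
  simp only [hz, hw]
  ring

theorem modulationNorm_crossWigner_gaussian {c c' : ℝ} (hc : 0 < c) (hc' : 0 < c')
    (p q : ℝ≥0∞) : modulationNorm (crossWigner (gaussian one_pos) (gaussian one_pos)) p q
      (symbolWeight 0) (toDistribution (crossWigner (gaussian hc') (gaussian hc : 𝓢(E, ℂ)))) =
      ENNReal.ofReal ((1 + c') ^ (-halfDim E)) * ENNReal.ofReal ((1 + c) ^ (-halfDim E)) *
        ((eLpNorm (gaussE (c / (1 + c) + c' / (1 + c')) : E → ℝ≥0∞) p volume *
          eLpNorm (gaussE ((1 + c)⁻¹ + (1 + c')⁻¹) : E → ℝ≥0∞) p volume) *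
        (eLpNorm (gaussE (c / (1 + c) * (c' / (1 + c')) / (c / (1 + c) + c' / (1 + c'))) :
            E → ℝ≥0∞) q volume *
          eLpNorm (gaussE ((1 + c)⁻¹ * (1 + c')⁻¹ / ((1 + c)⁻¹ + (1 + c')⁻¹)) : E → ℝ≥0∞)
            q volume)) := by
  set K := ENNReal.ofReal ((1 + c') ^ (-halfDim E)) * ENNReal.ofReal ((1 + c) ^ (-halfDim E)) with hK
  set a := c / (1 + c) with ha
  set a' := c' / (1 + c') with ha'
  set b := (1 + c)⁻¹ with hb
  set b' := (1 + c')⁻¹ with hb'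
  have h1 : a + a' ≠ 0 := by positivity
  have h2 : b + b' ≠ 0 := by positivity
  have hm := isModerate_symbolWeight (E := E) le_rfl
  rw [modulationNorm_eq hm, ← mixE_comp_toLp (hm.measurable_mul (measurable_enorm_stft _ _))]
  simp_rw [symbolWeight_zero, ENNReal.ofReal_one, one_mul, enorm_stft_crossWigner_gaussian]
  have hA : ∀ (s s' : ℝ) (y : E), Measurable fun x : E =>
      gaussE s' (x - (2⁻¹ : ℝ) • y) * gaussE s (x + (2⁻¹ : ℝ) • y) := fun s s' y =>
    ((measurable_gaussE _).comp (measurable_sub_const _)).mul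
      ((measurable_gaussE _).comp (measurable_add_const _))
  have hin : ∀ v : E × E, eLpNorm (fun u : E × E => K *
      ((gaussE a' (u.1 - (2⁻¹ : ℝ) • v.2) * gaussE a (u.1 + (2⁻¹ : ℝ) • v.2)) *
        (gaussE b' (u.2 - (2⁻¹ : ℝ) • -v.1) * gaussE b (u.2 + (2⁻¹ : ℝ) • -v.1)))) p volume =
      (K * (eLpNorm (gaussE (a + a') : E → ℝ≥0∞) p volume *
        eLpNorm (gaussE (b + b') : E → ℝ≥0∞) p volume)) *
        (gaussE (b * b' / (b + b')) v.1 * gaussE (a * a' / (a + a')) v.2) := by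
    intro v
    rw [eLpNorm_ennreal_const_mul _ _ _ (measurable_mul_prod (hA a a' v.2) (hA b b' (-v.1))),
      eLpNorm_mul_prod p (hA a a' v.2) (hA b b' (-v.1)), eLpNorm_gaussE_mul_gaussE h1,
      eLpNorm_gaussE_mul_gaussE h2, gaussE_neg]
    ring
  simp only [← hK, ← ha, ← ha', ← hb, ← hb']
  unfold mixE
  simp_rw [hin]
  rw [eLpNorm_ennreal_const_mul _ _ _ (measurable_mul_prod (measurable_gaussE _)
    (measurable_gaussE _)), eLpNorm_mul_prod q (measurable_gaussE _) (measurable_gaussE _)]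
  ring

end WeylMod

namespace WeylMod

open Filter Topology

variable {E : Type*} [NormedAddCommGroup E] [InnerProductSpace ℝ E] [FiniteDimensional ℝ E]
  [MeasurableSpace E] [BorelSpace E]

/-! ### Testing the boundedness of Weyl operators on Gaussians -/

theorem energy_nonneg (g : 𝓢(E, ℂ)) : 0 ≤ energy g := integral_nonneg fun x => by positivity

/-- Duality of modulation spaces: the inversion formula writes the pairing as an integral over phase
space, to which mixed Hölder applies. -/
theorem energy_mul_enorm_le_modulationNorm {p p' q q' : ℝ≥0∞} [p.HolderConjugate p']
    [q.HolderConjugate q'] (g φ : 𝓢(E, ℂ)) (f : 𝓢'(E, ℂ)) :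
    ENNReal.ofReal (energy g) * ‖f (conjS φ)‖ₑ ≤
      modulationNorm g p q (vWeight 0) f * modulationNorm g p' q' (vWeight 0) (toDistribution φ) := by
  have hm := isModerate_vWeight (E := E) le_rfl
  have h1 : ENNReal.ofReal (energy g) * ‖f (conjS φ)‖ₑ =
      ‖∫ z : E × E, stft g f z.1 z.2 * conj (stftS g φ z)‖ₑ := by
    rw [integral_stft_mul, enorm_mul, ← ofReal_norm (energy g : ℂ), Complex.norm_real,
      Real.norm_of_nonneg (energy_nonneg g)]
  rw [h1, modulationNorm_eq hm, modulationNorm_eq hm]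
  simp_rw [vWeight_zero, ENNReal.ofReal_one, one_mul, stft_toDistribution]
  have hf : Measurable fun z : E × E => ‖stft g f z.1 z.2‖ₑ := measurable_enorm_stft g f
  have hφ : Measurable fun z : E × E => ‖stftS g φ z‖ₑ := (stftS g φ).continuous.enorm.measurable
  refine (enorm_integral_le_lintegral_enorm _).trans ?_
  simp_rw [enorm_mul, RCLike.enorm_conj]
  have hp : Measurable fun z : E × E => ‖stft g f z.1 z.2‖ₑ * ‖stftS g φ z‖ₑ := hf.mul hφ
  rw [Measure.volume_eq_prod, lintegral_prod_symm _ hp.aemeasurable]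
  exact lintegral_mul_le_mixE (F := fun x ξ => ‖stft g f x ξ‖ₑ) (G := fun x ξ => ‖stftS g φ (x, ξ)‖ₑ)
    hf hφ

/-- The bound is tested on the symbol W(φ, f), the argument f and, by duality, φ. The windows are
changed to γ and W(γ, γ) so that Gaussian windows may be used below. -/
theorem exists_energy_le_modulationNorm {g : 𝓢(E, ℂ)} (hg : g ≠ 0) {Φ : 𝓢(Phase E, ℂ)}
    {p₁ q₁ p₂ q₂ p q p₂' q₂' : ℝ≥0∞} [p₂.HolderConjugate p₂'] [q₂.HolderConjugate q₂']
    (hp₁ : 1 ≤ p₁) (hq₁ : 1 ≤ q₁) (hp₂ : 1 ≤ p₂) (hq₂ : 1 ≤ q₂) (hp : 1 ≤ p) (hq : 1 ≤ q)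
    {C : ℝ≥0} (h : ∀ (σ : 𝓢'(Phase E, ℂ)) (f : 𝓢(E, ℂ)),
      modulationNorm g p₂ q₂ (vWeight 0) (weylOperator σ f) ≤
        C * modulationNorm Φ p q (symbolWeight 0) σ *
          modulationNorm g p₁ q₁ (vWeight 0) (toDistribution f))
    {γ : 𝓢(E, ℂ)} (hγ : γ ≠ 0) : ∃ K : ℝ≥0, ∀ f φ : 𝓢(E, ℂ),
      ENNReal.ofReal (energy φ * energy f) ≤
        K * modulationNorm (crossWigner γ γ) p q (symbolWeight 0) (toDistribution (crossWigner φ f)) *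
          modulationNorm γ p₁ q₁ (vWeight 0) (toDistribution f) *
          modulationNorm γ p₂' q₂' (vWeight 0) (toDistribution φ) := by
  have hm := isModerate_vWeight (E := E) le_rfl
  have hms := isModerate_symbolWeight (E := E) le_rfl
  obtain ⟨C₁, hC₁⟩ := exists_modulationNorm_le hm hg γ hp₂ le_rfl hq₂ le_rfl
  obtain ⟨C₂, hC₂⟩ := exists_modulationNorm_le hms (crossWigner_self_ne_zero hγ) Φ hp le_rfl hq le_rfl
  obtain ⟨C₃, hC₃⟩ := exists_modulationNorm_le hm hγ g hp₁ le_rfl hq₁ le_rfl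
  have he : ENNReal.ofReal (energy γ) ≠ 0 := by simpa using energy_pos hγ
  refine ⟨(ENNReal.ofReal (energy γ))⁻¹.toNNReal * (C₁ * C * C₂ * C₃), fun f φ => ?_⟩
  have h1 := energy_mul_enorm_le_modulationNorm (p := p₂) (q := q₂) (p' := p₂') (q' := q₂') γ φ
    (weylOperator (toDistribution (crossWigner φ f)) f)
  rw [weylOperator_crossWigner, ← ofReal_mul, ← ofReal_norm ((energy φ * energy f : ℝ) : ℂ),
    Complex.norm_real, Real.norm_of_nonneg (mul_nonneg (energy_nonneg φ) (energy_nonneg f)),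
    ENNReal.mul_le_iff_le_inv he ENNReal.ofReal_ne_top] at h1
  refine h1.trans ?_
  set σ := toDistribution (crossWigner φ f)
  calc _ ≤ (ENNReal.ofReal (energy γ))⁻¹ *
        (C₁ * (C * (C₂ * modulationNorm (crossWigner γ γ) p q (symbolWeight 0) σ) *
          (C₃ * modulationNorm γ p₁ q₁ (vWeight 0) (toDistribution f))) *
          modulationNorm γ p₂' q₂' (vWeight 0) (toDistribution φ)) := by
        gcongr
        refine (hC₁ _).trans ?_
        gcongr
        refine (h σ f).trans ?_
        gcongr
        · exact hC₂ σ
        · exact hC₃ _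
    _ = _ := by
        rw [ENNReal.coe_mul, ENNReal.coe_toNNReal (ENNReal.inv_ne_top.2 he)]
        push_cast
        ring

/-- The factor by which the boundedness of Weyl operators tested on Gaussians of parameters `a`, `a'`
is governed. -/
def gaussianFactor (κ r s t t' a a' : ℝ) : ℝ :=
  a ^ (κ * (1 - t)) * a' ^ (κ * (1 - t')) * (a + a') ^ (-(κ * r)) * (a * a' / (a + a')) ^ (-(κ * s))

theorem gaussianFactor_comm (κ r s t t' a a' : ℝ) :
    gaussianFactor κ r s t t' a a' = gaussianFactor κ r s t' t a' a := by
  rw [gaussianFactor, gaussianFactor, add_comm a, mul_comm a]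
  ring

/-- The energy bound for Gaussians against the Gaussian window. Position and frequency parts
separate, the first with a, a' and the exponents p₁, p₂', the second with 1 - a, 1 - a' and q₁, q₂'.
-/
theorem exists_one_le_gaussianFactor {g : 𝓢(E, ℂ)} (hg : g ≠ 0) {Φ : 𝓢(Phase E, ℂ)}
    {p₁ q₁ p₂ q₂ p q p₂' q₂' : ℝ≥0∞} [p₂.HolderConjugate p₂'] [q₂.HolderConjugate q₂']
    (hp₁ : 1 ≤ p₁) (hq₁ : 1 ≤ q₁) (hp₂ : 1 ≤ p₂) (hq₂ : 1 ≤ q₂) (hp : 1 ≤ p) (hq : 1 ≤ q)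
    (hp₂' : 1 ≤ p₂') (hq₂' : 1 ≤ q₂')
    {C : ℝ≥0} (h : ∀ (σ : 𝓢'(Phase E, ℂ)) (f : 𝓢(E, ℂ)),
      modulationNorm g p₂ q₂ (vWeight 0) (weylOperator σ f) ≤
        C * modulationNorm Φ p q (symbolWeight 0) σ *
          modulationNorm g p₁ q₁ (vWeight 0) (toDistribution f)) :
    ∃ K : ℝ, 0 < K ∧ ∀ a a' : ℝ, 0 < a → a < 1 → 0 < a' → a' < 1 →
      1 ≤ K * gaussianFactor (halfDim E) (recip p) (recip q) (recip p₁) (recip p₂') a a' *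
        gaussianFactor (halfDim E) (recip p) (recip q) (recip q₁) (recip q₂') (1 - a) (1 - a') := by
  obtain ⟨K, hK⟩ := exists_energy_le_modulationNorm (p₂' := p₂') (q₂' := q₂') hg hp₁ hq₁ hp₂ hq₂ hp
    hq h (gaussian_ne_zero one_pos)
  obtain ⟨A, hA0, hA⟩ := exists_eLpNorm_gaussian_le (E := E) hp
  obtain ⟨B, hB0, hB⟩ := exists_eLpNorm_gaussian_le (E := E) hq
  obtain ⟨A₁, hA₁0, hA₁⟩ := exists_eLpNorm_gaussian_le (E := E) hp₁
  obtain ⟨B₁, hB₁0, hB₁⟩ := exists_eLpNorm_gaussian_le (E := E) hq₁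
  obtain ⟨A₂, hA₂0, hA₂⟩ := exists_eLpNorm_gaussian_le (E := E) hp₂'
  obtain ⟨B₂, hB₂0, hB₂⟩ := exists_eLpNorm_gaussian_le (E := E) hq₂'
  change ∀ a : ℝ, 0 < a → eLpNorm (gaussE a : E → ℝ≥0∞) _ volume ≤ _ at hA hB hA₁ hB₁ hA₂ hB₂
  set κ := halfDim E
  refine ⟨(2 ^ κ) ^ 2 * (K + 1) * (A * A * (B * B) * (A₁ * B₁ * (A₂ * B₂))), by positivity,
    fun a a' ha ha1 ha' ha1' => ?_⟩
  set b := 1 - a with hb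
  set b' := 1 - a' with hb'
  have hb0 : 0 < b := by linarith
  have hb0' : 0 < b' := by linarith
  -- With c = a/(1 - a) one has c/(1 + c) = a and 1/(1 + c) = 1 - a, so the transform decays with
  -- rate a in position and 1 - a in frequency.
  have hc : 0 < a / b := by positivity
  have hc' : 0 < a' / b' := by positivity
  have e1 : ∀ {x y : ℝ}, 0 < y → y = 1 - x → (1 + x / y)⁻¹ = y ∧ x / y / (1 + x / y) = x := by
    intro x y hy hxy
    have : 1 + x / y = y⁻¹ := by field_simp; linarith
    rw [this, inv_inv, div_inv_eq_mul]
    exact ⟨rfl, by field_simp⟩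
  obtain ⟨e2, e3⟩ := e1 hb0 hb
  obtain ⟨e2', e3'⟩ := e1 hb0' hb'
  have e4 : (1 + a / b) ^ (-κ) = b ^ κ := by
    rw [Real.rpow_neg (by positivity), ← Real.inv_rpow (by positivity), e2]
  have e4' : (1 + a' / b') ^ (-κ) = b' ^ κ := by
    rw [Real.rpow_neg (by positivity), ← Real.inv_rpow (by positivity), e2']
  have key := hK (gaussian hc) (gaussian hc')
  rw [modulationNorm_crossWigner_gaussian, modulationNorm_gaussian, modulationNorm_gaussian,
    energy_gaussian, energy_gaussian, e2, e2', e3, e3', e4, e4'] at key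
  have key2 : ENNReal.ofReal ((2 * (a' / b')) ^ (-κ) * (2 * (a / b)) ^ (-κ)) ≤
      ENNReal.ofReal ((K + 1) * (b' ^ κ * b ^ κ *
        ((A * (a + a') ^ (-(κ * recip p))) * (A * (b + b') ^ (-(κ * recip p))) *
        ((B * (a * a' / (a + a')) ^ (-(κ * recip q))) *
          (B * (b * b' / (b + b')) ^ (-(κ * recip q)))))) *
        (b ^ κ * ((A₁ * a ^ (-(κ * recip p₁))) * (B₁ * b ^ (-(κ * recip q₁))))) *
        (b' ^ κ * ((A₂ * a' ^ (-(κ * recip p₂'))) * (B₂ * b' ^ (-(κ * recip q₂')))))) := by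
    refine key.trans ?_
    repeat rw [ENNReal.ofReal_mul (by positivity)]
    have hKK : (K : ℝ≥0∞) ≤ ENNReal.ofReal ((K : ℝ) + 1) := by
      rw [← ENNReal.ofReal_coe_nnreal]
      exact ENNReal.ofReal_le_ofReal (by linarith)
    gcongr
    · rw [← ENNReal.ofReal_mul hA0.le]; exact hA _ (by positivity)
    · rw [← ENNReal.ofReal_mul hA0.le]; exact hA _ (by positivity)
    · rw [← ENNReal.ofReal_mul hB0.le]; exact hB _ (by positivity)
    · rw [← ENNReal.ofReal_mul hB0.le]; exact hB _ (by positivity)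
    · rw [← ENNReal.ofReal_mul hA₁0.le]; exact hA₁ _ (by positivity)
    · rw [← ENNReal.ofReal_mul hB₁0.le]; exact hB₁ _ (by positivity)
    · rw [← ENNReal.ofReal_mul hA₂0.le]; exact hA₂ _ (by positivity)
    · rw [← ENNReal.ofReal_mul hB₂0.le]; exact hB₂ _ (by positivity)
  rw [ENNReal.ofReal_le_ofReal_iff (by positivity)] at key2
  have hE : ∀ {x y : ℝ}, 0 < x → 0 < y → (2 * (x / y)) ^ (-κ) = (2 ^ κ)⁻¹ * ((x ^ κ)⁻¹ * y ^ κ) := by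
    intro x y hx hy
    rw [Real.rpow_neg (by positivity), Real.mul_rpow (by positivity) (by positivity),
      Real.div_rpow hx.le hy.le]
    field_simp
  have hsplit : ∀ {x : ℝ} (t : ℝ), 0 < x → x ^ (κ * (1 - t)) = x ^ κ * x ^ (-(κ * t)) := by
    intro x t hx
    rw [← Real.rpow_add hx]
    congr 1
    ring
  rw [hE ha' hb0', hE ha hb0] at key2
  rw [gaussianFactor, gaussianFactor, hsplit _ ha, hsplit _ ha', hsplit _ hb0, hsplit _ hb0']
  have hX : 0 < a ^ κ := by positivity
  have hX' : 0 < a' ^ κ := by positivity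
  have hY : 0 < b ^ κ := by positivity
  have hY' : 0 < b' ^ κ := by positivity
  have h2 : (0 : ℝ) < 2 ^ κ := by positivity
  -- The multiplier is the reciprocal of the product of energies on the left, so that side becomes
  -- 1.
  have := mul_le_mul_of_nonneg_left key2
    (by positivity : 0 ≤ (2 ^ κ) ^ 2 * (a ^ κ * (b ^ κ)⁻¹ * (a' ^ κ * (b' ^ κ)⁻¹)))
  refine le_trans (le_of_eq ?_) (this.trans (le_of_eq ?_))
  · field_simp
  · field_simp

end WeylMod

namespace WeylMod

open Filter Topology

variable {E : Type*} [NormedAddCommGroup E] [InnerProductSpace ℝ E] [FiniteDimensional ℝ E]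
  [MeasurableSpace E] [BorelSpace E]

/-! ### Necessity of the index conditions -/

/-- For positive α the right side tends to 0 as a → 0, whatever β is, because the factor with 1 - a
tends to 1. -/
theorem nonpos_of_one_le_mul_rpow {K α β : ℝ}
    (h : ∀ a : ℝ, 0 < a → a < 1 → 1 ≤ K * (a ^ α * (1 - a) ^ β)) : α ≤ 0 := by
  by_contra! hα
  have h1 : ContinuousAt (fun a : ℝ => K * (a ^ α * (1 - a) ^ β)) 0 := by
    refine continuousAt_const.mul ((Real.continuousAt_rpow_const _ _ (.inr hα.le)).mul ?_)
    exact (continuousAt_const.sub continuousAt_id).rpow_const (.inl (by simp))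
  have h2 : Tendsto (fun a : ℝ => K * (a ^ α * (1 - a) ^ β)) (𝓝[>] 0) (𝓝 0) := by
    have := h1.tendsto.mono_left (nhdsWithin_le_nhds (s := Set.Ioi 0))
    simpa [Real.zero_rpow hα.ne'] using this
  have h3 := ge_of_tendsto h2 (by
    filter_upwards [Ioo_mem_nhdsGT (zero_lt_one' ℝ)] with a ha
    exact h a ha.1 ha.2)
  linarith

theorem gaussianFactor_self (κ r s t t' : ℝ) {a : ℝ} (ha : 0 < a) :
    gaussianFactor κ r s t t' a a =
      2 ^ (κ * (s - r)) * a ^ (κ * (2 - (r + s + t + t'))) := by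
  have h1 : a * a / (a + a) = 2 ^ (-1 : ℝ) * a := by rw [Real.rpow_neg_one]; field_simp; norm_num
  rw [gaussianFactor, h1, ← two_mul, Real.mul_rpow two_pos.le ha.le,
    Real.mul_rpow (by positivity) ha.le, ← Real.rpow_mul two_pos.le]
  have h2 : (2 : ℝ) ^ (κ * (s - r)) = 2 ^ (-(κ * r)) * 2 ^ (-1 * -(κ * s)) := by
    rw [← Real.rpow_add two_pos]; congr 1; ring
  have h3 : a ^ (κ * (2 - (r + s + t + t'))) =
      a ^ (κ * (1 - t)) * a ^ (κ * (1 - t')) * a ^ (-(κ * r)) * a ^ (-(κ * s)) := by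
    simp only [← Real.rpow_add ha]; congr 1; ring
  rw [h2, h3]
  ring

/-- With the second parameter frozen, a + 1/2 stays away from 0 and the harmonic term is at least
a/3. Since r and s enter through negative powers, lower bounds for these bases are what is needed;
only s and t survive in the exponent of a. -/
theorem gaussianFactor_half_le {κ r s : ℝ} (hκ : 0 ≤ κ) (hr : 0 ≤ r) (hs : 0 ≤ s) (t t' : ℝ) {a : ℝ}
    (ha : 0 < a) (ha1 : a < 1) : gaussianFactor κ r s t t' a 2⁻¹ ≤
      (2⁻¹ ^ (κ * (1 - t')) * 2⁻¹ ^ (-(κ * r)) * 3⁻¹ ^ (-(κ * s))) * a ^ (κ * (1 - (s + t))) := by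
  have h1 : (a + 2⁻¹) ^ (-(κ * r)) ≤ 2⁻¹ ^ (-(κ * r)) :=
    Real.rpow_le_rpow_of_nonpos (by positivity) (by linarith) (by simp; positivity)
  have h2 : (a * 2⁻¹ / (a + 2⁻¹)) ^ (-(κ * s)) ≤ (3⁻¹ * a) ^ (-(κ * s)) := by
    refine Real.rpow_le_rpow_of_nonpos (by positivity) ?_ (by simp; positivity)
    rw [le_div_iff₀ (by positivity)]
    nlinarith
  have h3 : a ^ (κ * (1 - (s + t))) = a ^ (κ * (1 - t)) * a ^ (-(κ * s)) := by
    rw [← Real.rpow_add ha]; congr 1; ring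
  rw [Real.mul_rpow (by positivity) ha.le] at h2
  calc _ ≤ a ^ (κ * (1 - t)) * 2⁻¹ ^ (κ * (1 - t')) * 2⁻¹ ^ (-(κ * r)) *
        (3⁻¹ ^ (-(κ * s)) * a ^ (-(κ * s))) := by
        unfold gaussianFactor
        gcongr
    _ = _ := by rw [h3]; ring

theorem gaussianFactor_nonneg (κ r s t t' : ℝ) {a a' : ℝ} (ha : 0 < a) (ha' : 0 < a') :
    0 ≤ gaussianFactor κ r s t t' a a' := by
  unfold gaussianFactor
  positivity

/-- Both parameters tend to 0 together; the other factor stays bounded at 1. -/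
theorem two_le_of_one_le_gaussianFactor {κ r s t t' u u' K : ℝ} (hκ : 0 < κ)
    (h : ∀ a a' : ℝ, 0 < a → a < 1 → 0 < a' → a' < 1 →
      1 ≤ K * gaussianFactor κ r s t t' a a' * gaussianFactor κ r s u u' (1 - a) (1 - a')) :
    2 ≤ r + s + t + t' := by
  have h1 : κ * (2 - (r + s + t + t')) ≤ 0 := by
    refine nonpos_of_one_le_mul_rpow (K := K * (2 ^ (κ * (s - r)) * 2 ^ (κ * (s - r))))
      (β := κ * (2 - (r + s + u + u'))) fun a ha ha1 => (h a a ha ha1 ha ha1).trans_eq ?_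
    rw [gaussianFactor_self _ _ _ _ _ ha, gaussianFactor_self _ _ _ _ _ (by linarith)]
    ring
  nlinarith

/-- Only the first parameter tends to 0; the second stays at 1/2, which is fixed by a' ↦ 1 - a', so
one bound serves both factors. -/
theorem one_le_of_one_le_gaussianFactor {κ r s t t' u u' K : ℝ} (hκ : 0 < κ) (hr : 0 ≤ r)
    (hs : 0 ≤ s) (hK : 0 ≤ K) (h : ∀ a a' : ℝ, 0 < a → a < 1 → 0 < a' → a' < 1 →
      1 ≤ K * gaussianFactor κ r s t t' a a' * gaussianFactor κ r s u u' (1 - a) (1 - a')) :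
    1 ≤ s + t := by
  have h1 : κ * (1 - (s + t)) ≤ 0 := by
    refine nonpos_of_one_le_mul_rpow (β := κ * (1 - (s + u)))
      (K := K * (2⁻¹ ^ (κ * (1 - t')) * 2⁻¹ ^ (-(κ * r)) * 3⁻¹ ^ (-(κ * s))) *
        (2⁻¹ ^ (κ * (1 - u')) * 2⁻¹ ^ (-(κ * r)) * 3⁻¹ ^ (-(κ * s)))) fun a ha ha1 => ?_
    have h2 := h a 2⁻¹ ha ha1 (by norm_num) (by norm_num)
    rw [show (1 : ℝ) - 2⁻¹ = 2⁻¹ by norm_num] at h2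
    have h3 := gaussianFactor_half_le hκ.le hr hs t t' ha ha1
    have h4 := gaussianFactor_half_le (a := 1 - a) hκ.le hr hs u u' (by linarith) (by linarith)
    refine h2.trans ((mul_le_mul (mul_le_mul_of_nonneg_left h3 hK) h4
      (gaussianFactor_nonneg _ _ _ _ _ (by linarith) (by norm_num)) ?_).trans_eq ?_)
    · have := Real.rpow_nonneg ha.le (κ * (1 - (s + t)))
      positivity
    · ring
  nlinarith

theorem recip_nonneg (p : ℝ≥0∞) : 0 ≤ recip p := ENNReal.toReal_nonneg

theorem inv_eq_ofReal_recip {p : ℝ≥0∞} (hp : 1 ≤ p) : p⁻¹ = ENNReal.ofReal (recip p) :=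
  (ENNReal.ofReal_toReal (ENNReal.inv_ne_top.2 (one_pos.trans_le hp).ne')).symm

theorem recip_add_recip {p p' : ℝ≥0∞} [p.HolderConjugate p'] : recip p + recip p' = 1 := by
  have hp := ENNReal.HolderConjugate.one_le p p'
  have hp' := ENNReal.HolderConjugate.one_le p' p
  have h := ENNReal.HolderConjugate.inv_add_inv_eq_one p p'
  rw [inv_eq_ofReal_recip hp, inv_eq_ofReal_recip hp', ← ENNReal.ofReal_add (recip_nonneg _)
    (recip_nonneg _), ENNReal.ofReal_eq_one] at h
  exact h

theorem le_of_recip_le {p q : ℝ≥0∞} (hp : 1 ≤ p) (hq : 1 ≤ q) (h : recip q ≤ recip p) : p ≤ q := by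
  rw [← ENNReal.inv_le_inv, inv_eq_ofReal_recip hp, inv_eq_ofReal_recip hq]
  exact ENNReal.ofReal_le_ofReal h

/-- Boundedness of all Weyl operators with symbols in `M^{p,q}` forces the index conditions. -/
theorem admissibleExponents_of_bounded [Nontrivial E] {g : 𝓢(E, ℂ)} (hg : g ≠ 0) {Φ : 𝓢(Phase E, ℂ)}
    {p₁ q₁ p₂ q₂ p q : ℝ≥0∞}
    (hp₁ : 1 ≤ p₁) (hq₁ : 1 ≤ q₁) (hp₂ : 1 ≤ p₂) (hq₂ : 1 ≤ q₂) (hp : 1 ≤ p) (hq : 1 ≤ q)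
    {C : ℝ≥0} (h : ∀ (σ : 𝓢'(Phase E, ℂ)) (f : 𝓢(E, ℂ)),
      modulationNorm g p₂ q₂ (vWeight 0) (weylOperator σ f) ≤
        C * modulationNorm Φ p q (symbolWeight 0) σ *
          modulationNorm g p₁ q₁ (vWeight 0) (toDistribution f)) :
    AdmissibleExponents p₁ q₁ p₂ q₂ p q := by
  have hconj : ∀ {r : ℝ≥0∞}, 1 ≤ r → r.HolderConjugate r.conjExponent :=
    fun hr => ENNReal.HolderConjugate.conjExponent hr
  have := hconj hp₁
  have := hconj hq₁
  have := hconj hp₂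
  have := hconj hq₂
  have := hconj hp
  have := hconj hq
  have hone : ∀ {r : ℝ≥0∞}, 1 ≤ r → 1 ≤ r.conjExponent := fun {r} hr =>
    have := hconj hr
    ENNReal.HolderConjugate.one_le r.conjExponent r
  obtain ⟨K, hK, hb⟩ := exists_one_le_gaussianFactor (p₂' := p₂.conjExponent)
    (q₂' := q₂.conjExponent) hg hp₁ hq₁ hp₂ hq₂ hp hq (hone hp₂) (hone hq₂) h
  have hκ : 0 < halfDim E := by
    have : 0 < Module.finrank ℝ E := Module.finrank_pos
    unfold halfDim
    positivity
  have hr := recip_nonneg p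
  have hs := recip_nonneg q
  -- Replacing (a, a') by (1 - a, 1 - a') exchanges time and frequency, so p₁, p₂' trade places with
  -- q₁, q₂'.
  have hb₁ : ∀ a a' : ℝ, 0 < a → a < 1 → 0 < a' → a' < 1 → 1 ≤ K *
      gaussianFactor (halfDim E) (recip p) (recip q) (recip q₁) (recip q₂.conjExponent) a a' *
      gaussianFactor (halfDim E) (recip p) (recip q) (recip p₁) (recip p₂.conjExponent)
        (1 - a) (1 - a') := by
    intro a a' ha ha1 ha' ha1'
    have := hb (1 - a) (1 - a') (by linarith) (by linarith) (by linarith) (by linarith)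
    rw [sub_sub_cancel, sub_sub_cancel] at this
    refine this.trans_eq ?_
    ring
  -- Exchanging a and a' exchanges the roles of argument and dual test function, so p₁ trades places
  -- with p₂' and q₁ with q₂'.
  have hb₂ : ∀ a a' : ℝ, 0 < a → a < 1 → 0 < a' → a' < 1 → 1 ≤ K *
      gaussianFactor (halfDim E) (recip p) (recip q) (recip p₂.conjExponent) (recip p₁) a a' *
      gaussianFactor (halfDim E) (recip p) (recip q) (recip q₂.conjExponent) (recip q₁)
        (1 - a) (1 - a') := by
    intro a a' ha ha1 ha' ha1'
    rw [gaussianFactor_comm, gaussianFactor_comm _ _ _ _ _ (1 - a)]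
    exact hb a' a ha' ha1' ha ha1
  have hb₃ : ∀ a a' : ℝ, 0 < a → a < 1 → 0 < a' → a' < 1 → 1 ≤ K *
      gaussianFactor (halfDim E) (recip p) (recip q) (recip q₂.conjExponent) (recip q₁) a a' *
      gaussianFactor (halfDim E) (recip p) (recip q) (recip p₂.conjExponent) (recip p₁)
        (1 - a) (1 - a') := by
    intro a a' ha ha1 ha' ha1'
    rw [gaussianFactor_comm, gaussianFactor_comm _ _ _ _ _ (1 - a)]
    exact hb₁ a' a ha' ha1' ha ha1
  have i₁ := two_le_of_one_le_gaussianFactor hκ hb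
  have i₂ := two_le_of_one_le_gaussianFactor hκ hb₁
  have j₁ := one_le_of_one_le_gaussianFactor hκ hr hs hK.le hb
  have j₂ := one_le_of_one_le_gaussianFactor hκ hr hs hK.le hb₁
  have j₃ := one_le_of_one_le_gaussianFactor hκ hr hs hK.le hb₂
  have j₄ := one_le_of_one_le_gaussianFactor hκ hr hs hK.le hb₃
  have s₁ := recip_add_recip (p := p₁) (p' := p₁.conjExponent)
  have s₂ := recip_add_recip (p := q₁) (p' := q₁.conjExponent)
  have s₃ := recip_add_recip (p := p₂) (p' := p₂.conjExponent)
  have s₄ := recip_add_recip (p := q₂) (p' := q₂.conjExponent)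
  have s₅ := recip_add_recip (p := p) (p' := p.conjExponent)
  have s₆ := recip_add_recip (p := q) (p' := q.conjExponent)
  refine ⟨le_min ?_ ?_, le_min (le_min ?_ ?_) (le_min ?_ ?_)⟩
  · rw [inv_eq_ofReal_recip (hone hp), inv_eq_ofReal_recip (hone hq), inv_eq_ofReal_recip hp₁,
      inv_eq_ofReal_recip (hone hp₂), ← ENNReal.ofReal_add (recip_nonneg _) (recip_nonneg _),
      ← ENNReal.ofReal_add (recip_nonneg _) (recip_nonneg _)]
    exact ENNReal.ofReal_le_ofReal (by linarith)
  · rw [inv_eq_ofReal_recip (hone hp), inv_eq_ofReal_recip (hone hq), inv_eq_ofReal_recip hq₁,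
      inv_eq_ofReal_recip (hone hq₂), ← ENNReal.ofReal_add (recip_nonneg _) (recip_nonneg _),
      ← ENNReal.ofReal_add (recip_nonneg _) (recip_nonneg _)]
    exact ENNReal.ofReal_le_ofReal (by linarith)
  · exact le_of_recip_le hq (hone hp₁) (by linarith)
  · exact le_of_recip_le hq (hone hq₁) (by linarith)
  · exact le_of_recip_le hq hp₂ (by linarith)
  · exact le_of_recip_le hq hq₂ (by linarith)

end WeylMod

end


/-! ### The theorem: bounded extension, uniqueness and necessity. -/

theorem theorem5p1 (d : ℕ) (hd : 0 < d)
    (g : 𝓢(EuclideanSpace ℝ (Fin d), ℂ)) (hg : g ≠ 0)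
    (Φ : 𝓢(Phase (EuclideanSpace ℝ (Fin d)), ℂ)) (hΦ : Φ ≠ 0)
    (p₁ q₁ p₂ q₂ p q : ℝ≥0∞) (hp₁ : 1 ≤ p₁) (hq₁ : 1 ≤ q₁) (hp₂ : 1 ≤ p₂) (hq₂ : 1 ≤ q₂)
    (hp : 1 ≤ p) (hq : 1 ≤ q) :
    (∀ s : ℝ, 0 ≤ s → AdmissibleExponents p₁ q₁ p₂ q₂ p q →
      ∃ C : ℝ≥0, ∀ σ ∈ modulationSpace Φ p q (symbolWeight s),
        ∃ T : 𝓢'(EuclideanSpace ℝ (Fin d), ℂ) →ₗ.[ℂ] 𝓢'(EuclideanSpace ℝ (Fin d), ℂ),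
          IsBoundedExtension g p₁ q₁ p₂ q₂ (vWeight s) (weylOperator σ)
            (C * modulationNorm Φ p q (symbolWeight s) σ) T ∧
          ∀ (K : ℝ≥0) (T' : 𝓢'(EuclideanSpace ℝ (Fin d), ℂ) →ₗ.[ℂ]
              𝓢'(EuclideanSpace ℝ (Fin d), ℂ)),
            IsBoundedExtension g p₁ q₁ p₂ q₂ (vWeight s) (weylOperator σ) K T' →
              (p₁ ≠ ∞ → q₁ ≠ ∞ → T' = T) ∧
              ∀ (f : T.domain) (f' : T'.domain),
                (f' : 𝓢'(EuclideanSpace ℝ (Fin d), ℂ)) = f →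
                (f : 𝓢'(EuclideanSpace ℝ (Fin d), ℂ)) ∈ schwartzClosure g p₁ q₁ (vWeight s) →
                T' f' = T f) ∧
    ((∃ C : ℝ≥0, ∀ (σ : 𝓢'(Phase (EuclideanSpace ℝ (Fin d)), ℂ))
        (f : 𝓢(EuclideanSpace ℝ (Fin d), ℂ)),
        modulationNorm g p₂ q₂ (vWeight 0) (weylOperator σ f) ≤
          C * modulationNorm Φ p q (symbolWeight 0) σ *
            modulationNorm g p₁ q₁ (vWeight 0) (toDistribution f)) →
      AdmissibleExponents p₁ q₁ p₂ q₂ p q) := by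
  refine ⟨fun s hs hadm => ?_, ?_⟩
  · obtain ⟨C, hC⟩ := exists_isBoundedExtension hs hg hΦ hp₁ hq₁ hp₂ hq₂ hp hq hadm
    refine ⟨C, fun σ hσ => ?_⟩
    obtain ⟨T, hT⟩ := hC σ hσ
    have hm := isModerate_vWeight (E := EuclideanSpace ℝ (Fin d)) hs
    have hK : (C : ℝ≥0∞) * modulationNorm Φ p q (symbolWeight s) σ ≠ ∞ :=
      ENNReal.mul_ne_top ENNReal.coe_ne_top hσ.ne
    exact ⟨T, hT, fun K T' hT' => ⟨fun h1 h2 => hT.eq_of_ne_top hm hg hp₁ hq₁ hp₂ hq₂ h1 h2 hK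
      ENNReal.coe_ne_top hT', fun f f' he hf =>
        hT.eq_of_mem_schwartzClosure hm hg hp₂ hq₂ hK ENNReal.coe_ne_top hT' f f' he hf⟩⟩
  · rintro ⟨C, hC⟩
    have : Nonempty (Fin d) := ⟨⟨0, hd⟩⟩
    exact admissibleExponents_of_bounded hg hp₁ hq₁ hp₂ hq₂ hp hq hC
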